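/- Let $T$ be a tree on $n\ge 2$ vertices embedded in a metric space: a metric $c$ is given on $V(T)$, and every edge $(u,v)$ of $T$ has weight $\delta(u,v)=c(u,v)$. For a shortcut $(u,v)$, i.e. a pair of distinct vertices, let $T+(u,v)$ be the multigraph obtained from $T$ by adding one edge between $u$ and $v$ of weight $c(u,v)$ (possibly parallel to an edge of $T$). The diameter $\mathrm{diam}(G)$ of a weighted graph $G$ is the maximum, over all pairs of vertices, of the length of a shortest path between them. For $\varepsilon>0$, a $(1+\varepsilon)$-approximate optimal shortcut is a shortcut $(u,v)$ with $$\mathrm{diam}(T+(u,v))\le(1+\varepsilon)\,\mathrm{diam}(T+(u',v'))\quad\text{for all } u',v'\in V(T).$$ The machine is a deterministic real RAM. It stores integers of $O(\log(n+1/\varepsilon))$ bits and exact real numbers. Arithmetic operations, comparisons and memory accesses take unit time; rounding reals to integers is not available. The input consists of $n$, $\varepsilon$ and the $n-1$ edges of $T$ with their weights, listed in arbitrary order and orientation. The function $c$ is not part of the input; an oracle reports $c(u,v)$ for a queried pair $(u,v)$ in unit time. Then there is a single program which, for every such tree and every real $\varepsilon>0$, computes a $(1+\varepsilon)$-approximate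 optimal shortcut in $O\!\left(n+\frac1\varepsilon\log\frac1\varepsilon\right)$ time, using $O\!\left(n+\frac1\varepsilon\right)$ memory cells. The constants in the $O$-bounds are absolute. -/

import Mathlib

/-! ### Weighted graphs, distance and diameter -/

/-- `WalkLength E a b l`: there is a walk of total length `l` from `a` to `b` in the multigraph
in which `E x y w` says that some edge of weight `w` joins `x` to `y`. -/
inductive WalkLength {V : Type*} (E : V → V → ℝ → Prop) : V → V → ℝ → Prop
  | nil (a : V) : WalkLength E a a 0
  | cons {a b z : V} {w l : ℝ} :
      E a b w → WalkLength E b z l → WalkLength E a z (w + l)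

/-- The length of a shortest path. It is used for finite connected multigraphs with nonnegative
weights only; there the infimum over all walks is attained by a simple path. -/
noncomputable def wDist {V : Type*} (E : V → V → ℝ → Prop) (a b : V) : ℝ :=
  sInf {l : ℝ | WalkLength E a b l}

/-- The diameter: the maximum distance between two vertices (of a finite vertex set). -/
noncomputable def wDiam {V : Type*} (E : V → V → ℝ → Prop) : ℝ :=
  ⨆ p : V × V, wDist E p.1 p.2

/-! ### The Diameter-Optimal Augmentation Problem on trees -/

/-- An instance: a tree on `n` vertices, a positive weight for each edge of the tree, and a
nonnegative weight `c u v` for each possible shortcut `(u, v)`. -/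
structure Doap (n : ℕ) where
  tree : SimpleGraph (Fin n)
  isTree : tree.IsTree
  δ : Sym2 (Fin n) → ℝ
  δ_pos : ∀ e ∈ tree.edgeSet, 0 < δ e
  c : Fin n → Fin n → ℝ
  c_nonneg : ∀ u v, 0 ≤ c u v

/-- The edges of the multigraph `T + (u, v)`: the edges of the tree with their weights, and one
additional edge, possibly parallel to an edge of the tree, of weight `c u v` between `u` and `v`. -/
def Doap.addShortcut {n : ℕ} (I : Doap n) (u v : Fin n) (a b : Fin n) (w : ℝ) : Prop :=
  (I.tree.Adj a b ∧ w = I.δ s(a, b)) ∨ (s(a, b) = s(u, v) ∧ w = I.c u v)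

/-- The diameter of `T + (u, v)`. -/
noncomputable def Doap.diamWith {n : ℕ} (I : Doap n) (u v : Fin n) : ℝ :=
  wDiam (I.addShortcut u v)

/-- The tree is embedded in a metric space: the shortcut weights are the distances of a metric on
the vertices, and the weight of every edge of the tree is the distance of its two ends. -/
def Doap.EmbeddedInMetric {n : ℕ} (I : Doap n) : Prop :=
  ∃ m : MetricSpace (Fin n), (∀ u v, I.c u v = m.dist u v) ∧
    ∀ u v, I.tree.Adj u v → I.δ s(u, v) = m.dist u v

/-- `(u, v)` is a `(1 + ε)`-approximate solution: a shortcut for which the diameter of `T + (u, v)`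
is at most `1 + ε` times the diameter obtained with any other shortcut. -/
def Doap.IsApproxSolution {n : ℕ} (I : Doap n) (ε : ℝ) (u v : Fin n) : Prop :=
  u ≠ v ∧ ∀ u' v' : Fin n, I.diamWith u v ≤ (1 + ε) * I.diamWith u' v'

/-- An enumeration of the `n - 1` edges of a tree, in any order and with any orientation. -/
structure EdgeList {n : ℕ} (T : SimpleGraph (Fin n)) where
  src : Fin (n - 1) → Fin n
  dst : Fin (n - 1) → Fin n
  injective : Function.Injective fun k => s(src k, dst k)
  range_eq : Set.range (fun k => s(src k, dst k)) = T.edgeSet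

/-! ### The machine model: a real RAM with an oracle

A program is a fixed finite text over `k` integer registers, `k` real registers, `k` integer arrays
and `k` real arrays. Integers have bounded size (a word); reals are exact, with the four arithmetic
operations and comparisons, and cannot be rounded or converted to integers. Every operation, memory
access, test, assignment and oracle query is charged one unit of time. -/

/-- Integer expressions; `sub` is truncated and `div` rounds down. -/
inductive NExp (k : ℕ) : Type
  | const (v : ℕ)
  | reg (x : Fin k)
  | get (A : Fin k) (i : NExp k)
  | add (e f : NExp k)
  | sub (e f : NExp k)
  | mul (e f : NExp k)
  | div (e f : NExp k)

/-- Real expressions; `query i j` asks the oracle for the weight of the shortcut `(i, j)`. -/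
inductive RExp (k : ℕ) : Type
  | const (q : ℚ)
  | reg (x : Fin k)
  | get (A : Fin k) (i : NExp k)
  | query (i j : NExp k)
  | add (e f : RExp k)
  | sub (e f : RExp k)
  | mul (e f : RExp k)
  | div (e f : RExp k)

/-- Tests. -/
inductive BExp (k : ℕ) : Type
  | nle (e f : NExp k)
  | rle (e f : RExp k)
  | not (b : BExp k)
  | and (b b' : BExp k)

/-- Programs. -/
inductive Stmt (k : ℕ) : Type
  | skip
  | nset (x : Fin k) (e : NExp k)
  | rset (x : Fin k) (e : RExp k)
  | nput (A : Fin k) (i e : NExp k)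
  | rput (A : Fin k) (i : NExp k) (e : RExp k)
  | seq (p q : Stmt k)
  | ite (b : BExp k) (p q : Stmt k)
  | loop (b : BExp k) (p : Stmt k)

/-- The time needed to evaluate an expression: its number of operations and operands. -/
def NExp.cost {k : ℕ} : NExp k → ℕ
  | .const _ => 1
  | .reg _ => 1
  | .get _ i => 1 + i.cost
  | .add e f => 1 + e.cost + f.cost
  | .sub e f => 1 + e.cost + f.cost
  | .mul e f => 1 + e.cost + f.cost
  | .div e f => 1 + e.cost + f.cost

/-- The time needed to evaluate a real expression. -/
def RExp.cost {k : ℕ} : RExp k → ℕ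
  | .const _ => 1
  | .reg _ => 1
  | .get _ i => 1 + i.cost
  | .query i j => 1 + i.cost + j.cost
  | .add e f => 1 + e.cost + f.cost
  | .sub e f => 1 + e.cost + f.cost
  | .mul e f => 1 + e.cost + f.cost
  | .div e f => 1 + e.cost + f.cost

/-- The time needed to evaluate a test. -/
def BExp.cost {k : ℕ} : BExp k → ℕ
  | .nle e f => 1 + e.cost + f.cost
  | .rle e f => 1 + e.cost + f.cost
  | .not b => 1 + b.cost
  | .and b b' => 1 + b.cost + b'.cost

/-- The contents of the registers and of the arrays. -/
structure Store (k : ℕ) where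
  nreg : Fin k → ℕ
  rreg : Fin k → ℝ
  narr : Fin k → ℕ → ℕ
  rarr : Fin k → ℕ → ℝ

/-- A machine: an oracle for the pairs of numbers below `n`, the number `size` of cells of each
array, and the largest integer `word` that it can handle. Programs have no access to `size` and
`word`; a computation that would exceed them, or that queries the oracle outside its range, aborts
and yields no result. -/
structure Machine where
  n : ℕ
  oracle : Fin n → Fin n → ℝ
  size : ℕ
  word : ℕ

/-- The total number of memory cells (registers and array cells, integer and real) that are
available to a program with parameter `k`. -/
def Machine.cells (m : Machine) (k : ℕ) : ℕ := 2 * k * (m.size + 1)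

/-- An integer that fits into a word. -/
def Machine.fit (m : Machine) (v : ℕ) : Option ℕ := if v ≤ m.word then some v else none

/-- An address inside an array. -/
def Machine.addr (m : Machine) (i : ℕ) : Option ℕ := if i < m.size then some i else none

/-- The answer of the oracle. -/
noncomputable def Machine.ask (m : Machine) (i j : ℕ) : Option ℝ :=
  if h : i < m.n ∧ j < m.n then some (m.oracle ⟨i, h.1⟩ ⟨j, h.2⟩) else none

/-- The value of an integer expression, if its evaluation does not abort. -/
def NExp.eval {k : ℕ} (m : Machine) (s : Store k) : NExp k → Option ℕ
  | .const v => m.fit v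
  | .reg x => some (s.nreg x)
  | .get A i => do
      let a ← m.addr (← i.eval m s)
      return s.narr A a
  | .add e f => do m.fit ((← e.eval m s) + (← f.eval m s))
  | .sub e f => do m.fit ((← e.eval m s) - (← f.eval m s))
  | .mul e f => do m.fit ((← e.eval m s) * (← f.eval m s))
  | .div e f => do m.fit ((← e.eval m s) / (← f.eval m s))

/-- The value of a real expression, if its evaluation does not abort. -/
noncomputable def RExp.eval {k : ℕ} (m : Machine) (s : Store k) : RExp k → Option ℝ
  | .const q => some (q : ℝ)
  | .reg x => some (s.rreg x)
  | .get A i => do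
      let a ← m.addr (← i.eval m s)
      return s.rarr A a
  | .query i j => do m.ask (← i.eval m s) (← j.eval m s)
  | .add e f => do return (← e.eval m s) + (← f.eval m s)
  | .sub e f => do return (← e.eval m s) - (← f.eval m s)
  | .mul e f => do return (← e.eval m s) * (← f.eval m s)
  | .div e f => do return (← e.eval m s) / (← f.eval m s)

open Classical in
/-- The truth value of a test, if its evaluation does not abort. The second part of a conjunction
is evaluated only if the first part is true. -/
noncomputable def BExp.eval {k : ℕ} (m : Machine) (s : Store k) : BExp k → Option Bool
  | .nle e f => do return decide ((← e.eval m s) ≤ (← f.eval m s))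
  | .rle e f => do return decide ((← e.eval m s) ≤ (← f.eval m s))
  | .not b => do return !(← b.eval m s)
  | .and b b' => do if (← b.eval m s) then b'.eval m s else return false

/-- `Exec m p s t s'`: started in the store `s`, the program `p` halts on the machine `m` after
exactly `t` units of time without aborting, and leaves the store `s'`. -/
inductive Exec {k : ℕ} (m : Machine) : Stmt k → Store k → ℕ → Store k → Prop
  | skip (s : Store k) : Exec m .skip s 1 s
  | nset {s : Store k} {x : Fin k} {e : NExp k} {v : ℕ} :
      e.eval m s = some v →
      Exec m (.nset x e) s (1 + e.cost) { s with nreg := Function.update s.nreg x v }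
  | rset {s : Store k} {x : Fin k} {e : RExp k} {v : ℝ} :
      e.eval m s = some v →
      Exec m (.rset x e) s (1 + e.cost) { s with rreg := Function.update s.rreg x v }
  | nput {s : Store k} {A : Fin k} {i e : NExp k} {a v : ℕ} :
      i.eval m s = some a → a < m.size → e.eval m s = some v →
      Exec m (.nput A i e) s (1 + i.cost + e.cost)
        { s with narr := Function.update s.narr A (Function.update (s.narr A) a v) }
  | rput {s : Store k} {A : Fin k} {i : NExp k} {e : RExp k} {a : ℕ} {v : ℝ} :
      i.eval m s = some a → a < m.size → e.eval m s = some v →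
      Exec m (.rput A i e) s (1 + i.cost + e.cost)
        { s with rarr := Function.update s.rarr A (Function.update (s.rarr A) a v) }
  | seq {p q : Stmt k} {s₁ s₂ s₃ : Store k} {t t' : ℕ} :
      Exec m p s₁ t s₂ → Exec m q s₂ t' s₃ → Exec m (.seq p q) s₁ (t + t') s₃
  | ite_true {b : BExp k} {p q : Stmt k} {s s' : Store k} {t : ℕ} :
      b.eval m s = some true → Exec m p s t s' →
      Exec m (.ite b p q) s (1 + b.cost + t) s'
  | ite_false {b : BExp k} {p q : Stmt k} {s s' : Store k} {t : ℕ} :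
      b.eval m s = some false → Exec m q s t s' →
      Exec m (.ite b p q) s (1 + b.cost + t) s'
  | loop_true {b : BExp k} {p : Stmt k} {s₁ s₂ s₃ : Store k} {t t' : ℕ} :
      b.eval m s₁ = some true → Exec m p s₁ t s₂ → Exec m (.loop b p) s₂ t' s₃ →
      Exec m (.loop b p) s₁ (1 + b.cost + t + t') s₃
  | loop_false {b : BExp k} {p : Stmt k} {s : Store k} :
      b.eval m s = some false → Exec m (.loop b p) s (1 + b.cost) s

/-- The initial store for the input `(T, δ, ε)`: integer register `0` holds `n`, real register `0`
holds `ε`, cell `i` of the integer arrays `0` and `1` holds the two ends of the `i`-th edge of the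
list, cell `i` of the real array `0` holds the weight of that edge, and all else is `0`. The
shortcut weights are not part of the input; they are available through the oracle only. -/
noncomputable def Doap.input {n : ℕ} (I : Doap n) (L : EdgeList I.tree) (ε : ℝ) (k : ℕ) :
    Store (k + 2) where
  nreg x := if x = 0 then n else 0
  rreg x := if x = 0 then ε else 0
  narr A i :=
    if h : i < n - 1 then
      if A = 0 then (L.src ⟨i, h⟩ : ℕ) else if A = 1 then (L.dst ⟨i, h⟩ : ℕ) else 0
    else 0
  rarr A i :=
    if h : i < n - 1 then
      if A = 0 then I.δ s(L.src ⟨i, h⟩, L.dst ⟨i, h⟩) else 0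
    else 0

/-! Let `D` be the length of a longest path of the tree, with ends `a` and `b`. Every vertex `z`
hangs from this path: the branch that leads to it leaves the path at the position `pos` and has the
length `height`. By the four-point condition, two vertices with different positions have as their
distance the sum of their heights and the difference of their positions. As the path is longest, a
height is at most the distance from the position to either end. Hence a shortcut that achieves a
diameter `Δ < D` satisfies four linear inequalities in its weight and its two positions (`Good`):
one for the pair `a`, `b`, one for the pairs of `a` and a far vertex, one for those of `b`, and one
for the far pairs that hang between the two positions. A shortcut between branches counts as one
between their feet whose weight is increased by the two heights. Necessity is `good_of_sides`;
sufficiency, for vertices of the path, is `diamWith_le_max`.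

Among any three vertices two have a tree distance of at most the new diameter, and tree edges stay
shortest paths. This gives `D ≤ 3 * diam` for every shortcut (`dist_le_three_mul`), so that an
additive error of `7 * η` with `η = ε * D / 21` suffices.

The vertices are grouped greedily into clusters whose positions spread over at most `η`, with
centres on the path that are more than `η` apart. There are at most `21 / ε + 1` clusters, and no
real number has to be rounded. For a given `Δ` the far pairs enter the inequalities only through
three maxima (`Bounds`), computed from prefix and suffix maxima over the clusters by a pointer that
never moves back. A pair of centres that passes the test has the required property exactly
(`good_of_fits`), and a shortcut that achieves `Δ - 6 * η` yields a pair of centres that passes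
(`fits_of_good`). The metric is 1-Lipschitz along the path, so each of the four inequalities is
monotone in both indices, and four monotone pointers find a pair in time linear in the number of
clusters (`search_spec`). Binary search in `[0, D]` down to the length `η` takes logarithmically
many rounds and costs one more `η`.

The linear part needs no adjacency lists. Each vertex keeps its degree and the sum of the numbers of
its incident edges; at a leaf this sum is the number of the only edge. Leaves are stripped with a
queue, and the reverse order yields the distances from the root. Three such sweeps give `b`, `a` and
all distances from both. -/

/-! ### A program logic with time bounds -/

/-- The integer expression evaluates, without aborting, to a value that satisfies `Q`. -/
def NExp.wp {k : ℕ} (m : Machine) (s : Store k) : NExp k → (ℕ → Prop) → Prop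
  | .const v, Q => v ≤ m.word ∧ Q v
  | .reg x, Q => Q (s.nreg x)
  | .get A i, Q => i.wp m s fun a => a < m.size ∧ Q (s.narr A a)
  | .add e f, Q => e.wp m s fun a => f.wp m s fun b => a + b ≤ m.word ∧ Q (a + b)
  | .sub e f, Q => e.wp m s fun a => f.wp m s fun b => a - b ≤ m.word ∧ Q (a - b)
  | .mul e f, Q => e.wp m s fun a => f.wp m s fun b => a * b ≤ m.word ∧ Q (a * b)
  | .div e f, Q => e.wp m s fun a => f.wp m s fun b => a / b ≤ m.word ∧ Q (a / b)

theorem NExp.eval_of_wp {k : ℕ} {m : Machine} {s : Store k} (e : NExp k) :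
    ∀ {Q : ℕ → Prop}, e.wp m s Q → ∃ v, e.eval m s = some v ∧ Q v := by
  induction e with
  | const v => intro Q h; exact ⟨v, by simp [NExp.eval, Machine.fit, h.1], h.2⟩
  | reg x => intro Q h; exact ⟨_, rfl, h⟩
  | get A i ih =>
    intro Q h
    obtain ⟨a, ha, h1, h2⟩ := ih h
    exact ⟨_, by simp [NExp.eval, ha, Machine.addr, h1], h2⟩
  | add e f ihe ihf =>
    intro Q h
    obtain ⟨a, ha, h1⟩ := ihe h
    obtain ⟨b, hb, h2, h3⟩ := ihf h1
    exact ⟨_, by simp [NExp.eval, ha, hb, Machine.fit, h2], h3⟩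
  | sub e f ihe ihf =>
    intro Q h
    obtain ⟨a, ha, h1⟩ := ihe h
    obtain ⟨b, hb, h2, h3⟩ := ihf h1
    refine ⟨a - b, ?_, h3⟩
    simp only [NExp.eval, ha, hb, Machine.fit, Option.bind_eq_bind, Option.bind_some, if_pos h2]
  | mul e f ihe ihf =>
    intro Q h
    obtain ⟨a, ha, h1⟩ := ihe h
    obtain ⟨b, hb, h2, h3⟩ := ihf h1
    exact ⟨_, by simp [NExp.eval, ha, hb, Machine.fit, h2], h3⟩
  | div e f ihe ihf =>
    intro Q h
    obtain ⟨a, ha, h1⟩ := ihe h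
    obtain ⟨b, hb, h2, h3⟩ := ihf h1
    exact ⟨_, by simp [NExp.eval, ha, hb, Machine.fit, h2], h3⟩

/-- The real expression evaluates, without aborting, to a value that satisfies `Q`. -/
def RExp.wp {k : ℕ} (m : Machine) (s : Store k) : RExp k → (ℝ → Prop) → Prop
  | .const q, Q => Q (q : ℝ)
  | .reg x, Q => Q (s.rreg x)
  | .get A i, Q => i.wp m s fun a => a < m.size ∧ Q (s.rarr A a)
  | .query i j, Q => i.wp m s fun a => j.wp m s fun b =>
      ∃ h : a < m.n ∧ b < m.n, Q (m.oracle ⟨a, h.1⟩ ⟨b, h.2⟩)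
  | .add e f, Q => e.wp m s fun a => f.wp m s fun b => Q (a + b)
  | .sub e f, Q => e.wp m s fun a => f.wp m s fun b => Q (a - b)
  | .mul e f, Q => e.wp m s fun a => f.wp m s fun b => Q (a * b)
  | .div e f, Q => e.wp m s fun a => f.wp m s fun b => Q (a / b)

theorem RExp.eval_of_wp {k : ℕ} {m : Machine} {s : Store k} (e : RExp k) :
    ∀ {Q : ℝ → Prop}, e.wp m s Q → ∃ v, e.eval m s = some v ∧ Q v := by
  induction e with
  | const v => intro Q h; exact ⟨_, rfl, h⟩
  | reg x => intro Q h; exact ⟨_, rfl, h⟩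
  | get A i =>
    intro Q h
    obtain ⟨a, ha, h1, h2⟩ := i.eval_of_wp h
    exact ⟨_, by simp [RExp.eval, ha, Machine.addr, h1], h2⟩
  | query i j =>
    intro Q h
    obtain ⟨a, ha, h1⟩ := i.eval_of_wp h
    obtain ⟨b, hb, h2, h3⟩ := j.eval_of_wp h1
    exact ⟨_, by simp [RExp.eval, ha, hb, Machine.ask, h2], h3⟩
  | add e f ihe ihf | sub e f ihe ihf | mul e f ihe ihf | div e f ihe ihf =>
    intro Q h
    obtain ⟨a, ha, h1⟩ := ihe h
    obtain ⟨b, hb, h2⟩ := ihf h1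
    exact ⟨_, by simp [RExp.eval, ha, hb], h2⟩

/-- The test evaluates without aborting; if it is true then `Qt`, and if it is false then `Qf`. -/
def BExp.wp {k : ℕ} (m : Machine) (s : Store k) : BExp k → Prop → Prop → Prop
  | .nle e f, Qt, Qf => e.wp m s fun a => f.wp m s fun b => (a ≤ b → Qt) ∧ (b < a → Qf)
  | .rle e f, Qt, Qf => e.wp m s fun a => f.wp m s fun b => (a ≤ b → Qt) ∧ (b < a → Qf)
  | .not b, Qt, Qf => b.wp m s Qf Qt
  | .and b b', Qt, Qf => b.wp m s (b'.wp m s Qt Qf) Qf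

theorem BExp.eval_of_wp {k : ℕ} {m : Machine} {s : Store k} (b : BExp k) :
    ∀ {Qt Qf : Prop}, b.wp m s Qt Qf →
      (b.eval m s = some true ∧ Qt) ∨ (b.eval m s = some false ∧ Qf) := by
  induction b with
  | nle e f =>
    intro Qt Qf h
    obtain ⟨x, hx, h1⟩ := e.eval_of_wp h
    obtain ⟨y, hy, h2, h3⟩ := f.eval_of_wp h1
    rcases le_or_gt x y with hxy | hxy
    · exact .inl ⟨by simp [BExp.eval, hx, hy, hxy], h2 hxy⟩
    · exact .inr ⟨by simp [BExp.eval, hx, hy, hxy], h3 hxy⟩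
  | rle e f =>
    intro Qt Qf h
    obtain ⟨x, hx, h1⟩ := e.eval_of_wp h
    obtain ⟨y, hy, h2, h3⟩ := f.eval_of_wp h1
    rcases le_or_gt x y with hxy | hxy
    · exact .inl ⟨by simp [BExp.eval, hx, hy, hxy], h2 hxy⟩
    · exact .inr ⟨by simp [BExp.eval, hx, hy, hxy], h3 hxy⟩
  | not b ih =>
    intro Qt Qf h
    rcases ih h with ⟨h1, h2⟩ | ⟨h1, h2⟩
    · exact .inr ⟨by simp [BExp.eval, h1], h2⟩
    · exact .inl ⟨by simp [BExp.eval, h1], h2⟩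
  | and b b' ih ih' =>
    intro Qt Qf h
    rcases ih h with ⟨h1, h2⟩ | ⟨h1, h2⟩
    · rcases ih' h2 with ⟨h3, h4⟩ | ⟨h3, h4⟩
      · exact .inl ⟨by simp [BExp.eval, h1, h3], h4⟩
      · exact .inr ⟨by simp [BExp.eval, h1, h3], h4⟩
    · exact .inr ⟨by simp [BExp.eval, h1], h2⟩

/-- The program halts within `T` units of time in a store that satisfies `Q`. -/
def Tri {k : ℕ} (m : Machine) (p : Stmt k) (s : Store k) (T : ℕ) (Q : Store k → Prop) : Prop :=
  ∃ t s', Exec m p s t s' ∧ t ≤ T ∧ Q s'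

theorem Tri.mono {k : ℕ} {m : Machine} {p : Stmt k} {s : Store k} {T T' : ℕ}
    {Q Q' : Store k → Prop} (h : Tri m p s T Q) (hT : T ≤ T') (hQ : ∀ s, Q s → Q' s) :
    Tri m p s T' Q' := by
  obtain ⟨t, s', h1, h2, h3⟩ := h
  exact ⟨t, s', h1, h2.trans hT, hQ _ h3⟩

theorem Tri.seq {k : ℕ} {m : Machine} {p q : Stmt k} {s : Store k} {T T' : ℕ}
    {R Q : Store k → Prop} (h : Tri m p s T R) (h' : ∀ s, R s → Tri m q s T' Q) :
    Tri m (.seq p q) s (T + T') Q := by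
  obtain ⟨t, s', h1, h2, h3⟩ := h
  obtain ⟨t', s'', h4, h5, h6⟩ := h' _ h3
  exact ⟨_, _, .seq h1 h4, by omega, h6⟩

/-- The index of the invariant is the time still available. Every round consumes some of it, so
strong induction on the budget proves termination together with the bound. -/
theorem Tri.loop {k : ℕ} {m : Machine} {b : BExp k} {p : Stmt k} {Q : Store k → Prop}
    (Inv : ℕ → Store k → Prop)
    (h : ∀ r s, Inv r s → b.wp m s
      (∃ T, Tri m p s T fun s' => ∃ r', T + 1 + b.cost + r' ≤ r ∧ Inv r' s')
      (1 + b.cost ≤ r ∧ Q s)) (r : ℕ) (s : Store k) (hs : Inv r s) :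
    Tri m (.loop b p) s r Q := by
  induction r using Nat.strong_induction_on generalizing s with
  | _ r ih =>
    rcases b.eval_of_wp (h r s hs) with ⟨h1, T, t, s', h2, h3, r', h4, h5⟩ | ⟨h1, h2, h3⟩
    · obtain ⟨t', s'', h6, h7, h8⟩ := ih r' (by omega) s' h5
      exact ⟨_, _, .loop_true h1 h2 h6, by omega, h8⟩
    · exact ⟨_, _, .loop_false h1, h2, h3⟩

theorem NExp.wp_mono {k : ℕ} {m : Machine} {s : Store k} (e : NExp k) :
    ∀ {P P' : ℕ → Prop}, (∀ v, P v → P' v) → e.wp m s P → e.wp m s P' := by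
  induction e with
  | const v => intro P P' h hp; exact ⟨hp.1, h _ hp.2⟩
  | reg x => intro P P' h hp; exact h _ hp
  | get A i ih => intro P P' h; exact ih fun v hv => ⟨hv.1, h _ hv.2⟩
  | add e f ihe ihf | sub e f ihe ihf | mul e f ihe ihf | div e f ihe ihf =>
    intro P P' h; exact ihe fun v => ihf fun w hw => ⟨hw.1, h _ hw.2⟩

theorem RExp.wp_mono {k : ℕ} {m : Machine} {s : Store k} (e : RExp k) :
    ∀ {P P' : ℝ → Prop}, (∀ v, P v → P' v) → e.wp m s P → e.wp m s P' := by
  induction e with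
  | const v => intro P P' h hp; exact h _ hp
  | reg x => intro P P' h hp; exact h _ hp
  | get A i => intro P P' h; exact i.wp_mono fun v hv => ⟨hv.1, h _ hv.2⟩
  | query i j =>
    intro P P' h; exact i.wp_mono fun v => j.wp_mono fun w ⟨hw, hw'⟩ => ⟨hw, h _ hw'⟩
  | add e f ihe ihf | sub e f ihe ihf | mul e f ihe ihf | div e f ihe ihf =>
    intro P P' h; exact ihe fun v => ihf fun w => h _

theorem BExp.wp_mono {k : ℕ} {m : Machine} {s : Store k} (b : BExp k) :
    ∀ {A A' B B' : Prop}, (A → A') → (B → B') → b.wp m s A B → b.wp m s A' B' := by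
  induction b with
  | nle e f =>
    intro A A' B B' hA hB
    exact e.wp_mono fun v => f.wp_mono fun w hw => ⟨fun h => hA (hw.1 h), fun h => hB (hw.2 h)⟩
  | rle e f =>
    intro A A' B B' hA hB
    exact e.wp_mono fun v => f.wp_mono fun w hw => ⟨fun h => hA (hw.1 h), fun h => hB (hw.2 h)⟩
  | not b ih => intro A A' B B' hA hB; exact ih hB hA
  | and b b' ih ih' => intro A A' B B' hA hB; exact ih (ih' hA hB) hB

/-- A loop with `N` rounds. A round takes at most `T` units of time, and `c` additional units of
time for each unit by which it increases a quantity that never exceeds `Φ`. -/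
theorem Tri.loop_amortized {k : ℕ} {m : Machine} {b : BExp k} {p : Stmt k} {Q : Store k → Prop}
    (N T c Φ : ℕ) (Inv : ℕ → ℕ → Store k → Prop)
    (h : ∀ i φ s, Inv i φ s → b.wp m s
      (i < N ∧ ∃ φ', φ ≤ φ' ∧ φ' ≤ Φ ∧ Tri m p s (T + (φ' - φ) * c) (Inv (i + 1) φ')) (Q s))
    (s : Store k) (hs : Inv 0 0 s) :
    Tri m (.loop b p) s ((N + 1) * (T + 1 + b.cost) + Φ * c) Q := by
  -- The remaining budget: a fixed share for each outstanding round and for the final failing test,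
  -- and `c` for each unit by which the potential can still grow.
  refine Tri.loop (fun r s => ∃ i φ, i ≤ N ∧ φ ≤ Φ ∧
    r = (N - i + 1) * (T + 1 + b.cost) + (Φ - φ) * c ∧ Inv i φ s)
    ?_ _ s ⟨0, 0, by omega, by omega, by simp, hs⟩
  rintro r s ⟨i, φ, hi, hφ, rfl, hI⟩
  refine b.wp_mono ?_ ?_ (h i φ s hI)
  · rintro ⟨h1, φ', h2, h3, h4⟩
    refine ⟨_, h4.mono le_rfl fun s' h5 => ⟨_, ?_, i + 1, φ', h1, h3, rfl, h5⟩⟩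
    obtain ⟨j, rfl⟩ : ∃ j, N = i + 1 + j := ⟨N - (i + 1), by omega⟩
    obtain ⟨x, rfl⟩ := Nat.exists_eq_add_of_le h2
    obtain ⟨y, rfl⟩ := Nat.exists_eq_add_of_le h3
    rw [show i + 1 + j - i = j + 1 by omega, show i + 1 + j - (i + 1) = j by omega,
      show φ + x - φ = x by omega, show φ + x + y - φ = x + y by omega,
      show φ + x + y - (φ + x) = y by omega]
    apply le_of_eq
    ring
  · intro h1
    refine ⟨?_, h1⟩
    rw [add_mul, one_mul]
    omega

/-- A loop with `N` rounds, each of which takes at most `c` units of time. -/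
theorem Tri.loop_le {k : ℕ} {m : Machine} {b : BExp k} {p : Stmt k} {Q : Store k → Prop}
    (N T c : ℕ) (hc : T + 1 + b.cost ≤ c) (Inv : ℕ → Store k → Prop)
    (h : ∀ i s, Inv i s → b.wp m s (i < N ∧ Tri m p s T (Inv (i + 1))) (Q s))
    (s : Store k) (hs : Inv 0 s) :
    Tri m (.loop b p) s ((N + 1) * c) Q := by
  refine (Tri.loop_amortized N T 0 0 (fun i φ s => φ = 0 ∧ Inv i s) ?_ s ⟨rfl, hs⟩).mono ?_
    fun _ h => h
  · rintro i φ s ⟨rfl, hI⟩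
    refine b.wp_mono ?_ id (h i s hI)
    rintro ⟨h1, h2⟩
    exact ⟨h1, 0, le_rfl, le_rfl, h2.mono (by simp) fun s hs => ⟨rfl, hs⟩⟩
  · simpa using Nat.mul_le_mul_left (N + 1) hc

/-! ### Updates of the store, and what they leave unchanged -/

namespace Store

variable {k : ℕ} (s : Store k)

/-- Assign a value to an integer register. -/
def setN (x : Fin k) (v : ℕ) : Store k := { s with nreg := Function.update s.nreg x v }

/-- Assign a value to a real register. -/
def setR (x : Fin k) (v : ℝ) : Store k := { s with rreg := Function.update s.rreg x v }

/-- Assign a value to a cell of an integer array. -/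
def putN (A : Fin k) (a v : ℕ) : Store k :=
  { s with narr := Function.update s.narr A (Function.update (s.narr A) a v) }

/-- Assign a value to a cell of a real array. -/
def putR (A : Fin k) (a : ℕ) (v : ℝ) : Store k :=
  { s with rarr := Function.update s.rarr A (Function.update (s.rarr A) a v) }

@[simp] theorem setN_nreg (x y : Fin k) (v : ℕ) :
    (s.setN x v).nreg y = if y = x then v else s.nreg y := by
  simp [setN, Function.update_apply]

theorem setN_self (x : Fin k) : s.setN x (s.nreg x) = s := by
  simp [setN]

theorem setN_setN (x : Fin k) (v w : ℕ) : (s.setN x v).setN x w = s.setN x w := by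
  simp [setN]

@[simp] theorem setN_rreg (x : Fin k) (v : ℕ) : (s.setN x v).rreg = s.rreg := rfl

@[simp] theorem setN_narr (x : Fin k) (v : ℕ) : (s.setN x v).narr = s.narr := rfl

@[simp] theorem setN_rarr (x : Fin k) (v : ℕ) : (s.setN x v).rarr = s.rarr := rfl

@[simp] theorem setR_rreg (x y : Fin k) (v : ℝ) :
    (s.setR x v).rreg y = if y = x then v else s.rreg y := by
  simp [setR, Function.update_apply]

@[simp] theorem setR_nreg (x : Fin k) (v : ℝ) : (s.setR x v).nreg = s.nreg := rfl

@[simp] theorem setR_narr (x : Fin k) (v : ℝ) : (s.setR x v).narr = s.narr := rfl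

@[simp] theorem setR_rarr (x : Fin k) (v : ℝ) : (s.setR x v).rarr = s.rarr := rfl

@[simp] theorem putN_narr (A B : Fin k) (a v i : ℕ) :
    (s.putN A a v).narr B i = if B = A then if i = a then v else s.narr A i else s.narr B i := by
  simp only [putN, Function.update_apply]
  split_ifs <;> simp_all

@[simp] theorem putN_nreg (A : Fin k) (a v : ℕ) : (s.putN A a v).nreg = s.nreg := rfl

@[simp] theorem putN_rreg (A : Fin k) (a v : ℕ) : (s.putN A a v).rreg = s.rreg := rfl

@[simp] theorem putN_rarr (A : Fin k) (a v : ℕ) : (s.putN A a v).rarr = s.rarr := rfl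

@[simp] theorem putR_rarr (A B : Fin k) (a : ℕ) (v : ℝ) (i : ℕ) :
    (s.putR A a v).rarr B i = if B = A then if i = a then v else s.rarr A i else s.rarr B i := by
  simp only [putR, Function.update_apply]
  split_ifs <;> simp_all

@[simp] theorem putR_nreg (A : Fin k) (a : ℕ) (v : ℝ) : (s.putR A a v).nreg = s.nreg := rfl

@[simp] theorem putR_rreg (A : Fin k) (a : ℕ) (v : ℝ) : (s.putR A a v).rreg = s.rreg := rfl

@[simp] theorem putR_narr (A : Fin k) (a : ℕ) (v : ℝ) : (s.putR A a v).narr = s.narr := rfl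

end Store

/-- The stores agree except for the integer registers `N`, the real registers `R`, the integer
arrays `A` and the real arrays `B`. -/
structure Frame {k : ℕ} (N R A B : List (Fin k)) (s s' : Store k) : Prop where
  nreg : ∀ x ∉ N, s'.nreg x = s.nreg x
  rreg : ∀ x ∉ R, s'.rreg x = s.rreg x
  narr : ∀ x ∉ A, s'.narr x = s.narr x
  rarr : ∀ x ∉ B, s'.rarr x = s.rarr x

namespace Frame

variable {k : ℕ} {N R A B : List (Fin k)} {s s' s'' : Store k}

theorem refl (s : Store k) : Frame N R A B s s :=
  ⟨fun _ _ => rfl, fun _ _ => rfl, fun _ _ => rfl, fun _ _ => rfl⟩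

theorem trans {N' R' A' B' : List (Fin k)} (h : Frame N R A B s s')
    (h' : Frame N' R' A' B' s' s'') (hN : N' ⊆ N := by decide) (hR : R' ⊆ R := by decide)
    (hA : A' ⊆ A := by decide) (hB : B' ⊆ B := by decide) : Frame N R A B s s'' :=
  ⟨fun x hx => (h'.nreg x fun h => hx (hN h)).trans (h.nreg x hx),
    fun x hx => (h'.rreg x fun h => hx (hR h)).trans (h.rreg x hx),
    fun x hx => (h'.narr x fun h => hx (hA h)).trans (h.narr x hx),
    fun x hx => (h'.rarr x fun h => hx (hB h)).trans (h.rarr x hx)⟩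

theorem setN (h : Frame N R A B s s') {x : Fin k} {v : ℕ} (hx : x ∈ N) :
    Frame N R A B s (s'.setN x v) :=
  ⟨fun y hy => by rw [Store.setN_nreg, if_neg (by rintro rfl; exact hy hx), h.nreg y hy],
    h.rreg, h.narr, h.rarr⟩

theorem setR (h : Frame N R A B s s') {x : Fin k} {v : ℝ} (hx : x ∈ R) :
    Frame N R A B s (s'.setR x v) :=
  ⟨h.nreg, fun y hy => by
    rw [Store.setR_rreg, if_neg (by rintro rfl; exact hy hx), h.rreg y hy], h.narr, h.rarr⟩

theorem putN (h : Frame N R A B s s') {x : Fin k} {a v : ℕ} (hx : x ∈ A) :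
    Frame N R A B s (s'.putN x a v) :=
  ⟨h.nreg, h.rreg, fun y hy => by
    ext i; rw [Store.putN_narr, if_neg (by rintro rfl; exact hy hx), h.narr y hy], h.rarr⟩

theorem putR (h : Frame N R A B s s') {x : Fin k} {a : ℕ} {v : ℝ} (hx : x ∈ B) :
    Frame N R A B s (s'.putR x a v) :=
  ⟨h.nreg, h.rreg, h.narr, fun y hy => by
    ext i; rw [Store.putR_rarr, if_neg (by rintro rfl; exact hy hx), h.rarr y hy]⟩

end Frame

/-- A bound for the running time of a program without loops. -/
def Stmt.flatCost {k : ℕ} : Stmt k → ℕ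
  | .skip => 1
  | .nset _ e => 1 + e.cost
  | .rset _ e => 1 + e.cost
  | .nput _ i e => 1 + i.cost + e.cost
  | .rput _ i e => 1 + i.cost + e.cost
  | .seq p q => p.flatCost + q.flatCost
  | .ite b p q => 1 + b.cost + (p.flatCost + q.flatCost)
  -- A dummy value: `Stmt.wp` is `False` on loops, so `Tri.of_wp` never relies on it.
  | .loop _ _ => 0

/-- The program has no loops, and it halts without aborting in a store that satisfies `Q`. -/
def Stmt.wp {k : ℕ} (m : Machine) : Stmt k → (Store k → Prop) → Store k → Prop
  | .skip, Q, s => Q s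
  | .nset x e, Q, s => e.wp m s fun v => Q (s.setN x v)
  | .rset x e, Q, s => e.wp m s fun v => Q (s.setR x v)
  | .nput A i e, Q, s => i.wp m s fun a => a < m.size ∧ e.wp m s fun v =>
      Q (s.putN A a v)
  | .rput A i e, Q, s => i.wp m s fun a => a < m.size ∧ e.wp m s fun v =>
      Q (s.putR A a v)
  | .seq p q, Q, s => p.wp m (q.wp m Q) s
  | .ite b p q, Q, s => b.wp m s (p.wp m Q s) (q.wp m Q s)
  | .loop _ _, _, _ => False

theorem Tri.of_wp {k : ℕ} {m : Machine} (p : Stmt k) :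
    ∀ {Q : Store k → Prop} {s : Store k}, p.wp m Q s → Tri m p s p.flatCost Q := by
  induction p with
  | skip => intro Q s h; exact ⟨_, _, .skip s, le_rfl, h⟩
  | nset x e =>
    intro Q s h
    obtain ⟨v, hv, h1⟩ := e.eval_of_wp h
    exact ⟨_, _, .nset hv, le_rfl, h1⟩
  | rset x e =>
    intro Q s h
    obtain ⟨v, hv, h1⟩ := e.eval_of_wp h
    exact ⟨_, _, .rset hv, le_rfl, h1⟩
  | nput A i e =>
    intro Q s h
    obtain ⟨a, ha, h1, h2⟩ := i.eval_of_wp h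
    obtain ⟨v, hv, h3⟩ := e.eval_of_wp h2
    exact ⟨_, _, .nput ha h1 hv, le_rfl, h3⟩
  | rput A i e =>
    intro Q s h
    obtain ⟨a, ha, h1, h2⟩ := i.eval_of_wp h
    obtain ⟨v, hv, h3⟩ := e.eval_of_wp h2
    exact ⟨_, _, .rput ha h1 hv, le_rfl, h3⟩
  | seq p q ihp ihq => intro Q s h; exact (ihp h).seq fun s' => ihq
  | ite b p q ihp ihq =>
    intro Q s h
    rcases b.eval_of_wp h with ⟨h1, h2⟩ | ⟨h1, h2⟩
    · obtain ⟨t, s', h3, h4, h5⟩ := ihp h2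
      exact ⟨_, _, .ite_true h1 h3, by simp only [Stmt.flatCost]; omega, h5⟩
    · obtain ⟨t, s', h3, h4, h5⟩ := ihq h2
      exact ⟨_, _, .ite_false h1 h3, by simp only [Stmt.flatCost]; omega, h5⟩
  | loop b p => intro Q s h; exact h.elim

/-- A loop with `N` rounds whose body has no loops. -/
theorem Tri.loop_wp {k : ℕ} {m : Machine} {b : BExp k} {p : Stmt k} {Q : Store k → Prop}
    (N c : ℕ) (hc : p.flatCost + 1 + b.cost ≤ c) (Inv : ℕ → Store k → Prop)
    (h : ∀ i s, Inv i s → b.wp m s (i < N ∧ Tri m p s p.flatCost (Inv (i + 1))) (Q s))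
    (s : Store k) (hs : Inv 0 s) :
    Tri m (.loop b p) s ((N + 1) * c) Q :=
  Tri.loop_le N p.flatCost c hc Inv h s hs

theorem Tri.wp_seq {k : ℕ} {m : Machine} {p q : Stmt k} {s : Store k} {T : ℕ}
    {Q : Store k → Prop} (h : p.wp m (fun s' => Tri m q s' T Q) s) :
    Tri m (.seq p q) s (p.flatCost + T) Q :=
  (Tri.of_wp p h).seq fun _ h => h

/-! ### The metric of a tree -/

/-- The edges of the tree with their weights. -/
def Doap.treeEdge {n : ℕ} (I : Doap n) (a b : Fin n) (w : ℝ) : Prop :=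
  I.tree.Adj a b ∧ w = I.δ s(a, b)

/-- The distance in the tree. -/
noncomputable def Doap.dist {n : ℕ} (I : Doap n) (a b : Fin n) : ℝ := wDist I.treeEdge a b

/-- An order in which all vertices but `root` can be removed as leaves; `par x` is the neighbour
of `x` at the time of its removal. -/
structure Doap.Elimination {n : ℕ} (I : Doap n) (root : Fin n) (par : Fin n → Fin n)
    (rank : Fin n → ℕ) : Prop where
  inj : Function.Injective rank
  le_root : ∀ x, rank x ≤ rank root
  lt_par : ∀ x, x ≠ root → rank x < rank (par x)
  adj : ∀ x, x ≠ root → I.tree.Adj x (par x)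
  edge : ∀ x y, I.tree.Adj x y → (x ≠ root ∧ par x = y) ∨ (y ≠ root ∧ par y = x)

namespace Doap.Elimination

variable {n : ℕ} {I : Doap n} {root : Fin n} {par : Fin n → Fin n} {rank : Fin n → ℕ}

theorem ne_root (h : I.Elimination root par rank) {x y : Fin n} (hr : rank x < rank y) :
    x ≠ root := fun e => absurd (h.le_root y) (by rw [← e]; omega)

/-- The distance in the tree, computed along an elimination order. -/
noncomputable def recDist (h : I.Elimination root par rank) (x y : Fin n) : ℝ :=
  if x = y then 0
  -- The vertex of smaller rank is removed first, and at that time its parent is its only neighbour;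
  -- the path must leave it through the parent.
  else if _hr : rank x < rank y then I.δ s(x, par x) + h.recDist (par x) y
  else if _hr : rank y < rank x then I.δ s(y, par y) + h.recDist x (par y)
  -- Never reached, because `rank` is injective.
  else 0
termination_by (rank root - rank x) + (rank root - rank y)
decreasing_by
  · have h1 := h.lt_par x (h.ne_root _hr)
    have h2 := h.le_root (par x)
    omega
  · have h1 := h.lt_par y (h.ne_root _hr)
    have h2 := h.le_root (par y)
    omega

variable (h : I.Elimination root par rank)

theorem recDist_self (x : Fin n) : h.recDist x x = 0 := by
  rw [recDist]; simp

theorem recDist_left {x y : Fin n} (hr : rank x < rank y) :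
    h.recDist x y = I.δ s(x, par x) + h.recDist (par x) y := by
  rw [recDist, if_neg (by rintro rfl; omega), dif_pos hr]

theorem recDist_right {x y : Fin n} (hr : rank y < rank x) :
    h.recDist x y = I.δ s(y, par y) + h.recDist x (par y) := by
  rw [recDist, if_neg (by rintro rfl; omega), dif_neg (by omega), dif_pos hr]

include h

theorem weight_pos {x y : Fin n} (hr : rank x < rank y) : 0 < I.δ s(x, par x) :=
  I.δ_pos _ (h.adj x (h.ne_root hr))

/-- Induction over families of vertices: a vertex may be replaced by its parent. -/
theorem rank_par_lt {x y : Fin n} (hr : rank x < rank y) :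
    rank root - rank (par x) < rank root - rank x := by
  have h1 := h.lt_par x (h.ne_root hr)
  have h2 := h.le_root (par x)
  omega

theorem eq_or_lt (x y : Fin n) : x = y ∨ rank x < rank y ∨ rank y < rank x := by
  rcases lt_trichotomy (rank x) (rank y) with h1 | h1 | h1
  · exact .inr (.inl h1)
  · exact .inl (h.inj h1)
  · exact .inr (.inr h1)

theorem recDist_comm (x y : Fin n) : h.recDist x y = h.recDist y x := by
  induction hN : (rank root - rank x) + (rank root - rank y) using Nat.strong_induction_on
    generalizing x y with
  | _ N ih =>
    rcases h.eq_or_lt x y with rfl | hr | hr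
    · rfl
    · rw [h.recDist_left hr, h.recDist_right hr,
        ih _ (by have := h.rank_par_lt hr; omega) _ _ rfl]
    · rw [h.recDist_left hr, h.recDist_right hr,
        ih _ (by have := h.rank_par_lt hr; omega) _ _ rfl]

theorem recDist_nonneg (x y : Fin n) : 0 ≤ h.recDist x y := by
  induction hN : (rank root - rank x) + (rank root - rank y) using Nat.strong_induction_on
    generalizing x y with
  | _ N ih =>
    rcases h.eq_or_lt x y with rfl | hr | hr
    · rw [h.recDist_self]
    · rw [h.recDist_left hr]
      have := ih _ (by have := h.rank_par_lt hr; omega) (par x) y rfl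
      linarith [h.weight_pos hr]
    · rw [h.recDist_right hr]
      have := ih _ (by have := h.rank_par_lt hr; omega) x (par y) rfl
      linarith [h.weight_pos hr]

theorem recDist_pos {x y : Fin n} (hxy : x ≠ y) : 0 < h.recDist x y := by
  rcases h.eq_or_lt x y with rfl | hr | hr
  · exact absurd rfl hxy
  · rw [h.recDist_left hr]
    linarith [h.weight_pos hr, h.recDist_nonneg (par x) y]
  · rw [h.recDist_right hr]
    linarith [h.weight_pos hr, h.recDist_nonneg x (par y)]

/-- For distinct vertices, the one of least rank is replaced by its parent. Its two distances drop
by the same edge weight, which keeps the inequality if it is an outer vertex; if it is `y`, only the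
right side drops. -/
theorem recDist_triangle (x y z : Fin n) :
    h.recDist x z ≤ h.recDist x y + h.recDist y z := by
  induction hN : (rank root - rank x) + (rank root - rank y) + (rank root - rank z)
    using Nat.strong_induction_on generalizing x y z with
  | _ N ih =>
    rcases h.eq_or_lt x z with rfl | hxz
    · rw [h.recDist_self]; linarith [h.recDist_nonneg x y, h.recDist_nonneg y x]
    rcases h.eq_or_lt x y with rfl | hxy
    · rw [h.recDist_self]; linarith
    rcases h.eq_or_lt y z with rfl | hyz
    · rw [h.recDist_self]; linarith
    have hcases : (rank x < rank y ∧ rank x < rank z) ∨ (rank y < rank x ∧ rank y < rank z) ∨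
      (rank z < rank x ∧ rank z < rank y) := by omega
    rcases hcases with ⟨h1, h2⟩ | ⟨h1, h2⟩ | ⟨h1, h2⟩
    · rw [h.recDist_left h1, h.recDist_left h2]
      linarith [ih _ (by have := h.rank_par_lt h1; omega) (par x) y z rfl]
    · rw [h.recDist_right h1, h.recDist_left h2]
      linarith [ih _ (by have := h.rank_par_lt h1; omega) x (par y) z rfl, h.weight_pos h1]
    · rw [h.recDist_right h1, h.recDist_right h2]
      linarith [ih _ (by have := h.rank_par_lt h1; omega) x y (par z) rfl]

/-- Each of the three sums contains every vertex once. Replacing the vertex of least rank by its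
parent therefore lowers all three by the same weight. When two vertices coincide, the claim is a
triangle inequality or trivial. -/
theorem recDist_four_point (x y z w : Fin n) :
    h.recDist x y + h.recDist z w ≤ h.recDist x z + h.recDist y w ∨
    h.recDist x y + h.recDist z w ≤ h.recDist x w + h.recDist y z := by
  induction hN : (rank root - rank x) + (rank root - rank y) + (rank root - rank z) +
    (rank root - rank w) using Nat.strong_induction_on generalizing x y z w with
  | _ N ih =>
    rcases h.eq_or_lt x y with rfl | hxy
    · left; rw [h.recDist_self, h.recDist_comm x z]; linarith [h.recDist_triangle z x w]
    rcases h.eq_or_lt z w with rfl | hzw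
    · left; rw [h.recDist_self, h.recDist_comm y z]; linarith [h.recDist_triangle x z y]
    rcases h.eq_or_lt x z with rfl | hxz
    · right; rw [h.recDist_comm y x]; linarith
    rcases h.eq_or_lt x w with rfl | hxw
    · left; rw [h.recDist_comm y x, h.recDist_comm z x]; linarith
    rcases h.eq_or_lt y z with rfl | hyz
    · left; linarith
    rcases h.eq_or_lt y w with rfl | hyw
    · right; rw [h.recDist_comm z y]
    have hcases : (rank x < rank y ∧ rank x < rank z ∧ rank x < rank w) ∨
      (rank y < rank x ∧ rank y < rank z ∧ rank y < rank w) ∨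
      (rank z < rank x ∧ rank z < rank y ∧ rank z < rank w) ∨
      (rank w < rank x ∧ rank w < rank y ∧ rank w < rank z) := by omega
    rcases hcases with ⟨h1, h2, h3⟩ | ⟨h1, h2, h3⟩ | ⟨h1, h2, h3⟩ | ⟨h1, h2, h3⟩
    · rw [h.recDist_left h1, h.recDist_left h2, h.recDist_left h3]
      rcases ih _ (by have := h.rank_par_lt h1; omega) (par x) y z w rfl with h4 | h4
      · left; linarith
      · right; linarith
    · rw [h.recDist_right h1, h.recDist_left h2, h.recDist_left h3]
      rcases ih _ (by have := h.rank_par_lt h1; omega) x (par y) z w rfl with h4 | h4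
      · left; linarith
      · right; linarith
    · rw [h.recDist_right h1, h.recDist_right h2, h.recDist_left h3]
      rcases ih _ (by have := h.rank_par_lt h1; omega) x y (par z) w rfl with h4 | h4
      · left; linarith
      · right; linarith
    · rw [h.recDist_right h1, h.recDist_right h2, h.recDist_right h3]
      rcases ih _ (by have := h.rank_par_lt h1; omega) x y z (par w) rfl with h4 | h4
      · left; linarith
      · right; linarith

theorem recDist_par {x : Fin n} (hx : x ≠ root) : h.recDist x (par x) = I.δ s(x, par x) := by
  rw [h.recDist_left (h.lt_par x hx), h.recDist_self, add_zero]

theorem recDist_adj {x y : Fin n} (hxy : I.tree.Adj x y) : h.recDist x y = I.δ s(x, y) := by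
  rcases h.edge x y hxy with ⟨h1, rfl⟩ | ⟨h1, rfl⟩
  · exact h.recDist_par h1
  · rw [h.recDist_comm, h.recDist_par h1, Sym2.eq_swap]

omit h in
theorem _root_.WalkLength.concat {V : Type*} {E : V → V → ℝ → Prop} {a b z : V} {l w : ℝ}
    (hw : WalkLength E a b l) (he : E b z w) : WalkLength E a z (l + w) := by
  induction hw with
  | nil a => simpa [add_comm] using WalkLength.cons he (.nil z)
  | cons h1 h2 ih => rw [add_assoc]; exact .cons h1 (ih he)

theorem walkLength_recDist (x y : Fin n) : WalkLength I.treeEdge x y (h.recDist x y) := by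
  induction hN : (rank root - rank x) + (rank root - rank y) using Nat.strong_induction_on
    generalizing x y with
  | _ N ih =>
    rcases h.eq_or_lt x y with rfl | hr | hr
    · rw [h.recDist_self]; exact .nil x
    · rw [h.recDist_left hr]
      exact .cons ⟨h.adj x (h.ne_root hr), rfl⟩ (ih _ (by have := h.rank_par_lt hr; omega) _ _ rfl)
    · rw [h.recDist_right hr, add_comm]
      refine (ih _ (by have := h.rank_par_lt hr; omega) _ _ rfl).concat
        ⟨(h.adj y (h.ne_root hr)).symm, by rw [Sym2.eq_swap]⟩

/-- The recursion follows an actual walk, and by the triangle inequality no walk is shorter; the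
infimum is attained. -/
theorem dist_eq (x y : Fin n) : I.dist x y = h.recDist x y := by
  have hlb : ∀ l, WalkLength I.treeEdge x y l → h.recDist x y ≤ l := by
    intro l hl
    induction hl with
    | nil a => rw [h.recDist_self]
    | @cons a b z w l he hw ih =>
      have := h.recDist_triangle a b z
      rw [h.recDist_adj he.1, ← he.2] at this
      linarith
  refine le_antisymm (csInf_le ⟨_, hlb⟩ (h.walkLength_recDist x y))
    (le_csInf ⟨_, h.walkLength_recDist x y⟩ hlb)

theorem dist_self (x : Fin n) : I.dist x x = 0 := by rw [h.dist_eq, h.recDist_self]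

theorem dist_comm (x y : Fin n) : I.dist x y = I.dist y x := by
  rw [h.dist_eq, h.dist_eq, h.recDist_comm]

theorem dist_pos {x y : Fin n} (hxy : x ≠ y) : 0 < I.dist x y := by
  rw [h.dist_eq]; exact h.recDist_pos hxy

theorem dist_triangle (x y z : Fin n) : I.dist x z ≤ I.dist x y + I.dist y z := by
  simp only [h.dist_eq]; exact h.recDist_triangle x y z

theorem dist_four_point (x y z w : Fin n) :
    I.dist x y + I.dist z w ≤ I.dist x z + I.dist y w ∨
    I.dist x y + I.dist z w ≤ I.dist x w + I.dist y z := by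
  simp only [h.dist_eq]; exact h.recDist_four_point x y z w

theorem dist_adj {x y : Fin n} (hxy : I.tree.Adj x y) : I.dist x y = I.δ s(x, y) := by
  rw [h.dist_eq, h.recDist_adj hxy]

theorem walkLength_dist (x y : Fin n) : WalkLength I.treeEdge x y (I.dist x y) := by
  rw [h.dist_eq]; exact h.walkLength_recDist x y

/-- The distance from `x` to a vertex that is removed later. -/
theorem dist_of_rank_lt {x y : Fin n} (hr : rank x < rank y) :
    I.dist x y = I.δ s(x, par x) + I.dist (par x) y := by
  rw [h.dist_eq, h.dist_eq, h.recDist_left hr]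

/-- Every vertex lies on one side of the edge between `x` and its parent. -/
theorem dist_eq_add_or_eq_sub {x : Fin n} (hx : x ≠ root) (v : Fin n) :
    I.dist x v = I.dist (par x) v + I.δ s(x, par x) ∨
    I.dist x v = I.dist (par x) v - I.δ s(x, par x) := by
  have hpx := h.lt_par x hx
  -- A vertex removed after `x` lies beyond the parent, and `x` itself on the other side. A vertex
  -- removed before `x` is on the same side as its own parent, since both distances shrink by the
  -- same edge.
  induction hN : rank root - rank v using Nat.strong_induction_on generalizing v with
  | _ N ih =>
    rcases h.eq_or_lt x v with rfl | hr | hr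
    · right
      rw [h.dist_self, h.dist_comm, h.dist_eq, h.recDist_par hx, sub_self]
    · left; rw [h.dist_of_rank_lt hr, add_comm]
    · have h1 := h.dist_of_rank_lt hr
      have h2 := h.dist_of_rank_lt (hr.trans hpx)
      rw [h.dist_comm x v, h.dist_comm (par x) v, h1, h2, h.dist_comm (par v), h.dist_comm (par v)]
      rcases ih _ (by have := h.rank_par_lt hr; omega) (par v) rfl with h3 | h3
      · left; linarith
      · right; linarith

end Doap.Elimination

/-! ### The diameter of a tree with a shortcut -/

namespace Doap

variable {n : ℕ} {I : Doap n}

/-- The length of a shortest walk from `y` to `z` in the tree, with or without the shortcut. -/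
noncomputable def via (I : Doap n) (u v y z : Fin n) : ℝ :=
  min (I.dist y z)
    (min (I.dist y u + I.c u v + I.dist v z) (I.dist y v + I.c u v + I.dist u z))

/-- What the proofs use of a tree that is embedded in a metric space. -/
structure MetricTree (I : Doap n) : Prop where
  dist_self : ∀ x, I.dist x x = 0
  dist_comm : ∀ x y, I.dist x y = I.dist y x
  dist_pos : ∀ x y, x ≠ y → 0 < I.dist x y
  dist_triangle : ∀ x y z, I.dist x z ≤ I.dist x y + I.dist y z
  four_point : ∀ x y z w,
    I.dist x y + I.dist z w ≤ I.dist x z + I.dist y w ∨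
    I.dist x y + I.dist z w ≤ I.dist x w + I.dist y z
  walk : ∀ x y, WalkLength I.treeEdge x y (I.dist x y)
  dist_adj : ∀ x y, I.tree.Adj x y → I.dist x y = I.δ s(x, y)
  adj_le : ∀ x y, I.tree.Adj x y → I.dist x y ≤ I.c x y
  c_comm : ∀ x y, I.c x y = I.c y x
  c_triangle : ∀ x y z, I.c x z ≤ I.c x y + I.c y z
  c_le : ∀ x y, I.c x y ≤ I.dist x y

theorem Elimination.metricTree {root : Fin n} {par : Fin n → Fin n} {rank : Fin n → ℕ}
    (h : I.Elimination root par rank) (hI : I.EmbeddedInMetric) : I.MetricTree := by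
  obtain ⟨m, hc, hδ⟩ := hI
  have hle : ∀ {x y l}, WalkLength I.treeEdge x y l → I.c x y ≤ l := by
    intro x y l hw
    induction hw with
    | nil a => rw [hc]; exact (m.dist_self a).le
    | @cons a b z w l he hw ih =>
      have h1 := m.dist_triangle a b z
      rw [← hc, ← hc, ← hc] at h1
      have h2 := hδ _ _ he.1
      rw [← hc, ← he.2] at h2
      linarith
  exact
    { dist_self := h.dist_self
      dist_comm := h.dist_comm
      dist_pos := fun _ _ => h.dist_pos
      dist_triangle := h.dist_triangle
      four_point := h.dist_four_point
      walk := h.walkLength_dist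
      dist_adj := fun _ _ => h.dist_adj
      adj_le := fun x y hxy => by rw [h.dist_adj hxy, hδ x y hxy, hc]
      c_comm := fun x y => by rw [hc, hc]; exact m.dist_comm x y
      c_triangle := fun x y z => by rw [hc, hc, hc]; exact m.dist_triangle x y z
      c_le := fun x y => hle (h.walkLength_dist x y) }

namespace MetricTree

variable (h : I.MetricTree)
include h

theorem dist_nonneg (x y : Fin n) : 0 ≤ I.dist x y := by
  rcases eq_or_ne x y with rfl | hxy
  · rw [h.dist_self]
  · exact (h.dist_pos x y hxy).le

/-- One use of the shortcut is enough: by induction over walks, `via` drops by at most the weight of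
the first edge. If that edge is the shortcut, a second crossing could only add a nonnegative weight.
-/
theorem wDist_addShortcut (u v y z : Fin n) :
    wDist (I.addShortcut u v) y z = I.via u v y z := by
  have hmap : ∀ {a b l}, WalkLength I.treeEdge a b l → WalkLength (I.addShortcut u v) a b l := by
    intro a b l hw
    induction hw with
    | nil a => exact .nil a
    | cons he hw ih => exact .cons (.inl he) ih
  have happ : ∀ {a b c l l'}, WalkLength (I.addShortcut u v) a b l →
      WalkLength (I.addShortcut u v) b c l' → WalkLength (I.addShortcut u v) a c (l + l') := by
    intro a b c l l' hw hw'
    induction hw with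
    | nil a => rwa [zero_add]
    | cons he hw ih => rw [add_assoc]; exact .cons he (ih hw')
  have hlb : ∀ l, WalkLength (I.addShortcut u v) y z l → I.via u v y z ≤ l := by
    intro l hl
    induction hl with
    | nil a => exact (min_le_left _ _).trans (h.dist_self a).le
    | @cons a b z w l he hw ih =>
      refine le_trans ?_ (add_le_add_right ih w)
      simp only [via]
      rcases he with ⟨h1, h2⟩ | ⟨h1, h2⟩
      · rw [← h.dist_adj _ _ h1] at h2
        have t1 := h.dist_triangle a b z
        have t2 := h.dist_triangle a b u
        have t3 := h.dist_triangle a b v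
        subst h2
        simp only [← min_add_add_left]
        refine min_le_min (by linarith) (min_le_min (by linarith) (by linarith))
      · have hc := I.c_nonneg u v
        rw [Sym2.eq_iff] at h1
        subst h2
        simp only [← min_add_add_left]
        rcases h1 with ⟨rfl, rfl⟩ | ⟨rfl, rfl⟩
        · rw [h.dist_self]
          refine le_min ?_ (le_min ?_ ?_)
          · refine (min_le_right _ _).trans ((min_le_left _ _).trans ?_); linarith
          · refine (min_le_right _ _).trans ((min_le_left _ _).trans ?_)
            linarith [h.dist_nonneg b a]
          · refine (min_le_left _ _).trans ?_; rw [h.dist_self]; linarith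
        · rw [h.dist_self]
          refine le_min ?_ (le_min ?_ ?_)
          · refine (min_le_right _ _).trans ((min_le_right _ _).trans ?_); linarith
          · refine (min_le_left _ _).trans ?_; rw [h.dist_self]; linarith
          · refine (min_le_right _ _).trans ((min_le_right _ _).trans ?_)
            linarith [h.dist_nonneg b a]
  refine le_antisymm ?_ (le_csInf ⟨_, hmap (h.walk y z)⟩ hlb)
  refine le_min (csInf_le ⟨_, hlb⟩ (hmap (h.walk y z))) (le_min (csInf_le ⟨_, hlb⟩ ?_)
    (csInf_le ⟨_, hlb⟩ ?_))
  · exact happ ((hmap (h.walk y u)).concat (.inr ⟨rfl, rfl⟩)) (hmap (h.walk v z))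
  · exact happ ((hmap (h.walk y v)).concat (.inr ⟨Sym2.eq_swap, rfl⟩)) (hmap (h.walk u z))

theorem via_le_diamWith (u v y z : Fin n) : I.via u v y z ≤ I.diamWith u v := by
  rw [← h.wDist_addShortcut]
  exact le_ciSup (f := fun p : Fin n × Fin n => wDist (I.addShortcut u v) p.1 p.2)
    (Set.finite_range _).bddAbove (y, z)

theorem diamWith_le [NeZero n] {u v : Fin n} {B : ℝ} (hB : ∀ y z, I.via u v y z ≤ B) :
    I.diamWith u v ≤ B :=
  ciSup_le fun p => by rw [h.wDist_addShortcut]; exact hB p.1 p.2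

/-- A pair whose distance exceeds the diameter lies on different sides of the shortcut. -/
theorem sides {u v y z : Fin n} (hyz : I.diamWith u v < I.dist y z) :
    (I.dist y u + I.c u v < I.dist y v ∧ I.dist z v + I.c u v < I.dist z u ∧
      I.dist y u + I.c u v + I.dist v z ≤ I.diamWith u v) ∨
    (I.dist y v + I.c u v < I.dist y u ∧ I.dist z u + I.c u v < I.dist z v ∧
      I.dist y v + I.c u v + I.dist u z ≤ I.diamWith u v) := by
  have h1 := h.via_le_diamWith u v y z
  rw [via, min_le_iff, min_le_iff] at h1
  -- The winning detour is shorter than the tree distance of `y` and `z`. Comparing it with the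
  -- triangle inequalities through `v` and through `u` cancels one leg and leaves the two strict
  -- inequalities.
  have t1 := h.dist_triangle y v z
  have t2 := h.dist_triangle y u z
  rw [h.dist_comm z u, h.dist_comm z v]
  rcases h1 with h1 | h1 | h1
  · linarith
  · left; exact ⟨by linarith, by linarith, h1⟩
  · right; exact ⟨by linarith, by linarith, h1⟩

/-- Among three vertices, two have a distance in the tree of at most the diameter. -/
theorem triple (u v x y z : Fin n) : I.dist x y ≤ I.diamWith u v ∨ I.dist x z ≤ I.diamWith u v ∨
    I.dist y z ≤ I.diamWith u v := by
  by_contra! hc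
  have hn := I.c_nonneg u v
  -- Each far pair is separated by the shortcut, but three vertices cannot be pairwise separated
  -- into two sides.
  rcases h.sides hc.1 with h1 | h1 <;> rcases h.sides hc.2.1 with h2 | h2 <;>
    rcases h.sides hc.2.2 with h3 | h3 <;> linarith

/-- The edges of the tree are shortest paths. -/
theorem adj_le_diamWith (u v : Fin n) {x y : Fin n} (hxy : I.tree.Adj x y) :
    I.dist x y ≤ I.diamWith u v := by
  refine le_trans ?_ (h.via_le_diamWith u v x y)
  have h0 := h.adj_le x y hxy
  refine le_min le_rfl (le_min ?_ ?_)
  -- Measured in `c`, every leg of the detour only gets shorter, and the whole is still at least `c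
  -- x y`.
  · linarith [h.c_triangle x u y, h.c_triangle u v y, h.c_le x u, h.c_le v y]
  · linarith [h.c_triangle x v y, h.c_triangle v u y, h.c_le x v, h.c_le u y, h.c_comm v u]

/-- A shortcut reduces the distance of two vertices to a third of it at best. -/
theorem dist_le_three_mul (u v a b : Fin n) : I.dist a b ≤ 3 * I.diamWith u v := by
  by_contra! hc
  have h0 : 0 ≤ I.diamWith u v := by
    refine le_trans ?_ (h.via_le_diamWith u v a a)
    have := I.c_nonneg u v
    have := h.dist_nonneg
    exact le_min (this _ _) (le_min (by linarith [this a u, this v a])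
      (by linarith [this a v, this u a]))
  -- On a walk from `b` back to `a`, no vertex `x` can be the first to come within the diameter of
  -- `a`. The preceding vertex `y` would be farther than that from `a`, and also from `b`, since
  -- `I.dist a x` and `I.dist x y` are at most one diameter each; then `a`, `y`, `b` contradict
  -- `triple`. The walk ends in `a` itself, which is absurd.
  have key : ∀ {x l}, WalkLength I.treeEdge x b l → I.diamWith u v < I.dist a x := by
    have hb : I.diamWith u v < I.dist a b := by linarith
    intro x l hw
    induction hw with
    | nil => exact hb
    | @cons x y z w l he hw ih =>
      have h1 := ih hc hb
      by_contra! h2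
      have h3 := h.adj_le_diamWith u v he.1
      have h4 := h.dist_triangle a x z
      have h5 := h.dist_triangle x y z
      rcases h.triple u v a y z with h6 | h6 | h6 <;> linarith
  have := key (h.walk a b)
  rw [h.dist_self] at this
  linarith

end MetricTree

/-! ### Coordinates along a longest path -/

/-- The ends of a longest path. -/
structure Ends (I : Doap n) (a b : Fin n) : Prop where
  left : ∀ z, I.dist a z ≤ I.dist a b
  right : ∀ z, I.dist b z ≤ I.dist a b

/-- The position, measured from `a`, of the vertex at which the path from `z` meets the path from
`a` to `b`. -/
noncomputable def pos (I : Doap n) (a b z : Fin n) : ℝ :=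
  (I.dist a z + I.dist a b - I.dist b z) / 2

/-- The distance from `z` to the path from `a` to `b`. -/
noncomputable def height (I : Doap n) (a b z : Fin n) : ℝ :=
  (I.dist a z + I.dist b z - I.dist a b) / 2

/-- Conditions on a shortcut of weight `c` between the positions `x` and `y` of the path from `a`
to `b`: every pair of vertices whose distance in the tree exceeds `Δ` gets a distance of at most
`Δ` by way of the shortcut. -/
structure Good (I : Doap n) (a b : Fin n) (Δ x y c : ℝ) : Prop where
  ends : c + x - y + I.dist a b ≤ Δ
  left : ∀ z, Δ < I.dist a z → c + x + y + (I.dist b z - I.dist a b) ≤ Δ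
  right : ∀ z, Δ < I.dist b z → c + I.dist a b - x - y + I.dist a z ≤ Δ
  -- In coordinates the premise bounds `height z + height w + pos w - pos z`, the distance of `z`
  -- and `w` if `z` comes first. The conclusion measures the detour for feet between `x` and `y`:
  -- back from `z` to `x`, across, and back from `y` to `w`.
  cycle : ∀ z w, Δ < I.dist a w + (I.dist b z - I.dist a b) →
    c + y - x + (I.dist a z + (I.dist b w - I.dist a b)) ≤ Δ

namespace MetricTree

variable {a b : Fin n} (h : I.MetricTree)
include h

/-- The double sweep: the four-point condition for `a`, `z`, `r`, `b`, with `b` farthest from `r`,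
bounds `I.dist a z` by `I.dist z b` or by `I.dist a b`. -/
theorem ends_of_far {r : Fin n} (hb : ∀ z, I.dist r z ≤ I.dist r b)
    (ha : ∀ z, I.dist b z ≤ I.dist b a) : I.Ends a b := by
  refine ⟨fun z => ?_, fun z => by rw [h.dist_comm a b]; exact ha z⟩
  have h1 := hb a
  have h2 := hb z
  have h3 := ha z
  rcases h.four_point a z r b with h4 | h4
  · linarith [h.dist_comm a r, h.dist_comm z b, h.dist_comm a b]
  · linarith [h.dist_comm r z, h.dist_comm a b]

omit h in
theorem pos_add_height (a b z : Fin n) : I.pos a b z + I.height a b z = I.dist a z := by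
  simp only [pos, height]; ring

omit h in
theorem height_sub_pos (a b z : Fin n) :
    I.height a b z - I.pos a b z = I.dist b z - I.dist a b := by
  simp only [pos, height]; ring

theorem height_nonneg (a b z : Fin n) : 0 ≤ I.height a b z := by
  simp only [height]; linarith [h.dist_triangle a z b, h.dist_comm z b]

/-- Together with `height_le_dist` this makes the coordinates exact for different positions. For
equal positions only this upper bound survives, because the branches may share edges. -/
theorem dist_le_height (a b y z : Fin n) :
    I.dist y z ≤ I.height a b y + I.height a b z + |I.pos a b y - I.pos a b z| := by
  have h1 := le_abs_self (I.pos a b y - I.pos a b z)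
  have h2 := neg_le_abs (I.pos a b y - I.pos a b z)
  have := pos_add_height (I := I) a b y
  have := pos_add_height (I := I) a b z
  have := height_sub_pos (I := I) a b y
  have := height_sub_pos (I := I) a b z
  rcases h.four_point a b y z with h3 | h3 <;> linarith

theorem height_le_dist {y z : Fin n} (hyz : I.pos a b y < I.pos a b z) :
    I.height a b y + I.height a b z + (I.pos a b z - I.pos a b y) ≤ I.dist y z := by
  have := pos_add_height (I := I) a b y
  have := pos_add_height (I := I) a b z
  have := height_sub_pos (I := I) a b y
  have := height_sub_pos (I := I) a b z
  rcases h.four_point a z b y with h3 | h3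
  · linarith [h.dist_comm z y]
  · linarith [h.dist_comm z b]

/-- A lower bound for the distance of two vertices that hang from different places. -/
theorem dist_ge_or_pos_eq (y z : Fin n) :
    I.height a b y + I.height a b z + |I.pos a b y - I.pos a b z| ≤ I.dist y z ∨
      I.pos a b y = I.pos a b z := by
  rcases lt_trichotomy (I.pos a b y) (I.pos a b z) with h1 | h1 | h1
  · left; rw [abs_of_neg (by linarith)]; linarith [h.height_le_dist h1]
  · exact .inr h1
  · left; rw [abs_of_pos (by linarith)]; linarith [h.height_le_dist h1, h.dist_comm y z]

-- A branch longer than the stretch from its foot to an end would give a path longer than the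
-- longest one.
omit h in
theorem height_le_pos (he : I.Ends a b) (z : Fin n) : I.height a b z ≤ I.pos a b z := by
  linarith [he.right z, height_sub_pos (I := I) a b z]

omit h in
theorem height_le_sub_pos (he : I.Ends a b) (z : Fin n) :
    I.height a b z ≤ I.dist a b - I.pos a b z := by
  linarith [he.left z, pos_add_height (I := I) a b z]

/-- Vertices that hang from the same place are not brought closer together than the diameter. -/
theorem dist_le_diamWith_of_pos_eq (he : I.Ends a b) (u v : Fin n) {y z : Fin n}
    (hyz : I.pos a b y = I.pos a b z) : I.dist y z ≤ I.diamWith u v := by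
  have h1 := h.dist_le_height a b y z
  rw [hyz, sub_self, abs_zero] at h1
  have := pos_add_height (I := I) a b y
  have := pos_add_height (I := I) a b z
  have := height_le_pos he y
  have := height_le_pos he z
  -- With a common foot, `I.dist y z` is at most `height y + height z`, hence at most `I.dist a y`
  -- and at most `I.dist a z`. One of the three distances is bounded by the diameter, so the
  -- smallest is.
  rcases h.triple u v a y z with h2 | h2 | h2 <;> linarith

/-- The end `a` lies on the side of `u`, so a vertex far from `a` lies on the side of `v`, and
symmetrically for `b`. This fixes the direction in which each far pair crosses the shortcut, and the
coordinates turn its detour into the required inequality. -/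
theorem good_of_sides (he : I.Ends a b) {u v : Fin n} (hlt : I.diamWith u v < I.dist a b)
    (hs : I.dist a u + I.c u v < I.dist a v)
    (hab : I.dist a u + I.c u v + I.dist v b ≤ I.diamWith u v) :
    I.Good a b (I.diamWith u v) (I.pos a b u) (I.pos a b v)
      (I.c u v + I.height a b u + I.height a b v) := by
  have hc := I.c_nonneg u v
  have hp := fun z => pos_add_height (I := I) a b z
  have hq := fun z => height_sub_pos (I := I) a b z
  have hA : I.c u v + I.height a b u + I.height a b v + I.pos a b u - I.pos a b v + I.dist a b ≤
      I.diamWith u v := by linarith [hp u, hq v, h.dist_comm v b]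
  have hsb : I.dist b v + I.c u v < I.dist b u := by
    rcases h.sides hlt with h1 | h1 <;> linarith
  have hB : ∀ z, I.diamWith u v < I.dist a z →
      I.c u v + I.height a b u + I.height a b v + I.pos a b u + I.pos a b v +
        (I.dist b z - I.dist a b) ≤ I.diamWith u v := by
    intro z hz
    rcases h.sides hz with h1 | h1
    · rcases h.dist_ge_or_pos_eq (a := a) (b := b) v z with h2 | h2
      · linarith [hp u, hq z, le_abs_self (I.pos a b v - I.pos a b z)]
      -- If `v` and `z` share their foot, their distance has no useful lower bound; but `z` is then
      -- no higher than the path is long beyond that foot, and `hA` for the end `b` suffices.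
      · linarith [hq z, height_le_sub_pos he z]
    · linarith
  have hC : ∀ z, I.diamWith u v < I.dist b z →
      I.c u v + I.height a b u + I.height a b v + I.dist a b - I.pos a b u - I.pos a b v +
        I.dist a z ≤ I.diamWith u v := by
    intro z hz
    rcases h.sides hz with h1 | h1
    · linarith
    · rcases h.dist_ge_or_pos_eq (a := a) (b := b) u z with h2 | h2
      · linarith [hq v, hp z, neg_le_abs (I.pos a b u - I.pos a b z)]
      · linarith [hp z, height_le_pos he z]
  refine ⟨hA, hB, hC, fun y z hyz => ?_⟩
  have haz : I.diamWith u v < I.dist a z := by linarith [he.right y]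
  have hby : I.diamWith u v < I.dist b y := by linarith [he.left z]
  have hBz := hB z haz
  have hCy := hC y hby
  rcases lt_or_ge (I.pos a b y) (I.pos a b z) with hlt' | hge
  · have hd := h.height_le_dist hlt'
    have hyz' : I.diamWith u v < I.dist y z := by linarith [hp z, hq y]
    rcases h.sides hyz' with h1 | h1
    · rcases h.dist_ge_or_pos_eq (a := a) (b := b) u y with h2 | h2
      · rcases h.dist_ge_or_pos_eq (a := a) (b := b) v z with h3 | h3
        · linarith [hp y, hq z, le_abs_self (I.pos a b v - I.pos a b z),
            neg_le_abs (I.pos a b u - I.pos a b y), h.dist_comm u y]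
        · linarith [hp y, hq z, height_le_sub_pos he z]
      · linarith [hp y, hq z, height_le_pos he y]
    · rcases h.sides haz with h2 | h2 <;> linarith
  -- With the feet in the wrong order the premise would force the diameter below `height y + height
  -- z`, which is at most `I.dist a y`; then `a`, `b`, `y` would be pairwise too far.
  · have := height_le_pos he z
    have := height_le_sub_pos he y
    rcases h.triple u v a b y with h1 | h1 | h1 <;> linarith [hp z, hq y, hp y, hq z]

/-- A shortcut that reduces the diameter satisfies the conditions, in one of its orientations. -/
theorem exists_good (he : I.Ends a b) {u v : Fin n} (hlt : I.diamWith u v < I.dist a b) :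
    ∃ u' v', I.Good a b (I.diamWith u v) (I.pos a b u') (I.pos a b v')
      (I.c u' v' + I.height a b u' + I.height a b v') := by
  rcases h.sides hlt with h1 | h1
  · exact ⟨u, v, h.good_of_sides he hlt h1.1 h1.2.2⟩
  · have hd : I.diamWith v u = I.diamWith u v := by
      have : I.addShortcut v u = I.addShortcut u v := by
        funext x y w
        simp only [addShortcut, h.c_comm v u, Sym2.eq_swap (a := v) (b := u)]
      rw [diamWith, diamWith, this]
    have h2 := h.c_comm u v
    refine ⟨v, u, ?_⟩
    rw [← hd]
    rw [← hd] at h1 hlt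
    exact h.good_of_sides he hlt (by linarith) (by linarith)

/-- The conditions are sufficient for a shortcut between two vertices of the path. -/
theorem diamWith_le_max (he : I.Ends a b) {i j : Fin n} (hi : I.height a b i = 0)
    (hj : I.height a b j = 0) {Δ : ℝ}
    (hg : I.Good a b Δ (I.pos a b i) (I.pos a b j) (I.c i j)) (u v : Fin n) :
    I.diamWith i j ≤ max Δ (I.diamWith u v) := by
  have : NeZero n := ⟨by rintro rfl; exact i.elim0⟩
  have hp := fun z => pos_add_height (I := I) a b z
  have hq := fun z => height_sub_pos (I := I) a b z
  have main : ∀ y z, I.pos a b y < I.pos a b z →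
      I.dist y z ≤ Δ ∨ I.dist y i + I.c i j + I.dist j z ≤ Δ := by
    intro y z hyz
    by_contra! hcon
    obtain ⟨hc1, hc2⟩ := hcon
    have h1 := h.dist_le_height a b y z
    rw [abs_of_neg (by linarith)] at h1
    have hy := height_le_pos he y
    have hz := height_le_sub_pos he z
    have hcyc := hg.cycle y z (by linarith [hp z, hq y])
    have hL := hg.left z (by linarith [hp z])
    have hR := hg.right y (by linarith [hq y])
    have hE := hg.ends
    have h2 := h.dist_le_height a b y i
    have h3 := h.dist_le_height a b j z
    -- The four combinations of whether `y` hangs before `i` and `z` after `j` each use one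
    -- condition. Outside the stretch, a height is replaced by the distance to the end of the path,
    -- which reduces the pair to one that contains `a` or `b`.
    rcases abs_cases (I.pos a b y - I.pos a b i) with ⟨e1, _⟩ | ⟨e1, _⟩ <;>
      rcases abs_cases (I.pos a b j - I.pos a b z) with ⟨e2, _⟩ | ⟨e2, _⟩ <;>
      rw [e1] at h2 <;> rw [e2] at h3 <;> linarith [hp y, hq y, hp z, hq z]
  refine h.diamWith_le fun y z => ?_
  rcases lt_trichotomy (I.pos a b y) (I.pos a b z) with hlt | heq | hlt
  · refine le_max_of_le_left ?_
    rcases main y z hlt with h1 | h1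
    · exact (min_le_left _ _).trans h1
    · exact (min_le_right _ _).trans ((min_le_left _ _).trans h1)
  · exact le_max_of_le_right ((min_le_left _ _).trans (h.dist_le_diamWith_of_pos_eq he u v heq))
  · refine le_max_of_le_left ?_
    rcases main z y hlt with h1 | h1
    · exact (min_le_left _ _).trans (by rw [h.dist_comm]; exact h1)
    · refine (min_le_right _ _).trans ((min_le_right _ _).trans ?_)
      linarith [h.dist_comm z i, h.dist_comm j y]

/-- No shortcut increases the diameter of the tree. -/
theorem diamWith_le_dist (he : I.Ends a b) (u v : Fin n) : I.diamWith u v ≤ I.dist a b := by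
  have : NeZero n := ⟨by rintro rfl; exact a.elim0⟩
  refine h.diamWith_le fun y z => (min_le_left _ _).trans ?_
  rcases h.four_point y z a b with h1 | h1 <;>
    linarith [he.left y, he.left z, he.right y, he.right z, h.dist_comm y a, h.dist_comm z b,
      h.dist_comm y b, h.dist_comm z a]

end MetricTree

end Doap

/-! ### Removing the leaves of a tree one by one -/

namespace EdgeList

variable {n : ℕ} {T : SimpleGraph (Fin n)} (L : EdgeList T)

/-- The edges with both ends in `R`. -/
def within (R : Finset (Fin n)) : Finset (Fin (n - 1)) :=
  Finset.univ.filter fun k => L.src k ∈ R ∧ L.dst k ∈ R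

/-- The edges with both ends in `R` that are incident to `v`. -/
def inc (R : Finset (Fin n)) (v : Fin n) : Finset (Fin (n - 1)) :=
  (L.within R).filter fun k => L.src k = v ∨ L.dst k = v

theorem mem_within {R : Finset (Fin n)} {k : Fin (n - 1)} :
    k ∈ L.within R ↔ L.src k ∈ R ∧ L.dst k ∈ R := by simp [within]

theorem mem_inc {R : Finset (Fin n)} {v : Fin n} {k : Fin (n - 1)} :
    k ∈ L.inc R v ↔ (L.src k ∈ R ∧ L.dst k ∈ R) ∧ (L.src k = v ∨ L.dst k = v) := by
  simp [inc, within]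

theorem adj (k : Fin (n - 1)) : T.Adj (L.src k) (L.dst k) := by
  have : s(L.src k, L.dst k) ∈ T.edgeSet := L.range_eq ▸ Set.mem_range_self k
  simpa using this

theorem exists_of_adj {x y : Fin n} (h : T.Adj x y) :
    ∃ k, (L.src k = x ∧ L.dst k = y) ∨ (L.src k = y ∧ L.dst k = x) := by
  have : s(x, y) ∈ Set.range fun k => s(L.src k, L.dst k) := by
    rw [L.range_eq]; simpa using h
  obtain ⟨k, hk⟩ := this
  exact ⟨k, by simpa using hk⟩

/-- The edges within `R` form a tree on `R`. -/
structure Tight (R : Finset (Fin n)) : Prop where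
  card : (L.within R).card + 1 = R.card
  cut : ∀ A ⊆ R, A.Nonempty → A ≠ R →
    ∃ k ∈ L.within R, (L.src k ∈ A ∧ L.dst k ∉ A) ∨ (L.dst k ∈ A ∧ L.src k ∉ A)

theorem tight_univ (hn : 0 < n) (hT : T.Connected) : L.Tight Finset.univ := by
  refine ⟨by simp [within]; omega, fun A _ ⟨a, ha⟩ hA => ?_⟩
  obtain ⟨b, hb⟩ : ∃ b, b ∉ A := by
    by_contra! h
    exact hA (Finset.eq_univ_of_forall h)
  obtain ⟨p⟩ := hT.preconnected a b
  obtain ⟨d, -, h1, h2⟩ := p.exists_boundary_dart A ha hb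
  obtain ⟨k, ⟨h3, h4⟩ | ⟨h3, h4⟩⟩ := L.exists_of_adj d.adj
  · exact ⟨k, by simp [mem_within], .inl (by rw [h3, h4]; exact ⟨h1, h2⟩)⟩
  · exact ⟨k, by simp [mem_within], .inr (by rw [h3, h4]; exact ⟨h1, h2⟩)⟩

/-- The edge `e` joins `x` to `u`, and it is the only edge within `R` that is incident to `x`. -/
structure Leaf (R : Finset (Fin n)) (x u : Fin n) (e : Fin (n - 1)) : Prop where
  inc_eq : L.inc R x = {e}
  ends : (L.src e = x ∧ L.dst e = u) ∨ (L.src e = u ∧ L.dst e = x)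

variable {L}

theorem exists_leaf_of_card {R : Finset (Fin n)} {x : Fin n} (h : (L.inc R x).card = 1) :
    ∃ u e, L.Leaf R x u e := by
  obtain ⟨e, he⟩ := Finset.card_eq_one.1 h
  have h1 : e ∈ L.inc R x := by simp [he]
  rcases (L.mem_inc.1 h1).2 with h2 | h2
  · exact ⟨L.dst e, e, he, .inl ⟨h2, rfl⟩⟩
  · exact ⟨L.src e, e, he, .inr ⟨rfl, h2⟩⟩

namespace Leaf

variable {R : Finset (Fin n)} {x u : Fin n} {e : Fin (n - 1)} (h : L.Leaf R x u e)
include h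

theorem mem : e ∈ L.inc R x := by simp [h.inc_eq]

theorem eq_of_mem {k : Fin (n - 1)} (hk : k ∈ L.inc R x) : k = e := by
  simpa [h.inc_eq] using hk

theorem mem_left : x ∈ R := by
  have := L.mem_inc.1 h.mem
  rcases h.ends with h1 | h1
  · exact h1.1 ▸ this.1.1
  · exact h1.2 ▸ this.1.2

theorem mem_right : u ∈ R := by
  have := L.mem_inc.1 h.mem
  rcases h.ends with h1 | h1
  · exact h1.2 ▸ this.1.2
  · exact h1.1 ▸ this.1.1

theorem adj : T.Adj x u := by
  rcases h.ends with ⟨rfl, rfl⟩ | ⟨rfl, rfl⟩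
  · exact L.adj e
  · exact (L.adj e).symm

theorem ne : u ≠ x := h.adj.ne'

theorem mem_inc_right : e ∈ L.inc R u := by
  refine L.mem_inc.2 ⟨(L.mem_inc.1 h.mem).1, ?_⟩
  rcases h.ends with h1 | h1
  · exact .inr h1.2
  · exact .inl h1.1

theorem within_erase : L.within (R.erase x) = (L.within R).erase e := by
  ext k
  simp only [mem_within, Finset.mem_erase]
  constructor
  · rintro ⟨⟨h1, h2⟩, h3, h4⟩
    refine ⟨?_, h2, h4⟩
    rintro rfl
    rcases h.ends with h5 | h5
    · exact h1 h5.1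
    · exact h3 h5.2
  · rintro ⟨h1, h2, h3⟩
    refine ⟨⟨fun h4 => h1 (h.eq_of_mem (L.mem_inc.2 ⟨⟨h2, h3⟩, .inl h4⟩)), h2⟩,
      fun h4 => h1 (h.eq_of_mem (L.mem_inc.2 ⟨⟨h2, h3⟩, .inr h4⟩)), h3⟩

theorem inc_erase (v : Fin n) : L.inc (R.erase x) v = (L.inc R v).erase e := by
  rw [inc, h.within_erase, Finset.filter_erase, inc]

theorem inc_erase_of_ne {v : Fin n} (hx : v ≠ x) (hu : v ≠ u) :
    L.inc (R.erase x) v = L.inc R v := by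
  rw [h.inc_erase, Finset.erase_eq_of_notMem]
  intro h1
  rcases (L.mem_inc.1 h1).2 with h2 | h2 <;> rcases h.ends with ⟨h3, h4⟩ | ⟨h3, h4⟩
  · exact hx (h2.symm.trans h3)
  · exact hu (h2.symm.trans h3)
  · exact hu (h2.symm.trans h4)
  · exact hx (h2.symm.trans h4)

theorem tight_erase (hR : L.Tight R) : L.Tight (R.erase x) := by
  have hin : e ∈ L.within R := L.mem_within.2 (L.mem_inc.1 h.mem).1
  refine ⟨?_, fun A hA hne hAR => ?_⟩
  · have := hR.card
    rw [h.within_erase, Finset.card_erase_of_mem hin, Finset.card_erase_of_mem h.mem_left]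
    have := Finset.card_pos.2 ⟨e, hin⟩
    omega
  · have hxA : x ∉ A := fun hx => by simpa using hA hx
    have key : ∀ k ∈ L.within R, k ≠ e → k ∈ L.within (R.erase x) := fun k hk hke => by
      rw [h.within_erase]; exact Finset.mem_erase.2 ⟨hke, hk⟩
    -- A part that contains the neighbour `u` is enlarged by `x`, so that the removed edge does not
    -- cross the cut and the crossing edge survives.
    by_cases huA : u ∈ A
    · obtain ⟨k, hk, h1⟩ := hR.cut (insert x A)
        (Finset.insert_subset h.mem_left (hA.trans (Finset.erase_subset _ _)))
        ⟨x, by simp⟩ (by rintro h2; exact hAR (by rw [← h2]; simp [hxA]))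
      have hke : k ≠ e := by
        rintro rfl
        rcases h.ends with ⟨h3, h4⟩ | ⟨h3, h4⟩ <;> simp [h3, h4, huA] at h1
      refine ⟨k, key k hk hke, ?_⟩
      have h5 := L.mem_within.1 (key k hk hke)
      simp only [Finset.mem_erase] at h5
      simpa [h5.1.1, h5.2.1] using h1
    · obtain ⟨k, hk, h1⟩ := hR.cut A (hA.trans (Finset.erase_subset _ _)) hne
        (by rintro rfl; exact hxA h.mem_left)
      refine ⟨k, key k hk ?_, h1⟩
      rintro rfl
      rcases h.ends with ⟨h3, h4⟩ | ⟨h3, h4⟩ <;> simp [h3, h4, huA, hxA] at h1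

end Leaf

theorem sum_card_inc (R : Finset (Fin n)) :
    ∑ v ∈ R, (L.inc R v).card = 2 * (L.within R).card := by
  have h1 := Finset.sum_card_bipartiteAbove_eq_sum_card_bipartiteBelow
    (s := R) (t := L.within R) (fun v k => L.src k = v ∨ L.dst k = v)
  have h2 : ∀ k ∈ L.within R,
      (R.bipartiteBelow (fun v k => L.src k = v ∨ L.dst k = v) k).card = 2 := by
    intro k hk
    have h3 : R.bipartiteBelow (fun v k => L.src k = v ∨ L.dst k = v) k = {L.src k, L.dst k} := by
      have h4 := L.mem_within.1 hk
      ext v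
      simp only [Finset.mem_bipartiteBelow, Finset.mem_insert, Finset.mem_singleton]
      constructor
      · rintro ⟨-, h5 | h5⟩
        · exact .inl h5.symm
        · exact .inr h5.symm
      · rintro (rfl | rfl)
        · exact ⟨h4.1, .inl rfl⟩
        · exact ⟨h4.2, .inr rfl⟩
    rw [h3, Finset.card_pair (L.adj k).ne]
  rw [Finset.sum_congr rfl h2] at h1
  rw [show ∑ v ∈ R, (L.inc R v).card = _ from h1, Finset.sum_const, smul_eq_mul, mul_comm]

/-- A tree with at least two vertices has a leaf other than the root. -/
theorem Tight.exists_leaf {R : Finset (Fin n)} (hR : L.Tight R) (h2 : 2 ≤ R.card)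
    (root : Fin n) : ∃ v ∈ R, v ≠ root ∧ (L.inc R v).card = 1 := by
  by_contra! hcon
  have hpos : ∀ v ∈ R, 1 ≤ (L.inc R v).card := by
    intro v hv
    obtain ⟨k, hk, h1⟩ := hR.cut {v} (by simpa using hv) ⟨v, by simp⟩
      (by rintro rfl; simp at h2)
    refine Finset.card_pos.2 ⟨k, L.mem_inc.2 ⟨L.mem_within.1 hk, ?_⟩⟩
    simp only [Finset.mem_singleton] at h1
    tauto
  have h3 := sum_card_inc (L := L) R
  -- Without another leaf the degrees would sum to at least `2 * R.card - 1`, whereas the handshake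
  -- lemma gives `2 * (R.card - 1)`.
  have h4 : ∑ v ∈ R, (if v = root then 1 else 2) ≤ ∑ v ∈ R, (L.inc R v).card := by
    refine Finset.sum_le_sum fun v hv => ?_
    have := hpos v hv
    split_ifs with h
    · exact this
    · have := hcon v hv h; omega
  have h5 : ∑ v ∈ R, 2 ≤ ∑ v ∈ R, (if v = root then 1 else 2) + 1 := by
    have h6 : ∑ v ∈ R, (if v = root then 1 else 2) + ∑ v ∈ R, (if v = root then 1 else 0) =
        ∑ v ∈ R, 2 := by
      rw [← Finset.sum_add_distrib]
      exact Finset.sum_congr rfl fun v _ => by split_ifs <;> rfl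
    rw [Finset.sum_ite_eq'] at h6
    split_ifs at h6 <;> omega
  have := hR.card
  simp only [Finset.sum_const, smul_eq_mul] at h5
  omega

/-- A sequence `o` in which all vertices but `root` can be removed as leaves. -/
structure Strip (L : EdgeList T) (root : Fin n) (o : ℕ → Fin n) (u : ℕ → Fin n)
    (e : ℕ → Fin (n - 1)) (N : ℕ) : Prop where
  ne_root : ∀ t < N, o t ≠ root
  leaf : ∀ t < N, L.Leaf (Finset.univ \ (Finset.range t).image o) (o t) (u t) (e t)

theorem Strip.injOn {root : Fin n} {o u : ℕ → Fin n} {e : ℕ → Fin (n - 1)} {N : ℕ}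
    (h : L.Strip root o u e N) {t t' : ℕ} (ht' : t' < N) (htt : t < t') : o t ≠ o t' := by
  intro h1
  have h2 := (h.leaf t' ht').mem_left
  simp only [Finset.mem_sdiff, Finset.mem_univ, true_and, Finset.mem_image, Finset.mem_range,
    not_exists, not_and] at h2
  exact h2 t htt h1

/-- The rank is the time of removal; the root, never removed, gets the last time `n - 1`. By
counting, the sequence runs through all other vertices. -/
theorem Strip.elimination {I : Doap n} {L : EdgeList I.tree} {root : Fin n} {o u : ℕ → Fin n}
    {e : ℕ → Fin (n - 1)} (h : L.Strip root o u e (n - 1)) :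
    ∃ (par : Fin n → Fin n) (rank : Fin n → ℕ), I.Elimination root par rank ∧
      rank root = n - 1 ∧ (∀ x, x ≠ root → rank x < n - 1 ∧ o (rank x) = x ∧ par x = u (rank x)) ∧
      ∀ t < n - 1, rank (o t) = t := by
  have hinj : Set.InjOn o (Finset.range (n - 1)) := by
    intro t ht t' ht' h1
    simp only [Finset.coe_range, Set.mem_Iio] at ht ht'
    rcases lt_trichotomy t t' with h2 | h2 | h2
    · exact absurd h1 (h.injOn ht' h2)
    · exact h2
    · exact absurd h1.symm (h.injOn ht h2)
  have himg : (Finset.range (n - 1)).image o = Finset.univ.erase root := by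
    refine Finset.eq_of_subset_of_card_le ?_ ?_
    · intro v hv
      obtain ⟨t, ht, rfl⟩ := Finset.mem_image.1 hv
      simpa using h.ne_root t (Finset.mem_range.1 ht)
    · rw [Finset.card_image_of_injOn hinj, Finset.card_erase_of_mem (Finset.mem_univ _)]
      simp
  have hex : ∀ v, ∃ t, (v = root → t = n - 1) ∧ (v ≠ root → t < n - 1 ∧ o t = v) := by
    intro v
    by_cases hv : v = root
    · exact ⟨n - 1, fun _ => rfl, fun h => absurd hv h⟩
    · have : v ∈ (Finset.range (n - 1)).image o := by simp [himg, hv]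
      obtain ⟨t, ht, rfl⟩ := Finset.mem_image.1 this
      exact ⟨t, fun h => absurd h hv, fun _ => ⟨Finset.mem_range.1 ht, rfl⟩⟩
  choose rank hr1 hr2 using hex
  have hrank : ∀ t < n - 1, rank (o t) = t := fun t ht => by
    have h1 := hr2 _ (h.ne_root t ht)
    exact hinj (by simpa using h1.1) (by simpa using ht) h1.2
  have hle : ∀ x, rank x ≤ n - 1 := fun x => by
    by_cases hx : x = root
    · rw [hr1 x hx]
    · exact (hr2 x hx).1.le
  have hroot := hr1 root rfl
  -- a vertex that remains when `t` vertices have been removed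
  have hrest : ∀ t ≤ n - 1, ∀ v, v ∈ Finset.univ \ (Finset.range t).image o ↔ t ≤ rank v := by
    intro t ht v
    simp only [Finset.mem_sdiff, Finset.mem_univ, true_and, Finset.mem_image, Finset.mem_range,
      not_exists, not_and]
    constructor
    · intro h1
      by_contra! h2
      have h3 : v ≠ root := fun h4 => by rw [hr1 v h4] at h2; omega
      exact h1 _ h2 (hr2 v h3).2
    · rintro h1 t' ht' rfl
      rw [hrank t' (by omega)] at h1
      omega
  refine ⟨fun x => u (rank x), rank, ⟨?_, ?_, ?_, ?_, ?_⟩, hroot,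
    fun x hx => ⟨(hr2 x hx).1, (hr2 x hx).2, rfl⟩, hrank⟩
  · intro x y hxy
    by_cases hx : x = root <;> by_cases hy : y = root
    · rw [hx, hy]
    · rw [hr1 x hx] at hxy; have := (hr2 y hy).1; omega
    · rw [hr1 y hy] at hxy; have := (hr2 x hx).1; omega
    · rw [← (hr2 x hx).2, ← (hr2 y hy).2, hxy]
  · intro x; rw [hroot]; exact hle x
  · intro x hx
    have h1 := hr2 x hx
    have h2 := h.leaf _ h1.1
    have h3 := (hrest _ h1.1.le _).1 h2.mem_right
    refine lt_of_le_of_ne h3 fun h4 => h2.ne ?_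
    by_cases h5 : u (rank x) = root
    · rw [hr1 _ h5] at h4; omega
    · rw [← (hr2 _ h5).2, ← h4]
  · intro x hx
    have h1 := hr2 x hx
    have h2 := (h.leaf _ h1.1).adj
    rwa [h1.2] at h2
  -- When the earlier end of an edge is removed, the other end is still present, so this edge is the
  -- single remaining one and leads to the parent.
  · have key : ∀ x y, I.tree.Adj x y → rank x ≤ rank y → x ≠ root ∧ u (rank x) = y := by
      intro x y hxy hr
      have hx : x ≠ root := by
        rintro rfl
        have hy : y ≠ x := hxy.ne'
        have := (hr2 y hy).1
        omega
      refine ⟨hx, ?_⟩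
      have h1 := hr2 x hx
      have h2 := h.leaf _ h1.1
      rw [h1.2] at h2
      have h3 := (hrest _ h1.1.le x).2 le_rfl
      have h4 := (hrest _ h1.1.le y).2 hr
      obtain ⟨k, hk⟩ := L.exists_of_adj hxy
      have h5 : k = e (rank x) := by
        refine h2.eq_of_mem (L.mem_inc.2 ?_)
        rcases hk with ⟨h6, h7⟩ | ⟨h6, h7⟩ <;> rw [h6, h7]
        · exact ⟨⟨h3, h4⟩, .inl rfl⟩
        · exact ⟨⟨h4, h3⟩, .inr rfl⟩
      have h8 := hxy.ne
      rcases h2.ends with ⟨h6, h7⟩ | ⟨h6, h7⟩ <;> rw [← h5] at h6 h7 <;>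
        rcases hk with ⟨h9, h10⟩ | ⟨h9, h10⟩
      · rw [← h7, h10]
      · rw [h9] at h6; exact absurd h6.symm h8
      · rw [h9] at h6; rw [h10] at h7; exact absurd h7.symm h8
      · rw [← h6, h9]
    intro x y hxy
    rcases le_total (rank x) (rank y) with hr | hr
    · exact .inl (key x y hxy hr)
    · exact .inr (key y x hxy.symm hr)

end EdgeList

/-! ### The program: removing the leaves -/

/-- The machine on which the program runs. -/
def Doap.machine {n : ℕ} (I : Doap n) (W : ℕ) : Machine := ⟨n, I.c, n, W⟩

@[simp] theorem Doap.machine_n {n : ℕ} (I : Doap n) (W : ℕ) : (I.machine W).n = n := rfl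

@[simp] theorem Doap.machine_size {n : ℕ} (I : Doap n) (W : ℕ) : (I.machine W).size = n := rfl

@[simp] theorem Doap.machine_word {n : ℕ} (I : Doap n) (W : ℕ) : (I.machine W).word = W := rfl

@[simp] theorem Doap.machine_oracle {n : ℕ} (I : Doap n) (W : ℕ) :
    (I.machine W).oracle = I.c := rfl

/-- The input has been loaded. -/
structure Doap.Loaded {n : ℕ} (I : Doap n) (L : EdgeList I.tree) (s : Store 24) : Prop where
  n_eq : s.nreg 0 = n
  src : ∀ k : Fin (n - 1), s.narr 0 k = L.src k
  dst : ∀ k : Fin (n - 1), s.narr 1 k = L.dst k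
  weight : ∀ k : Fin (n - 1), s.rarr 0 k = I.δ s(L.src k, L.dst k)

theorem Doap.Loaded.frame {n : ℕ} {I : Doap n} {L : EdgeList I.tree} {s s' : Store 24}
    {N R A B : List (Fin 24)} (h : I.Loaded L s) (hF : Frame N R A B s s')
    (hN : 0 ∉ N := by decide) (hA0 : 0 ∉ A := by decide) (hA1 : 1 ∉ A := by decide)
    (hB : 0 ∉ B := by decide) : I.Loaded L s' := by
  refine ⟨?_, fun k => ?_, fun k => ?_, fun k => ?_⟩
  · rw [hF.nreg 0 hN, h.n_eq]
  · rw [hF.narr 0 hA0, h.src]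
  · rw [hF.narr 1 hA1, h.dst]
  · rw [hF.rarr 0 hB, h.weight]

/-- The left side is the form that `BExp.wp` gives to the test `Prog.eq`, a conjunction of two
comparisons. -/
theorem Nat.eq_cases_iff {a b : ℕ} {P Q : Prop} :
    ((a ≤ b → (b ≤ a → P) ∧ (a < b → Q)) ∧ (b < a → Q)) ↔ (a = b → P) ∧ (a ≠ b → Q) := by
  constructor
  · rintro ⟨h1, h2⟩
    refine ⟨fun h => (h1 h.le).1 h.ge, fun h => ?_⟩
    rcases Nat.lt_or_gt_of_ne h with h3 | h3
    · exact (h1 h3.le).2 h3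
    · exact h2 h3
  · rintro ⟨h1, h2⟩
    exact ⟨fun h => ⟨fun h3 => h1 (le_antisymm h h3), fun h3 => h2 h3.ne⟩, fun h => h2 h.ne'⟩

namespace Prog

infixr:60 " ;; " => Stmt.seq

/-- The test `e < f`. -/
def lt (e f : NExp 24) : BExp 24 := .not (.nle f e)

/-- The test `e = f`. -/
def eq (e f : NExp 24) : BExp 24 := .and (.nle e f) (.nle f e)

/-- Increase a register by one. -/
def incr (x : Fin 24) : Stmt 24 := .nset x (.add (.reg x) (.const 1))

/-- Set the degrees and the sums of the incident edges to zero. -/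
def zeroBody : Stmt 24 :=
  .nput 2 (.reg 3) (.const 0) ;; .nput 3 (.reg 3) (.const 0) ;; incr 3

/-- Account for the edge with the number in register `3` at its end `v`. -/
def bump (v : NExp 24) : Stmt 24 :=
  .nput 2 v (.add (.get 2 v) (.const 1)) ;; .nput 3 v (.add (.get 3 v) (.reg 3))

/-- Account for an edge at both of its ends. -/
def countBody : Stmt 24 := bump (.get 0 (.reg 3)) ;; bump (.get 1 (.reg 3)) ;; incr 3

/-- Append the vertex in register `x` to the queue if it is a leaf and not the root. -/
def pushLeaf (x : Fin 24) : Stmt 24 :=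
  .ite (.and (.not (eq (.reg x) (.reg 2))) (eq (.get 2 (.reg x)) (.const 1)))
    (.nput 4 (.reg 5) (.reg x) ;; incr 5) .skip

/-- Append the leaves to the queue. -/
def leafBody : Stmt 24 := pushLeaf 3 ;; incr 3

/-- Find the last edge of the vertex in register `6`, and its other end. -/
def fetch : Stmt 24 :=
  .nset 7 (.get 3 (.reg 6)) ;;
    .nset 8 (.sub (.add (.get 0 (.reg 7)) (.get 1 (.reg 7))) (.reg 6))

/-- Remove the first leaf of the queue. -/
def stripBody : Stmt 24 :=
  .nset 6 (.get 4 (.reg 4)) ;; fetch ;;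
    .nput 2 (.reg 8) (.sub (.get 2 (.reg 8)) (.const 1)) ;;
    .nput 3 (.reg 8) (.sub (.get 3 (.reg 8)) (.reg 7)) ;; pushLeaf 8 ;; incr 4

/-- Compute the distance from the root of the vertex that was removed last but not yet handled. -/
def distBody : Stmt 24 :=
  .nset 3 (.sub (.reg 3) (.const 1)) ;; .nset 6 (.get 4 (.reg 3)) ;; fetch ;;
    .rput 2 (.reg 6) (.add (.get 2 (.reg 8)) (.get 0 (.reg 7)))

/-- Compute an elimination order for the root in register `2`, and the distances from the root. -/
def peel : Stmt 24 :=
  (.nset 3 (.const 0) ;; .loop (lt (.reg 3) (.reg 0)) zeroBody) ;;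
  (.nset 3 (.const 0) ;; .loop (lt (.add (.reg 3) (.const 1)) (.reg 0)) countBody) ;;
  ((.nset 5 (.const 0) ;; .nset 3 (.const 0)) ;; .loop (lt (.reg 3) (.reg 0)) leafBody) ;;
  (.nset 4 (.const 0) ;; .loop (lt (.reg 4) (.reg 5)) stripBody) ;;
  ((.rput 2 (.reg 2) (.const 0) ;; .nset 3 (.sub (.reg 0) (.const 1))) ;;
    .loop (lt (.const 0) (.reg 3)) distBody)

section

variable {n : ℕ} {I : Doap n} {L : EdgeList I.tree} {W : ℕ} {s₀ : Store 24}

/-- The registers and arrays that are changed by `peel`. -/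
abbrev PeelFrame (s s' : Store 24) : Prop := Frame [3, 4, 5, 6, 7, 8] [] [2, 3, 4] [2] s s'

theorem zero_spec (hW : 2 * n + 2 ≤ W) (hL : I.Loaded L s₀) :
    Tri (I.machine W) (.nset 3 (.const 0) ;; .loop (lt (.reg 3) (.reg 0)) zeroBody) s₀
      (2 + (n + 1) * 100) fun s => PeelFrame s₀ s ∧ ∀ v < n, s.narr 2 v = 0 ∧ s.narr 3 v = 0 := by
  refine Tri.wp_seq (T := (n + 1) * 100) ?_
  simp only [Stmt.wp, NExp.wp, Doap.machine_word, Nat.zero_le, true_and]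
  refine Tri.loop_wp n 100 (by decide)
    (fun i s => PeelFrame s₀ s ∧ s.nreg 3 = i ∧ i ≤ n ∧
      ∀ v < i, s.narr 2 v = 0 ∧ s.narr 3 v = 0) ?_ _ ?_
  · rintro i s ⟨hF, hi, hin, hz⟩
    have hL' := hL.frame hF
    simp only [lt, BExp.wp, NExp.wp, hL'.n_eq, hi]
    refine ⟨fun h => ⟨hF, ?_⟩, fun h => ⟨h, Tri.of_wp _ ?_⟩⟩
    · obtain rfl : i = n := by omega
      exact hz
    · simp [zeroBody, incr, Stmt.wp, NExp.wp, hi, h]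
      refine ⟨by omega, by omega, ((hF.putN (by decide)).putN (by decide)).setN (by decide),
        fun v hv => ⟨fun h1 => (hz v (by omega)).1, fun h1 => (hz v (by omega)).2⟩⟩
  · refine ⟨(Frame.refl _).setN (by decide), by simp, by omega, by simp⟩

/-- The edges with numbers below `i` that are incident to `v`. -/
def _root_.EdgeList.below {T : SimpleGraph (Fin n)} (L : EdgeList T) (i : ℕ) (v : Fin n) :
    Finset (Fin (n - 1)) :=
  Finset.univ.filter fun k => (k : ℕ) < i ∧ (L.src k = v ∨ L.dst k = v)

theorem _root_.EdgeList.below_succ {T : SimpleGraph (Fin n)} (L : EdgeList T) (k : Fin (n - 1))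
    (v : Fin n) : L.below (k + 1) v =
      if L.src k = v ∨ L.dst k = v then insert k (L.below k v) else L.below k v := by
  ext j
  have hj : (j : ℕ) < k + 1 ↔ j = k ∨ (j : ℕ) < k := by rw [Fin.ext_iff]; omega
  split_ifs with h
  · simp only [EdgeList.below, Finset.mem_filter, Finset.mem_univ, true_and, Finset.mem_insert, hj]
    constructor
    · rintro ⟨h1 | h1, h2⟩
      · exact .inl h1
      · exact .inr ⟨h1, h2⟩
    · rintro (rfl | h1)
      · exact ⟨.inl rfl, h⟩
      · exact ⟨.inr h1.1, h1.2⟩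
  · simp only [EdgeList.below, Finset.mem_filter, Finset.mem_univ, true_and, hj]
    constructor
    · rintro ⟨rfl | h1, h2⟩
      · exact absurd h2 h
      · exact ⟨h1, h2⟩
    · rintro ⟨h1, h2⟩
      exact ⟨.inr h1, h2⟩

theorem notMem_below {T : SimpleGraph (Fin n)} (L : EdgeList T) (k : Fin (n - 1))
    (v : Fin n) : k ∉ L.below k v := by simp [EdgeList.below]

theorem card_edges_le (A : Finset (Fin (n - 1))) : A.card ≤ n :=
  (Finset.card_le_univ A).trans (by simp)

/-- The sums of edge numbers are the reason for the quadratic term in the word size. -/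
theorem sum_edges_le (A : Finset (Fin (n - 1))) : ∑ k ∈ A, (k : ℕ) ≤ n * n := by
  refine (Finset.sum_le_card_nsmul A _ n fun k _ => by omega).trans ?_
  exact Nat.mul_le_mul_right n (card_edges_le A)

/-- The arrays `2` and `3` hold the degrees and the sums of the incident edges within `R`. -/
def Degrees (L : EdgeList I.tree) (R : Finset (Fin n)) (s : Store 24) : Prop :=
  ∀ v ∈ R, s.narr 2 v = (L.inc R v).card ∧ s.narr 3 v = ∑ k ∈ L.inc R v, (k : ℕ)

theorem count_spec (hW : n * n + 2 * n + 2 ≤ W) (hL : I.Loaded L s₀)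
    (hz : ∀ v < n, s₀.narr 2 v = 0 ∧ s₀.narr 3 v = 0) :
    Tri (I.machine W) (.nset 3 (.const 0) ;;
      .loop (lt (.add (.reg 3) (.const 1)) (.reg 0)) countBody) s₀
      (2 + (n + 1) * 100) fun s => PeelFrame s₀ s ∧ Degrees L Finset.univ s := by
  refine Tri.wp_seq (T := (n + 1) * 100) ?_
  simp only [Stmt.wp, NExp.wp, Doap.machine_word, Nat.zero_le, true_and]
  refine Tri.loop_wp n 100 (by decide)
    (fun i s => PeelFrame s₀ s ∧ s.nreg 3 = i ∧ i ≤ n ∧ ∀ v : Fin n,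
      s.narr 2 v = (L.below i v).card ∧ s.narr 3 v = ∑ k ∈ L.below i v, (k : ℕ)) ?_ _ ?_
  · rintro i s ⟨hF, hi, hin, hz⟩
    have hL' := hL.frame hF
    simp only [lt, BExp.wp, NExp.wp, hL'.n_eq, hi, Doap.machine_word]
    have hnn := Nat.zero_le (n * n)
    refine ⟨by omega, by omega, fun h => ⟨hF, fun v _ => ?_⟩, fun h => ⟨by omega, Tri.of_wp _ ?_⟩⟩
    · have : L.below i v = L.inc Finset.univ v := by
        ext k
        simp only [EdgeList.below, EdgeList.mem_inc, Finset.mem_filter, Finset.mem_univ, true_and]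
        refine and_iff_right ?_
        omega
      rw [← this]
      exact hz v
    · obtain ⟨k, rfl⟩ : ∃ k : Fin (n - 1), (k : ℕ) = i := ⟨⟨i, by omega⟩, rfl⟩
      have hne := (L.adj k).ne
      have hne' : (L.src k : ℕ) ≠ L.dst k := fun h => hne (Fin.ext h)
      have h1 := (L.src k).2
      have h2 := (L.dst k).2
      have h3 := card_edges_le (L.below k (L.src k))
      have h4 := card_edges_le (L.below k (L.dst k))
      have h5 := sum_edges_le (L.below k (L.src k))
      have h6 := sum_edges_le (L.below k (L.dst k))
      have hk : (k : ℕ) < n := by omega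
      simp only [countBody, bump, incr, Stmt.wp, NExp.wp, hi, hL'.src, hL'.dst, hz, hk,
        Doap.machine_word, Doap.machine_size, Store.putN_narr, Store.putN_nreg, Store.setN_nreg,
        h1, h2, true_and, if_true, if_false, Fin.reduceEq, hne'.symm]
      refine ⟨by omega, by omega, by omega, by omega, by omega, by omega, by omega, by omega,
        ((((hF.putN (by decide)).putN (by decide)).putN (by decide)).putN (by decide)).setN
          (by decide), by simpa using hk, fun v => ?_⟩
      simp only [Store.setN_narr, Store.putN_narr, Fin.reduceEq, if_true, if_false, hz,
        L.below_succ, Fin.val_inj, eq_comm (a := v)]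
      by_cases hs : L.src k = v
      · subst hs
        simp [hne.symm, Finset.card_insert_of_notMem, Finset.sum_insert, notMem_below, add_comm]
      · by_cases hd : L.dst k = v
        · subst hd
          simp [hne, Finset.card_insert_of_notMem, Finset.sum_insert, notMem_below, add_comm]
        · simp [hs, hd]
  · refine ⟨(Frame.refl _).setN (by decide), by simp, by omega, fun v => ?_⟩
    have : L.below 0 v = ∅ := by simp [EdgeList.below]
    rw [this]
    simpa using hz v v.2

/-- The cells of the queue between `head` and `tail` hold the vertices that satisfy `P`. -/
structure Queue (root : Fin n) (s : Store 24) (o : ℕ → Fin n) (head tail : ℕ)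
    (P : Fin n → Prop) : Prop where
  tail_eq : s.nreg 5 = tail
  ord : ∀ t < tail, s.narr 4 t = o t
  inj : ∀ t < tail, ∀ t' < tail, o t = o t' → t = t'
  ne_root : ∀ t < tail, o t ≠ root
  mem : ∀ v, P v ↔ ∃ t, head ≤ t ∧ t < tail ∧ o t = v

/-- The queue holds distinct vertices other than the root, so it fits into an array of `n` cells. -/
theorem Queue.tail_lt {root : Fin n} {s : Store 24} {o : ℕ → Fin n} {head tail : ℕ}
    {P : Fin n → Prop} (h : Queue root s o head tail P) : tail < n := by
  have h1 : ((Finset.range tail).image o).card ≤ (Finset.univ.erase root).card := by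
    refine Finset.card_le_card fun v hv => ?_
    obtain ⟨t, ht, rfl⟩ := Finset.mem_image.1 hv
    simpa using h.ne_root t (Finset.mem_range.1 ht)
  rw [Finset.card_image_of_injOn, Finset.card_erase_of_mem (Finset.mem_univ _)] at h1
  · have := root.pos
    simp at h1
    omega
  · intro t ht t' ht'
    exact h.inj t (by simpa using ht) t' (by simpa using ht')

theorem Queue.congr {root : Fin n} {s s' : Store 24} {o : ℕ → Fin n} {head tail : ℕ}
    {P P' : Fin n → Prop} (h : Queue root s o head tail P) (h1 : s'.nreg 5 = s.nreg 5)
    (h2 : ∀ t, s'.narr 4 t = s.narr 4 t) (hP : ∀ v, P' v ↔ P v) :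
    Queue root s' o head tail P' :=
  ⟨h1.trans h.tail_eq, fun t ht => (h2 t).trans (h.ord t ht), h.inj, h.ne_root,
    fun v => (hP v).trans (h.mem v)⟩

/-- Append a vertex to the queue. -/
theorem Queue.push {root : Fin n} {s s' : Store 24} {o : ℕ → Fin n} {head tail : ℕ}
    {P P' : Fin n → Prop} (h : Queue root s o head tail P) {x : Fin n} (hx : x ≠ root)
    (hnew : ∀ t < tail, o t ≠ x) (hle : head ≤ tail) (h1 : s'.nreg 5 = tail + 1)
    (h2 : ∀ t, s'.narr 4 t = if t = tail then (x : ℕ) else s.narr 4 t)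
    (hP : ∀ v, P' v ↔ P v ∨ v = x) :
    Queue root s' (Function.update o tail x) head (tail + 1) P' := by
  refine ⟨h1, fun t ht => ?_, fun t ht t' ht' => ?_, fun t ht => ?_, fun v => ?_⟩
  · rw [h2, Function.update_apply]
    split_ifs with h3
    · rfl
    · exact h.ord t (by omega)
  · rw [Function.update_apply, Function.update_apply]
    split_ifs with h3 h4 h4
    · omega
    · intro h5; exact absurd h5.symm (hnew t' (by omega))
    · intro h5; exact absurd h5 (hnew t (by omega))
    · exact h.inj t (by omega) t' (by omega)
  · rw [Function.update_apply]
    split_ifs with h3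
    · exact hx
    · exact h.ne_root t (by omega)
  · rw [hP, h.mem]
    constructor
    · rintro (⟨t, h3, h4, h5⟩ | rfl)
      · exact ⟨t, h3, by omega, by rw [Function.update_of_ne (by omega), h5]⟩
      · exact ⟨tail, hle, by omega, by simp⟩
    · rintro ⟨t, h3, h4, h5⟩
      rw [Function.update_apply] at h5
      split_ifs at h5 with h6
      · exact .inr h5.symm
      · exact .inl ⟨t, h3, by omega, h5⟩

/-- Shared by the initial scan for leaves and by the stripping loop; `P'` is the set of queued
vertices after `v` has been considered. -/
theorem pushLeaf_wp (hW : 2 * n + 2 ≤ W) {s : Store 24} {x : Fin 24} {v root : Fin n}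
    {o : ℕ → Fin n} {head tail : ℕ} {P P' : Fin n → Prop} {Q : Store 24 → Prop}
    (hx : s.nreg x = v) (hr : s.nreg 2 = root) (hq : Queue root s o head tail P)
    (hle : head ≤ tail) (hnew : v ≠ root → s.narr 2 v = 1 → ∀ t < tail, o t ≠ v)
    (hP : ∀ w, P' w ↔ P w ∨ (w = v ∧ v ≠ root ∧ s.narr 2 v = 1))
    (hQ : ∀ s' o' tail', Frame [5] [] [4] [] s s' → (∀ t < tail, o' t = o t) → tail ≤ tail' →
      Queue root s' o' head tail' P' → Q s') : (pushLeaf x).wp (I.machine W) Q s := by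
  have h1 : 1 ≤ W := by omega
  have hno : (¬ (v ≠ root ∧ s.narr 2 v = 1)) → Q s := fun h =>
    hQ s o tail (Frame.refl s) (fun _ _ => rfl) le_rfl
      (hq.congr rfl (fun _ => rfl) fun w => by rw [hP]; simp [h])
  simp only [pushLeaf, eq, Stmt.wp, BExp.wp, NExp.wp, hx, hr, Doap.machine_size, Doap.machine_word,
    v.2, true_and, h1, Nat.eq_cases_iff]
  refine ⟨fun h => hno fun h' => h'.1 (Fin.ext h), fun h => ⟨fun h2 => ?_, fun h2 => hno fun h' =>
    h2 h'.2⟩⟩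
  have hv : v ≠ root := fun h' => h (by rw [h'])
  have ht := hq.tail_lt
  simp only [incr, Stmt.wp, NExp.wp, hq.tail_eq, Store.putN_nreg, h1, true_and,
    Doap.machine_word]
  refine ⟨ht, by omega, ?_⟩
  refine hQ _ _ (tail + 1) (((Frame.refl s).putN (by decide)).setN (by decide)) (fun t ht => ?_)
    (by omega) (hq.push (P' := P') hv (hnew hv h2) hle (by simp) (fun t => by simp) ?_)
  · rw [Function.update_of_ne (by omega)]
  · intro w; rw [hP]; simp [hv, h2]

theorem leaf_spec (hW : 2 * n + 2 ≤ W) (hL : I.Loaded L s₀) {root : Fin n}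
    (hr : s₀.nreg 2 = root) (hd : Degrees L Finset.univ s₀) :
    Tri (I.machine W) ((.nset 5 (.const 0) ;; .nset 3 (.const 0)) ;;
      .loop (lt (.reg 3) (.reg 0)) leafBody) s₀ (4 + (n + 1) * 100) fun s =>
        PeelFrame s₀ s ∧ Degrees L Finset.univ s ∧ ∃ o tail, Queue root s o 0 tail fun v =>
          v ≠ root ∧ (L.inc Finset.univ v).card = 1 := by
  refine Tri.wp_seq (T := (n + 1) * 100) ?_
  simp only [Stmt.wp, NExp.wp, Doap.machine_word, Nat.zero_le, true_and]
  refine Tri.loop_wp n 100 (by decide)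
    (fun i s => PeelFrame s₀ s ∧ s.nreg 3 = i ∧ i ≤ n ∧ Degrees L Finset.univ s ∧
      ∃ o tail, Queue root s o 0 tail fun v =>
        (v : ℕ) < i ∧ v ≠ root ∧ (L.inc Finset.univ v).card = 1) ?_ _ ?_
  · rintro i s ⟨hF, hi, hin, hd, o, tail, hq⟩
    have hL' := hL.frame hF
    simp only [lt, BExp.wp, NExp.wp, hL'.n_eq, hi]
    refine ⟨fun h => ⟨hF, hd, o, tail, hq.congr rfl (fun _ => rfl) fun v => ?_⟩,
      fun h => ⟨h, Tri.of_wp _ ?_⟩⟩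
    · exact ⟨fun h1 => ⟨by omega, h1⟩, fun h1 => h1.2⟩
    · obtain ⟨v, rfl⟩ : ∃ v : Fin n, (v : ℕ) = i := ⟨⟨i, h⟩, rfl⟩
      have hdv := (hd v (Finset.mem_univ v)).1
      simp only [leafBody, Stmt.wp]
      refine pushLeaf_wp hW hi ((hF.nreg 2 (by decide)).trans hr) hq (Nat.zero_le _)
        (P' := fun w => (w : ℕ) < v + 1 ∧ w ≠ root ∧ (L.inc Finset.univ w).card = 1)
        (fun h1 h2 t ht h3 => ?_) (fun w => ?_) (fun s' o' tail' hF' _ _ hq' => ?_)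
      · have := ((hq.mem v).2 ⟨t, Nat.zero_le _, ht, h3⟩).1
        omega
      · rw [hdv]
        constructor
        · rintro ⟨h1, h2⟩
          rcases Nat.lt_succ_iff_lt_or_eq.1 h1 with h3 | h3
          · exact .inl ⟨h3, h2⟩
          · obtain rfl := Fin.ext h3
            exact .inr ⟨rfl, h2⟩
        · rintro (⟨h1, h2⟩ | ⟨rfl, h2⟩)
          · exact ⟨by omega, h2⟩
          · exact ⟨by omega, h2⟩
      · have h3 : s'.nreg 3 = v := (hF'.nreg 3 (by decide)).trans hi
        simp only [incr, Stmt.wp, NExp.wp, h3, Doap.machine_word]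
        refine ⟨by omega, by omega, (hF.trans hF').setN (by decide), by simp, by omega,
          fun w hw => ?_, o', tail', hq'.congr (by simp) (by simp) fun _ => Iff.rfl⟩
        simp only [Store.setN_narr, hF'.narr 2 (by decide), hF'.narr 3 (by decide)]
        exact hd w hw
  · refine ⟨((Frame.refl _).setN (by decide)).setN (by decide), by simp, by omega, hd,
      fun _ => root, 0, by simp, by simp, by simp, by simp, by simp⟩

/-- The neighbour of a removed leaf has another neighbour, unless it is the root. -/
theorem _root_.EdgeList.Leaf.two_le_card {R : Finset (Fin n)} {x u root : Fin n}
    {e : Fin (n - 1)} (h : L.Leaf R x u e) (hR : L.Tight R) (hr : root ∈ R) (hx : x ≠ root)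
    (hu : u ≠ root) : 2 ≤ (L.inc R u).card := by
  -- The root lies outside `{x, u}`, so some edge leaves this pair. It cannot start at `x`, whose
  -- only edge is `e`.
  obtain ⟨k, hk, h1⟩ := hR.cut {x, u}
    (by intro v hv; rcases Finset.mem_insert.1 hv with rfl | hv
        · exact h.mem_left
        · rw [Finset.mem_singleton.1 hv]; exact h.mem_right)
    ⟨x, by simp⟩ (by rintro rfl; simp [hx.symm, hu.symm] at hr)
  have hw := L.mem_within.1 hk
  have hke : k ≠ e := by
    rintro rfl
    rcases h.ends with ⟨h2, h3⟩ | ⟨h2, h3⟩ <;> simp [h2, h3] at h1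
  have hku : k ∈ L.inc R u := by
    refine L.mem_inc.2 ⟨hw, ?_⟩
    have hnx : ¬ (L.src k = x ∨ L.dst k = x) := fun h2 => hke (h.eq_of_mem (L.mem_inc.2 ⟨hw, h2⟩))
    simp only [Finset.mem_insert, Finset.mem_singleton] at h1
    tauto
  exact Finset.one_lt_card.2 ⟨k, hku, e, h.mem_inc_right, hke⟩

/-- The waiting part of the queue consists of exactly the present leaves other than the root.
Removing a leaf changes only the degree of its neighbour, which was at least two unless that
neighbour is the root, so no vertex enters twice. -/
theorem strip_spec (h2n : 2 ≤ n) (hW : n * n + 2 * n + 2 ≤ W) (hL : I.Loaded L s₀) {root : Fin n}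
    (hT : I.tree.Connected) (hr : s₀.nreg 2 = root) (hd : Degrees L Finset.univ s₀)
    (hq : ∃ o tail, Queue root s₀ o 0 tail fun v =>
      v ≠ root ∧ (L.inc Finset.univ v).card = 1) :
    Tri (I.machine W) (.nset 4 (.const 0) ;; .loop (lt (.reg 4) (.reg 5)) stripBody) s₀
      (2 + (n + 1) * 100) fun s => PeelFrame s₀ s ∧ ∃ o u e, L.Strip root o u e (n - 1) ∧
        ∀ t < n - 1, s.narr 4 t = o t ∧ s.narr 3 (o t) = e t := by
  refine Tri.wp_seq (T := (n + 1) * 100) ?_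
  simp only [Stmt.wp, NExp.wp, Doap.machine_word, Nat.zero_le, true_and]
  refine Tri.loop_wp n 100 (by decide)
    (fun i s => PeelFrame s₀ s ∧ s.nreg 4 = i ∧ ∃ o u e tail, i ≤ tail ∧
      L.Strip root o u e i ∧
      Degrees L (Finset.univ \ (Finset.range i).image o) s ∧
      L.Tight (Finset.univ \ (Finset.range i).image o) ∧
      (∀ t < i, s.narr 3 (o t) = e t) ∧
      Queue root s o i tail fun v => v ∈ Finset.univ \ (Finset.range i).image o ∧ v ≠ root ∧
        (L.inc (Finset.univ \ (Finset.range i).image o) v).card = 1) ?_ _ ?_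
  · rintro i s ⟨hF, hi, o, u, e, tail, hit, hS, hd, hR, hSe, hq⟩
    have hL' := hL.frame hF
    have hnn := Nat.zero_le (n * n)
    set R := Finset.univ \ (Finset.range i).image o with hRdef
    have hrootR : root ∈ R := by
      simp only [R, Finset.mem_sdiff, Finset.mem_univ, true_and, Finset.mem_image, Finset.mem_range,
        not_exists, not_and]
      exact fun t ht => hS.ne_root t ht
    simp only [lt, BExp.wp, NExp.wp, hq.tail_eq, hi]
    have htail := hq.tail_lt
    refine ⟨fun h => ⟨hF, ?_⟩, fun h => ⟨by omega, Tri.of_wp _ ?_⟩⟩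
    · obtain rfl : tail = i := by omega
      have hcard : R.card + tail = n := by
        rw [hRdef, Finset.card_sdiff_of_subset (Finset.subset_univ _),
          Finset.card_image_of_injOn, Finset.card_univ, Fintype.card_fin, Finset.card_range]
        · omega
        · intro t ht t' ht'
          exact hq.inj t (by simpa using ht) t' (by simpa using ht')
      -- An empty queue means no leaf besides the root, and a tree with two or more vertices has
      -- one.
      have h1 : R.card < 2 := by
        by_contra! h2
        obtain ⟨v, h3, h4, h5⟩ := hR.exists_leaf h2 root
        obtain ⟨t, h6, h7, -⟩ := (hq.mem v).1 ⟨h3, h4, h5⟩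
        omega
      obtain rfl : tail = n - 1 := by omega
      exact ⟨o, u, e, hS, fun t ht => ⟨hq.ord t ht, hSe t ht⟩⟩
    · obtain ⟨hxR, hxr, hx1⟩ := (hq.mem (o i)).2 ⟨i, le_rfl, h, rfl⟩
      obtain ⟨u', e', hleaf⟩ := EdgeList.exists_leaf_of_card hx1
      have hnext : Finset.univ \ (Finset.range (i + 1)).image o = R.erase (o i) := by
        ext v
        simp only [R, Finset.range_add_one, Finset.image_insert, Finset.mem_sdiff, Finset.mem_univ,
          true_and, Finset.mem_insert, Finset.mem_erase, not_or]
      -- At a leaf the sum of the incident edge numbers has a single term. The other end of that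
      -- edge is then the sum of its ends minus the leaf itself.
      have hSx : s.narr 3 (o i) = e' := by rw [(hd _ hxR).2, hleaf.inc_eq]; simp
      have hdu := hd u' hleaf.mem_right
      have hsum : (L.src e' : ℕ) + L.dst e' = o i + u' := by
        rcases hleaf.ends with ⟨h1, h2⟩ | ⟨h1, h2⟩ <;> rw [h1, h2]
        exact add_comm _ _
      have hin : i < n := by omega
      have he' : (e' : ℕ) < n := by omega
      have hoi := (o i).2
      have hu := u'.2
      have hcu := card_edges_le (L.inc R u')
      have hsu := sum_edges_le (L.inc R u')
      simp only [stripBody, fetch, Stmt.wp, NExp.wp, hi, hq.ord i h, hSx, hL'.src, hL'.dst, hsum,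
        Doap.machine_word, Doap.machine_size, Store.putN_narr, Store.putN_nreg, Store.setN_nreg,
        Store.setN_narr, hin, he', hoi, hu, hdu, true_and, if_true, if_false, Fin.reduceEq,
        Nat.add_sub_cancel_left]
      refine ⟨by omega, by omega, by omega, by omega, by omega, ?_⟩
      refine pushLeaf_wp (v := u') (root := root) (o := o) (head := i + 1) (tail := tail)
        (P := fun v => (v ∈ R ∧ v ≠ root ∧ (L.inc R v).card = 1) ∧ v ≠ o i)
        (P' := fun v => v ∈ R.erase (o i) ∧ v ≠ root ∧ (L.inc (R.erase (o i)) v).card = 1)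
        (by omega) (by simp) (by simpa using (hF.nreg 2 (by decide)).trans hr) ?_ h ?_ ?_ ?_
      · refine ⟨by simpa using hq.tail_eq, fun t ht => by simpa using hq.ord t ht, hq.inj,
          hq.ne_root, fun v => ?_⟩
        constructor
        · rintro ⟨h1, h2⟩
          obtain ⟨t, h3, h4, h5⟩ := (hq.mem v).1 h1
          refine ⟨t, Nat.lt_of_le_of_ne h3 ?_, h4, h5⟩
          rintro rfl
          exact h2 h5.symm
        · rintro ⟨t, h3, h4, rfl⟩
          refine ⟨(hq.mem _).2 ⟨t, by omega, h4, rfl⟩, fun h5 => ?_⟩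
          have := hq.inj t h4 i h h5
          omega
      · intro h1 h2 t ht h3
        have h4 := hleaf.two_le_card hR hrootR hxr h1
        by_cases h5 : t < i
        · have h6 := hleaf.mem_right
          rw [hRdef, ← h3] at h6
          simp only [Finset.mem_sdiff, Finset.mem_image, Finset.mem_range, not_exists,
            not_and] at h6
          exact h6.2 t h5 rfl
        · have := ((hq.mem u').2 ⟨t, by omega, ht, h3⟩).2.2
          omega
      · intro w
        simp only [Store.setN_narr, Store.putN_narr, Fin.reduceEq, if_false, if_true,
          Finset.mem_erase]
        by_cases hwu : w = u'
        · subst hwu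
          rw [hleaf.inc_erase, Finset.card_erase_of_mem hleaf.mem_inc_right]
          constructor
          · rintro ⟨h1, h2, h3⟩
            exact .inr ⟨rfl, h2, h3⟩
          · rintro (h1 | h1)
            · have := hleaf.two_le_card hR hrootR hxr h1.1.2.1
              omega
            · exact ⟨⟨hleaf.ne, hleaf.mem_right⟩, h1.2⟩
        · constructor
          · rintro ⟨h1, h2, h3⟩
            rw [hleaf.inc_erase_of_ne h1.1 hwu] at h3
            exact .inl ⟨⟨h1.2, h2, h3⟩, h1.1⟩
          · rintro (h1 | h1)
            · rw [hleaf.inc_erase_of_ne h1.2 hwu]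
              exact ⟨⟨h1.2, h1.1.1⟩, h1.1.2⟩
            · exact absurd h1.1 hwu
      · intro s' o' tail' hF' ho' htt hq'
        have ho'i : o' i = o i := ho' i h
        have himg : (Finset.range i).image o' = (Finset.range i).image o :=
          Finset.image_congr fun t ht => ho' t (by simp at ht; omega)
        have himg' : (Finset.range (i + 1)).image o' = (Finset.range (i + 1)).image o :=
          Finset.image_congr fun t ht => ho' t (by simp at ht; omega)
        have h4 : s'.nreg 4 = i := by rw [hF'.nreg 4 (by decide)]; simpa using hi
        have hn3 : ∀ v, s'.narr 3 v = if v = u' then ∑ k ∈ L.inc R u', (k : ℕ) - e' else s.narr 3 v := by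
          intro v; rw [hF'.narr 3 (by decide)]; simp
        have hn2 : ∀ v, s'.narr 2 v = if v = u' then (L.inc R u').card - 1 else s.narr 2 v := by
          intro v; rw [hF'.narr 2 (by decide)]; simp
        simp only [incr, Stmt.wp, NExp.wp, h4, Doap.machine_word]
        refine ⟨by omega, by omega, ?_, by simp, o', Function.update u i u', Function.update e i e',
          tail', by omega, ⟨fun t ht => ?_, fun t ht => ?_⟩, ?_, ?_, fun t ht => ?_, ?_⟩
        · refine Frame.setN (Frame.trans (s' := _) ?_ hF') (by decide)
          exact ((((hF.setN (by decide)).setN (by decide)).setN (by decide)).putN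
            (by decide)).putN (by decide)
        · rw [ho' t (by omega)]
          exact hq.ne_root t (by omega)
        · rcases Nat.lt_succ_iff_lt_or_eq.1 ht with h5 | rfl
          · rw [Function.update_of_ne (by omega), Function.update_of_ne (by omega),
              ho' t (by omega), show (Finset.range t).image o' = (Finset.range t).image o from
                Finset.image_congr fun t' ht' => ho' t' (by simp at ht'; omega)]
            exact hS.leaf t h5
          · rw [Function.update_self, Function.update_self, ho'i, himg]
            exact hleaf
        · rw [himg', hnext]
          intro v hv
          have h5 := Finset.mem_erase.1 hv
          simp only [Store.setN_narr, hn2, hn3, Fin.val_inj]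
          split_ifs with h6
          · rw [h6, hleaf.inc_erase, Finset.card_erase_of_mem hleaf.mem_inc_right,
              ← Finset.sum_erase_add _ _ hleaf.mem_inc_right]
            simp
          · rw [hleaf.inc_erase_of_ne h5.1 h6]
            exact hd v h5.2
        · rw [himg', hnext]
          exact hleaf.tight_erase hR
        · rw [ho' t (by omega)]
          simp only [Store.setN_narr, hn3, Fin.val_inj]
          have h5 : o t ≠ u' := by
            rcases Nat.lt_succ_iff_lt_or_eq.1 ht with h5 | rfl
            · intro h7
              have h6 := hleaf.mem_right
              rw [hRdef, ← h7] at h6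
              simp only [Finset.mem_sdiff, Finset.mem_image, Finset.mem_range, not_exists,
                not_and] at h6
              exact h6.2 t h5 rfl
            · exact hleaf.ne.symm
          rw [if_neg h5]
          rcases Nat.lt_succ_iff_lt_or_eq.1 ht with h6 | rfl
          · rw [Function.update_of_ne (by omega)]
            exact hSe t h6
          · rw [Function.update_self, hSx]
        · rw [himg', hnext]
          exact hq'.congr (by simp) (by simp) fun _ => Iff.rfl
  · obtain ⟨o, tail, hq⟩ := hq
    have hn : 0 < n := root.pos
    have hr0 : Finset.univ \ (Finset.range 0).image o = Finset.univ := by simp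
    refine ⟨(Frame.refl _).setN (by decide), by simp, o, fun _ => root, ?_⟩
    refine ⟨fun _ => ⟨0, by omega⟩, tail, by omega, ⟨by simp, by simp⟩, ?_, ?_, by simp, ?_⟩
    · rw [hr0]; exact hd
    · rw [hr0]; exact L.tight_univ hn hT
    · rw [hr0]; exact hq.congr (by simp) (by simp) (by simp)

/-- The arrays hold an elimination order. -/
structure Ordered (L : EdgeList I.tree) (root : Fin n) (par : Fin n → Fin n)
    (rank : Fin n → ℕ) (s : Store 24) : Prop where
  elim : I.Elimination root par rank
  rank_root : rank root = n - 1
  rank_lt : ∀ x, x ≠ root → rank x < n - 1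
  exists_rank : ∀ t < n - 1, ∃ x, x ≠ root ∧ rank x = t
  ord : ∀ x, x ≠ root → s.narr 4 (rank x) = x
  edge : ∀ x, x ≠ root → ∃ k : Fin (n - 1), s.narr 3 x = k ∧
    (L.src k : ℕ) + L.dst k = x + par x ∧ I.δ s(L.src k, L.dst k) = I.δ s(x, par x)

theorem Ordered.frame {root : Fin n} {par : Fin n → Fin n} {rank : Fin n → ℕ} {s s' : Store 24}
    {N R A B : List (Fin 24)} (h : Ordered L root par rank s) (hF : Frame N R A B s s')
    (h3 : 3 ∉ A := by decide) (h4 : 4 ∉ A := by decide) : Ordered L root par rank s' := by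
  refine ⟨h.elim, h.rank_root, h.rank_lt, h.exists_rank, ?_, ?_⟩
  · rw [hF.narr 4 h4]; exact h.ord
  · rw [hF.narr 3 h3]; exact h.edge

theorem fetch_wp {root : Fin n} {par : Fin n → Fin n} {rank : Fin n → ℕ} {s : Store 24}
    (hW : 2 * n + 2 ≤ W) (hL : I.Loaded L s) (h : Ordered L root par rank s) {x : Fin n}
    (hx : x ≠ root) (h6 : s.nreg 6 = x) {Q : Store 24 → Prop}
    (hQ : ∀ k : Fin (n - 1), I.δ s(L.src k, L.dst k) = I.δ s(x, par x) →
      Q ((s.setN 7 k).setN 8 (par x))) : fetch.wp (I.machine W) Q s := by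
  obtain ⟨k, h1, h2, h3⟩ := h.edge x hx
  have hk : (k : ℕ) < n := by omega
  have := (par x).2
  simp only [fetch, Stmt.wp, NExp.wp, h6, h1, Doap.machine_size, Doap.machine_word, x.2, true_and,
    Store.setN_nreg, Store.setN_narr, Fin.reduceEq, if_true, if_false, hk, hL.src, hL.dst, h2,
    Nat.add_sub_cancel_left]
  exact ⟨by omega, by omega, hQ k h3⟩

/-- In the reverse order of removal a parent comes before its children, so its distance from the
root is known when it is needed. -/
theorem dist_spec (hW : 2 * n + 2 ≤ W) (hL : I.Loaded L s₀) {root : Fin n}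
    (hr : s₀.nreg 2 = root) {par : Fin n → Fin n} {rank : Fin n → ℕ}
    (ho : Ordered L root par rank s₀) :
    Tri (I.machine W) ((.rput 2 (.reg 2) (.const 0) ;; .nset 3 (.sub (.reg 0) (.const 1))) ;;
      .loop (lt (.const 0) (.reg 3)) distBody) s₀ (7 + (n + 1) * 100) fun s =>
        PeelFrame s₀ s ∧ Ordered L root par rank s ∧ ∀ v : Fin n, s.rarr 2 v = I.dist root v := by
  have hE := ho.elim
  refine Tri.wp_seq (T := (n + 1) * 100) ?_
  simp only [Stmt.wp, NExp.wp, RExp.wp, Doap.machine_word, Doap.machine_size, hL.n_eq, hr,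
    root.2, true_and, Store.putR_nreg]
  refine ⟨by omega, by omega, ?_⟩
  refine Tri.loop_wp n 100 (by decide)
    (fun i s => PeelFrame s₀ s ∧ s.nreg 3 = n - 1 - i ∧ i ≤ n - 1 ∧ Ordered L root par rank s ∧
      ∀ v : Fin n, n - 1 - i ≤ rank v → s.rarr 2 v = I.dist root v) ?_ _ ?_
  · rintro i s ⟨hF, hi, hin, ho, hd⟩
    have hL' := hL.frame hF
    have hn := root.pos
    simp only [lt, BExp.wp, NExp.wp, hi, Doap.machine_word, Nat.zero_le, true_and]
    refine ⟨fun h => ⟨hF, ho, fun v => hd v (by omega)⟩, fun h => ⟨by omega, Tri.of_wp _ ?_⟩⟩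
    obtain ⟨x, hx, hrx⟩ := ho.exists_rank (n - 1 - (i + 1)) (by omega)
    have hox := ho.ord x hx
    rw [hrx] at hox
    have hpx := hE.lt_par x hx
    simp only [distBody, Stmt.wp, NExp.wp, hi, Doap.machine_word, Doap.machine_size,
      Store.setN_nreg, Store.setN_narr, if_true, show n - 1 - i - 1 = n - 1 - (i + 1) by omega, hox]
    refine ⟨by omega, by omega, by omega, ?_⟩
    have hF' : PeelFrame s ((s.setN 3 (n - 1 - (i + 1))).setN 6 x) :=
      ((Frame.refl s).setN (by decide)).setN (by decide)
    have ho' : Ordered L root par rank ((s.setN 3 (n - 1 - (i + 1))).setN 6 x) :=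
      ho.frame (((Frame.refl s).setN (N := [3, 6]) (R := []) (A := []) (B := [])
        (by decide)).setN (by decide))
    refine fetch_wp hW (hL'.frame hF') ho' hx (by simp) fun k hk => ?_
    have hpar := (par x).2
    have hkn : (k : ℕ) < n := by omega
    have hval : I.dist root (par x) + I.δ s(x, par x) = I.dist root x := by
      rw [hE.dist_comm root x, hE.dist_of_rank_lt (y := root), hE.dist_comm (par x) root, add_comm]
      exact hpx.trans_le (hE.le_root _)
    simp only [NExp.wp, RExp.wp, Store.setN_nreg, Store.setN_rarr, Fin.reduceEq, if_true,
      if_false, Doap.machine_size, x.2, hpar, hkn, true_and, hL'.weight, hk,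
      hd (par x) (by omega), hval]
    refine ⟨(((hF.trans hF').setN (by decide)).setN (by decide)).putR (by decide), by simp,
      by omega, ?_, fun v hv => ?_⟩
    · exact ho'.frame ((((Frame.refl _).setN (N := [7, 8]) (R := []) (A := []) (B := [2])
        (by decide)).setN (by decide)).putR (by decide))
    · simp only [Store.putR_rarr, Store.setN_rarr, if_true, Fin.val_inj]
      split_ifs with h1
      · rw [h1]
      · refine hd v ?_
        have : rank v ≠ rank x := fun h2 => h1 (hE.inj h2)
        omega
  · refine ⟨((Frame.refl _).putR (by decide)).setN (by decide), by simp, by omega, ?_,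
      fun v hv => ?_⟩
    · exact ho.frame ((((Frame.refl _).putR (N := [3]) (R := []) (A := []) (B := [2])
        (by decide)).setN (by decide)))
    · have hv' : v = root := by
        by_contra h1
        have := ho.rank_lt v h1
        omega
      subst hv'
      simp [hE.dist_self]

theorem peel_spec (h2n : 2 ≤ n) (hW : n * n + 2 * n + 2 ≤ W) (hL : I.Loaded L s₀) {root : Fin n}
    (hr : s₀.nreg 2 = root) :
    Tri (I.machine W) peel s₀ (600 * n + 600) fun s => PeelFrame s₀ s ∧
      (∃ par rank, Ordered L root par rank s) ∧ ∀ v : Fin n, s.rarr 2 v = I.dist root v := by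
  have hW' : 2 * n + 2 ≤ W := by have := Nat.zero_le (n * n); omega
  refine Tri.mono (T := (2 + (n + 1) * 100) + ((2 + (n + 1) * 100) + ((4 + (n + 1) * 100) +
    ((2 + (n + 1) * 100) + (7 + (n + 1) * 100))))) ?_ (by omega) fun _ h => h
  refine (zero_spec hW' hL).seq fun s1 ⟨hF1, hz⟩ => ?_
  have hL1 := hL.frame hF1
  refine (count_spec hW hL1 hz).seq fun s2 ⟨hF2, hd2⟩ => ?_
  have hL2 := hL1.frame hF2
  have hF12 := hF1.trans hF2
  refine (leaf_spec hW' hL2 ((hF12.nreg 2 (by decide)).trans hr) hd2).seq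
    fun s3 ⟨hF3, hd3, hq3⟩ => ?_
  have hL3 := hL2.frame hF3
  have hF13 := hF12.trans hF3
  refine (strip_spec h2n hW hL3 I.isTree.connected ((hF13.nreg 2 (by decide)).trans hr) hd3
    hq3).seq fun s4 ⟨hF4, o, u, e, hS, ho⟩ => ?_
  have hL4 := hL3.frame hF4
  have hF14 := hF13.trans hF4
  obtain ⟨par, rank, hE, h1, h2, h3⟩ := hS.elimination
  have hO : Ordered L root par rank s4 := by
    refine ⟨hE, h1, fun x hx => (h2 x hx).1, fun t ht => ⟨o t, hS.ne_root t ht, h3 t ht⟩,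
      fun x hx => ?_, fun x hx => ⟨e (rank x), ?_, ?_⟩⟩
    · obtain ⟨h4, h5, -⟩ := h2 x hx
      rw [(ho _ h4).1, h5]
    · obtain ⟨h4, h5, -⟩ := h2 x hx
      have := (ho _ h4).2
      rwa [h5] at this
    · obtain ⟨h4, h5, h6⟩ := h2 x hx
      have h7 := (hS.leaf _ h4).ends
      rw [h5, ← h6] at h7
      rcases h7 with ⟨h8, h9⟩ | ⟨h8, h9⟩ <;> rw [h8, h9]
      · exact ⟨rfl, rfl⟩
      · exact ⟨add_comm _ _, by rw [Sym2.eq_swap]⟩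
  refine (dist_spec hW' hL4 ((hF14.nreg 2 (by decide)).trans hr) hO).mono le_rfl
    fun s5 ⟨hF5, hO5, hd5⟩ => ⟨hF14.trans hF5, ⟨par, rank, hO5⟩, hd5⟩

end

end Prog

/-! ### The program: the ends of a longest path -/

namespace Prog

/-- The test `e < f` for real numbers. -/
def rlt (e f : RExp 24) : BExp 24 := .not (.rle f e)

/-- Copy a distance from the root, and compare it with the largest one so far. -/
def farBody : Stmt 24 :=
  .rput 3 (.reg 3) (.get 2 (.reg 3)) ;;
    .ite (.rle (.get 2 (.reg 13)) (.get 2 (.reg 3))) (.nset 13 (.reg 3)) .skip ;; incr 3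

/-- Copy the distances from the root, and replace the root by a vertex that is farthest from it. -/
def far : Stmt 24 :=
  ((.nset 13 (.const 0) ;; .nset 3 (.const 0)) ;; .loop (lt (.reg 3) (.reg 0)) farBody) ;;
    .nset 12 (.reg 2) ;; .nset 2 (.reg 13)

/-- Find the ends of a longest path, and compute the distances from them. -/
def ends : Stmt 24 := .nset 2 (.const 0) ;; peel ;; far ;; peel ;; far ;; peel

section

variable {n : ℕ} {I : Doap n} {L : EdgeList I.tree} {W : ℕ} {s₀ : Store 24}

theorem far_spec (hW : 2 * n + 2 ≤ W) (hL : I.Loaded L s₀) {root : Fin n}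
    (hr : s₀.nreg 2 = root) (hd : ∀ v : Fin n, s₀.rarr 2 v = I.dist root v) :
    Tri (I.machine W) far s₀ (100 * n + 108) fun s =>
      Frame [2, 3, 12, 13] [] [] [3] s₀ s ∧ s.nreg 12 = root ∧
      (∀ v : Fin n, s.rarr 3 v = I.dist root v) ∧
      ∃ b : Fin n, s.nreg 2 = b ∧ ∀ v, I.dist root v ≤ I.dist root b := by
  have hn := root.pos
  refine Tri.mono (T := (4 + (n + 1) * 100) + 4) (Tri.seq (R := fun s =>
    Frame [2, 3, 12, 13] [] [] [3] s₀ s ∧ s.nreg 2 = root ∧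
      (∀ v : Fin n, s.rarr 3 v = I.dist root v) ∧
      ∃ b : Fin n, s.nreg 13 = b ∧ ∀ v, I.dist root v ≤ I.dist root b) ?_ ?_) (by omega)
      fun _ h => h
  · refine Tri.wp_seq (T := (n + 1) * 100) ?_
    simp only [Stmt.wp, NExp.wp, Doap.machine_word, Nat.zero_le, true_and]
    refine Tri.loop_wp n 100 (by decide)
      (fun i s => Frame [2, 3, 12, 13] [] [] [3] s₀ s ∧ s.nreg 2 = root ∧ s.nreg 3 = i ∧ i ≤ n ∧
        (∀ v : Fin n, (v : ℕ) < i → s.rarr 3 v = I.dist root v) ∧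
        ∃ b : Fin n, s.nreg 13 = b ∧ ∀ v : Fin n, (v : ℕ) < i → I.dist root v ≤ I.dist root b)
        ?_ _ ?_
    · rintro i s ⟨hF, h2, hi, hin, hc, b, hb, hmax⟩
      have hL' := hL.frame hF
      simp only [lt, BExp.wp, NExp.wp, hL'.n_eq, hi]
      refine ⟨fun h => ⟨hF, h2, fun v => hc v (by omega), b, hb, fun v => hmax v (by omega)⟩,
        fun h => ⟨h, Tri.of_wp _ ?_⟩⟩
      obtain ⟨v, rfl⟩ : ∃ v : Fin n, (v : ℕ) = i := ⟨⟨i, h⟩, rfl⟩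
      have hd' : ∀ v : Fin n, s.rarr 2 v = I.dist root v := by
        rw [hF.rarr 2 (by decide)]; exact hd
      simp only [farBody, incr, Stmt.wp, NExp.wp, RExp.wp, BExp.wp, hi, hb, hd',
        Doap.machine_word, Doap.machine_size, v.2, b.2, true_and, Store.putR_nreg,
        Store.putR_rarr, Fin.reduceEq, if_true, if_false, Store.setN_nreg]
      have hc' : ∀ w : Fin n, (w : ℕ) < v + 1 →
          (if (w : ℕ) = v then I.dist root v else s.rarr 3 w) = I.dist root w := by
        intro w hw
        split_ifs with h1
        · rw [Fin.ext h1]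
        · exact hc w (by omega)
      have hlt : ∀ w : Fin n, (w : ℕ) < v + 1 → w = v ∨ (w : ℕ) < v := fun w hw => by
        rw [Fin.ext_iff]; omega
      refine ⟨fun hle => ⟨by omega, by omega, ?_⟩, fun hle => ⟨by omega, by omega, ?_⟩⟩
      · refine ⟨((hF.putR (by decide)).setN (by decide)).setN (by decide), by simpa using h2,
          by omega, fun w hw => by simpa using hc' w hw, v, by simp, fun w hw => ?_⟩
        rcases hlt w hw with rfl | h1
        · exact le_rfl
        · exact (hmax w h1).trans hle
      · refine ⟨(hF.putR (by decide)).setN (by decide), by simpa using h2,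
          by omega, fun w hw => by simpa using hc' w hw, b, by simp, fun w hw => ?_⟩
        rcases hlt w hw with rfl | h1
        · exact hle.le
        · exact hmax w h1
    · exact ⟨((Frame.refl _).setN (by decide)).setN (by decide), by simpa using hr, by simp,
        by omega, by simp, ⟨0, hn⟩, by simp, by simp⟩
  · rintro s ⟨hF, h2, hc, b, hb, hmax⟩
    refine Tri.of_wp _ ?_
    simp only [Stmt.wp, NExp.wp, Store.setN_nreg, Fin.reduceEq, if_false, h2, hb]
    exact ⟨(hF.setN (by decide)).setN (by decide), by simp, hc, b, by simp, hmax⟩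

/-- The registers and arrays that are changed by `ends`. -/
abbrev EndsFrame (s s' : Store 24) : Prop :=
  Frame [2, 3, 4, 5, 6, 7, 8, 12, 13] [] [2, 3, 4] [2, 3] s s'

/-- A sweep from the vertex `0` finds `b`, a sweep from `b` finds `a`, and a sweep from `a` supplies
its distances and an elimination order rooted at `a`. The copy made by `far` keeps the distances
from `b`. -/
theorem ends_spec (h2n : 2 ≤ n) (hW : n * n + 2 * n + 2 ≤ W) (hI : I.EmbeddedInMetric)
    (hL : I.Loaded L s₀) :
    Tri (I.machine W) ends s₀ (2000 * n + 2018) fun s => EndsFrame s₀ s ∧ I.MetricTree ∧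
      ∃ a b : Fin n, a ≠ b ∧ I.Ends a b ∧ s.nreg 2 = a ∧ s.nreg 12 = b ∧
        (∃ par rank, Ordered L a par rank s) ∧ (∀ v : Fin n, s.rarr 2 v = I.dist a v) ∧
        ∀ v : Fin n, s.rarr 3 v = I.dist b v := by
  have hW' : 2 * n + 2 ≤ W := by have := Nat.zero_le (n * n); omega
  refine Tri.mono (T := 2 + ((600 * n + 600) + ((100 * n + 108) + ((600 * n + 600) +
    ((100 * n + 108) + (600 * n + 600)))))) ?_ (by omega) fun _ h => h
  refine Tri.wp_seq ?_
  simp only [Stmt.wp, NExp.wp, Doap.machine_word, Nat.zero_le, true_and]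
  have hF0 : EndsFrame s₀ (s₀.setN 2 0) := (Frame.refl _).setN (by decide)
  have hL0 : I.Loaded L (s₀.setN 2 0) := hL.frame hF0
  refine (peel_spec h2n hW hL0 (root := ⟨0, by omega⟩) (by simp)).seq
    fun s1 ⟨hF1, ⟨par, rank, hO⟩, hd1⟩ => ?_
  have hM : I.MetricTree := hO.elim.metricTree hI
  have hL1 := hL0.frame hF1
  refine (far_spec hW' hL1 (by rw [hF1.nreg 2 (by decide)]; rfl) hd1).seq
    fun s2 ⟨hF2, _, _, b, hb, hbmax⟩ => ?_
  have hL2 := hL1.frame hF2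
  refine (peel_spec h2n hW hL2 hb).seq fun s3 ⟨hF3, _, hd3⟩ => ?_
  have hL3 := hL2.frame hF3
  have hb3 : s3.nreg 2 = b := by rw [hF3.nreg 2 (by decide), hb]
  refine (far_spec hW' hL3 hb3 hd3).seq fun s4 ⟨hF4, h12, hdb, a, ha, hamax⟩ => ?_
  have hL4 := hL3.frame hF4
  refine (peel_spec h2n hW hL4 ha).mono le_rfl fun s5 ⟨hF5, hO5, hd5⟩ => ?_
  refine ⟨((((hF0.trans hF1).trans hF2).trans hF3).trans hF4).trans hF5, hM, a, b, ?_,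
    hM.ends_of_far hbmax hamax, by rw [hF5.nreg 2 (by decide), ha],
    by rw [hF5.nreg 12 (by decide), h12], hO5, hd5, by rw [hF5.rarr 3 (by decide)]; exact hdb⟩
  rintro rfl
  obtain ⟨v, hv⟩ : ∃ v : Fin n, v ≠ a := by
    by_contra! h
    have h0 := h ⟨0, by omega⟩
    have h1 := h ⟨1, by omega⟩
    simpa using h1.trans h0.symm
  have h1 := hM.dist_pos a v hv.symm
  have h2 := hamax v
  rw [hM.dist_self] at h2
  linarith

end

end Prog

/-! ### Clusters along a longest path -/

namespace Doap

variable {n : ℕ} {I : Doap n}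

namespace MetricTree

variable {a b : Fin n} (h : I.MetricTree) {par : Fin n → Fin n} {rank : Fin n → ℕ}
  (hE : I.Elimination a par rank)
include h hE

/-- A step away from `a` lengthens the distance from `a` by the whole edge and changes the distance
from `b` by at most as much. -/
theorem pos_par_le {x : Fin n} (hx : x ≠ a) : I.pos a b (par x) ≤ I.pos a b x := by
  have h1 := hE.dist_of_rank_lt ((hE.lt_par x hx).trans_le (hE.le_root _))
  have h2 := h.dist_triangle b (par x) x
  rw [h.dist_comm (par x) x, h.dist_adj _ _ (hE.adj x hx)] at h2
  simp only [pos]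
  linarith [h.dist_comm x a, h.dist_comm (par x) a]

/-- If the path from `a` to `b` leads from the parent of `x` to `x`, then no vertex that is removed
after `x` lies farther along this path than the parent of `x`. -/
theorem pos_le_pos_par {x : Fin n} (hx : x ≠ a) (hlt : I.pos a b (par x) < I.pos a b x)
    {v : Fin n} (hv : rank x < rank v) : I.pos a b v ≤ I.pos a b (par x) := by
  by_contra! hcon
  have h1 := hE.dist_of_rank_lt ((hE.lt_par x hx).trans_le (hE.le_root _))
  have h2 := hE.dist_of_rank_lt hv
  have h3 := h.height_le_dist hcon
  have h4 := h.dist_le_height a b x v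
  have := pos_add_height (I := I) a b x
  have := pos_add_height (I := I) a b (par x)
  -- By `h2` the path from `x` to `v` starts by going back to the parent. If both `x` and `v` hang
  -- beyond the parent, this detour is longer than the bound `h4` allows.
  have := h.dist_comm x a
  have := h.dist_comm (par x) a
  rcases abs_cases (I.pos a b x - I.pos a b v) with ⟨h5, _⟩ | ⟨h5, _⟩ <;> linarith

/-- If the path from `a` to `b` leads from the parent of `x` to `x`, then it visits `x`. -/
theorem height_eq_zero {x : Fin n} (hx : x ≠ a) (hlt : I.pos a b (par x) < I.pos a b x) :
    I.height a b x = 0 := by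
  have h1 := hE.dist_of_rank_lt ((hE.lt_par x hx).trans_le (hE.le_root _))
  have h2 := h.height_le_dist hlt
  rw [h.dist_comm (par x) x, h.dist_adj _ _ (hE.adj x hx)] at h2
  have h3 := hE.dist_eq_add_or_eq_sub hx b
  have h4 := h.height_nonneg a b (par x)
  have := h.dist_comm x a
  have := h.dist_comm (par x) a
  have := h.dist_comm x b
  have := h.dist_comm (par x) b
  simp only [pos, height] at *
  rcases h3 with h3 | h3 <;> linarith

end MetricTree

/-- A partition of the vertices in `S` into `M` clusters. Cluster `l` consists of vertices whose
positions are between `y l` and `y l + η`, and its centre `rep l` lies on the path from `a` to `b`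
at the position `y l`. -/
structure Clusters (I : Doap n) (a b : Fin n) (η : ℝ) (S : Fin n → Prop) (cl : Fin n → ℕ) (M : ℕ)
    (rep : ℕ → ℕ) (y : ℕ → ℝ) : Prop where
  pos : 0 < M
  lt : ∀ v, S v → cl v < M
  le_pos : ∀ v, S v → y (cl v) ≤ I.pos a b v
  pos_le : ∀ v, S v → I.pos a b v ≤ y (cl v) + η
  center : ∀ l < M, ∃ r : Fin n, S r ∧ rep l = r ∧ I.pos a b r = y l ∧ I.height a b r = 0 ∧ cl r = l
  gap : ∀ l, l + 1 < M → y l + η < y (l + 1)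
  last : ∀ v, S v → y (M - 1) ≤ I.pos a b v → cl v = M - 1

/-- `P l` is the maximum of `f` over the cluster `l`. -/
structure Maxima (S : Fin n → Prop) (cl : Fin n → ℕ) (M : ℕ) (f : Fin n → ℝ) (P : ℕ → ℝ) :
    Prop where
  le : ∀ v, S v → f v ≤ P (cl v)
  eq : ∀ l < M, ∃ v, S v ∧ cl v = l ∧ P l = f v

variable {a b : Fin n} {η : ℝ} {S S' : Fin n → Prop} {cl cl' : Fin n → ℕ} {M : ℕ}

theorem Maxima.insert {f : Fin n → ℝ} {P P' : ℕ → ℝ} (h : Maxima S cl M f P) {x : Fin n}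
    (hx : ¬ S x) (hS : ∀ v, S' v ↔ v = x ∨ S v) {c : ℕ}
    (hcl : ∀ v, cl' v = if v = x then c else cl v)
    (hP : ∀ l, P' l = if l = c then max (P l) (f x) else P l) : Maxima S' cl' M f P' := by
  refine ⟨fun v hv => ?_, fun l hl => ?_⟩
  · rcases (hS v).1 hv with rfl | hv
    · rw [hcl, if_pos rfl, hP, if_pos rfl]; exact le_max_right _ _
    · rw [hcl, if_neg (by rintro rfl; exact hx hv), hP]
      have := h.le v hv
      split_ifs
      · exact this.trans (le_max_left _ _)
      · exact this
  · obtain ⟨v, h1, h2, h3⟩ := h.eq l hl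
    have hvx : v ≠ x := by rintro rfl; exact hx h1
    rw [hP]
    split_ifs with h4
    · rcases le_total (P l) (f x) with h5 | h5
      · exact ⟨x, (hS x).2 (.inl rfl), by rw [hcl, if_pos rfl, h4], max_eq_right h5⟩
      · exact ⟨v, (hS v).2 (.inr h1), by rw [hcl, if_neg hvx, h2], by rw [max_eq_left h5, h3]⟩
    · exact ⟨v, (hS v).2 (.inr h1), by rw [hcl, if_neg hvx, h2], h3⟩

theorem Maxima.new {f : Fin n → ℝ} {P P' : ℕ → ℝ} (h : Maxima S cl M f P) {x : Fin n}
    (hx : ¬ S x) (hlt : ∀ v, S v → cl v < M) (hS : ∀ v, S' v ↔ v = x ∨ S v)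
    (hcl : ∀ v, cl' v = if v = x then M else cl v)
    (hP : ∀ l, P' l = if l = M then f x else P l) : Maxima S' cl' (M + 1) f P' := by
  refine ⟨fun v hv => ?_, fun l hl => ?_⟩
  · rcases (hS v).1 hv with rfl | hv
    · rw [hcl, if_pos rfl, hP, if_pos rfl]
    · have := hlt v hv
      rw [hcl, if_neg (by rintro rfl; exact hx hv), hP, if_neg (by omega)]
      exact h.le v hv
  · rw [hP]
    split_ifs with h4
    · exact ⟨x, (hS x).2 (.inl rfl), by rw [hcl, if_pos rfl, h4], rfl⟩
    · obtain ⟨v, h1, h2, h3⟩ := h.eq l (by omega)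
      exact ⟨v, (hS v).2 (.inr h1), by rw [hcl, if_neg (by rintro rfl; exact hx h1), h2], h3⟩

namespace Clusters

variable {rep rep' : ℕ → ℕ} {y y' : ℕ → ℝ} (hC : I.Clusters a b η S cl M rep y)
include hC

theorem le_card : M ≤ n := by
  have : (Finset.range M) ⊆ Finset.univ.image cl := fun l hl => by
    obtain ⟨r, -, -, -, -, h1⟩ := hC.center l (Finset.mem_range.1 hl)
    exact Finset.mem_image.2 ⟨r, Finset.mem_univ r, h1⟩
  simpa using (Finset.card_le_card this).trans Finset.card_image_le

theorem lt_card {x : Fin n} (hx : ¬ S x) : M < n := by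
  have : (Finset.range M) ⊆ (Finset.univ.erase x).image cl := fun l hl => by
    obtain ⟨r, h1, -, -, -, h2⟩ := hC.center l (Finset.mem_range.1 hl)
    refine Finset.mem_image.2 ⟨r, Finset.mem_erase.2 ⟨?_, Finset.mem_univ r⟩, h2⟩
    rintro rfl
    exact hx h1
  have h1 := (Finset.card_le_card this).trans Finset.card_image_le
  rw [Finset.card_erase_of_mem (Finset.mem_univ x)] at h1
  have := x.pos
  simp at h1
  omega

theorem strictMono (hη : 0 < η) {l l' : ℕ} (hl : l < l') (hM : l' < M) : y l < y l' := by
  induction l' with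
  | zero => omega
  | succ j ih =>
    have h1 := hC.gap j hM
    rcases Nat.lt_succ_iff_lt_or_eq.1 hl with h2 | rfl
    · linarith [ih h2 (by omega)]
    · linarith

/-- Successive centres are more than `η` apart on a path of length `I.dist a b`. This bounds the
number of clusters by a multiple of `1 / ε`. -/
theorem mul_le (h : I.MetricTree) (he : I.Ends a b) : ((M : ℝ) - 1) * η ≤ I.dist a b := by
  have h1 : ∀ l < M, (l : ℝ) * η ≤ y l := by
    intro l hl
    induction l with
    | zero =>
      obtain ⟨r, -, -, h2, -, -⟩ := hC.center 0 hl
      rw [← h2]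
      have := h.height_nonneg a b r
      have := MetricTree.height_le_pos he r
      push_cast
      linarith
    | succ l ih =>
      have := hC.gap l hl
      have := ih (by omega)
      push_cast
      linarith
  have h2 := hC.pos
  have h3 := h1 (M - 1) (by omega)
  obtain ⟨r, -, -, h4, -, -⟩ := hC.center (M - 1) (by omega)
  rw [← h4, Nat.cast_sub (by omega)] at h3
  have := h.height_nonneg a b r
  have := MetricTree.height_le_sub_pos he r
  push_cast at h3
  linarith

variable (h : I.MetricTree) {par : Fin n → Fin n} {rank : Fin n → ℕ}
  (hE : I.Elimination a par rank)
include h hE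

/-- The next vertex may join the cluster of its parent. -/
theorem insert {x : Fin n} (hx : x ≠ a) (hSr : ∀ v, S v ↔ rank x < rank v)
    (hS : ∀ v, S' v ↔ v = x ∨ S v) (hcl : ∀ v, cl' v = if v = x then cl (par x) else cl v)
    (hle : I.pos a b x ≤ y (cl (par x)) + η) : I.Clusters a b η S' cl' M rep y := by
  have hSp := (hSr (par x)).2 (hE.lt_par x hx)
  have hSx : ¬ S x := fun h1 => by simpa using (hSr x).1 h1
  have hne : ∀ v, S v → v ≠ x := by rintro v hv rfl; exact hSx hv
  have hpp := h.pos_par_le (b := b) hE hx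
  refine ⟨hC.pos, fun v hv => ?_, fun v hv => ?_, fun v hv => ?_, fun l hl => ?_, hC.gap,
    fun v hv hlv => ?_⟩
  · rw [hcl]
    rcases (hS v).1 hv with rfl | hv
    · rw [if_pos rfl]; exact hC.lt _ hSp
    · rw [if_neg (hne v hv)]; exact hC.lt v hv
  · rw [hcl]
    rcases (hS v).1 hv with rfl | hv
    · rw [if_pos rfl]; exact (hC.le_pos _ hSp).trans hpp
    · rw [if_neg (hne v hv)]; exact hC.le_pos v hv
  · rw [hcl]
    rcases (hS v).1 hv with rfl | hv
    · rw [if_pos rfl]; exact hle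
    · rw [if_neg (hne v hv)]; exact hC.pos_le v hv
  · obtain ⟨r, h1, h2, h3, h4, h5⟩ := hC.center l hl
    exact ⟨r, (hS r).2 (.inr h1), h2, h3, h4, by rw [hcl, if_neg (hne r h1), h5]⟩
  · rw [hcl]
    rcases (hS v).1 hv with rfl | hv
    · rw [if_pos rfl]
      refine hC.last _ hSp ?_
      -- If the position grows from the parent to `x`, no earlier centre lies beyond the parent, so
      -- `last` applies to the parent; if it does not grow, `last` applies directly.
      rcases hpp.lt_or_eq with h1 | h1
      · obtain ⟨r, h2, -, h3, -, -⟩ := hC.center (M - 1) (by have := hC.pos; omega)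
        rw [← h3]
        exact h.pos_le_pos_par hE hx h1 ((hSr r).1 h2)
      · rw [h1]; exact hlv
    · rw [if_neg (hne v hv)]; exact hC.last v hv hlv

/-- The next vertex may become the centre of a new cluster. -/
theorem new (hη : 0 < η) {x : Fin n} (hx : x ≠ a) (hSr : ∀ v, S v ↔ rank x < rank v)
    (hS : ∀ v, S' v ↔ v = x ∨ S v) (hcl : ∀ v, cl' v = if v = x then M else cl v)
    (hrep : ∀ l, rep' l = if l = M then (x : ℕ) else rep l)
    (hy : ∀ l, y' l = if l = M then I.pos a b x else y l)
    (hlt : y (cl (par x)) + η < I.pos a b x) : I.Clusters a b η S' cl' (M + 1) rep' y' := by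
  have hSp := (hSr (par x)).2 (hE.lt_par x hx)
  have hSx : ¬ S x := fun h1 => by simpa using (hSr x).1 h1
  have hne : ∀ v, S v → v ≠ x := by rintro v hv rfl; exact hSx hv
  -- The position grows only along the path from `a` to `b`, so the new centre is a vertex of that
  -- path and all earlier vertices hang no farther than its parent.
  have hlt' : I.pos a b (par x) < I.pos a b x := (hC.pos_le _ hSp).trans_lt hlt
  have hle : ∀ v, S v → I.pos a b v ≤ I.pos a b (par x) := fun v hv =>
    h.pos_le_pos_par hE hx hlt' ((hSr v).1 hv)
  have hcM : ∀ v, S v → y' (cl v) = y (cl v) := fun v hv => by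
    have := hC.lt v hv
    rw [hy, if_neg (by omega)]
  refine ⟨by omega, fun v hv => ?_, fun v hv => ?_, fun v hv => ?_, fun l hl => ?_, fun l hl => ?_,
    fun v hv hlv => ?_⟩
  · rw [hcl]
    rcases (hS v).1 hv with rfl | hv
    · simp
    · rw [if_neg (hne v hv)]; exact (hC.lt v hv).trans (by omega)
  · rw [hcl]
    rcases (hS v).1 hv with rfl | hv
    · rw [if_pos rfl, hy, if_pos rfl]
    · rw [if_neg (hne v hv), hcM v hv]; exact hC.le_pos v hv
  · rw [hcl]
    rcases (hS v).1 hv with rfl | hv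
    · rw [if_pos rfl, hy, if_pos rfl]; linarith
    · rw [if_neg (hne v hv), hcM v hv]; exact hC.pos_le v hv
  · rcases Nat.lt_succ_iff_lt_or_eq.1 hl with h1 | rfl
    · obtain ⟨r, h2, h3, h4, h5, h6⟩ := hC.center l h1
      exact ⟨r, (hS r).2 (.inr h2), by rw [hrep, if_neg (by omega), h3],
        by rw [hy, if_neg (by omega), h4], h5, by rw [hcl, if_neg (hne r h2), h6]⟩
    · exact ⟨x, (hS x).2 (.inl rfl), by rw [hrep, if_pos rfl], by rw [hy, if_pos rfl],
        h.height_eq_zero hE hx hlt', by rw [hcl, if_pos rfl]⟩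
  · rw [hy, hy, if_neg (by omega)]
    split_ifs with h1
    -- The parent hangs at or beyond the last centre, hence belongs to the last cluster; the failed
    -- test then says that the new centre is more than `η` beyond that centre.
    · obtain ⟨r, h2, -, h3, -, -⟩ := hC.center (M - 1) (by have := hC.pos; omega)
      have h4 := hle r h2
      rw [h3] at h4
      have h5 := hC.last _ hSp h4
      rw [h5] at hlt
      rwa [show l = M - 1 by omega]
    · exact hC.gap l (by omega)
  · rw [hcl]
    rcases (hS v).1 hv with rfl | hv
    · simp
    · rw [Nat.add_sub_cancel, hy, if_pos rfl] at hlv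
      linarith [hle v hv]

end Clusters

end Doap

/-! ### The program: clusters -/

/-- The clusters of all vertices, with the maximal distances from `a` of the vertices in an initial
segment, and from `b` of the vertices in a final segment of the sequence of clusters. -/
structure Doap.Summary {n : ℕ} (I : Doap n) (a b : Fin n) (η : ℝ) (cl : Fin n → ℕ) (M : ℕ)
    (rep : ℕ → ℕ) (y P Q : ℕ → ℝ) : Prop where
  clusters : I.Clusters a b η (fun _ => True) cl M rep y
  left_le : ∀ l < M, ∀ v, cl v ≤ l → I.dist a v ≤ P l
  left_eq : ∀ l < M, ∃ v, cl v ≤ l ∧ P l = I.dist a v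
  right_le : ∀ l < M, ∀ v, l ≤ cl v → I.dist b v - I.dist a b ≤ Q l
  right_eq : ∀ l < M, ∃ v, l ≤ cl v ∧ Q l = I.dist b v - I.dist a b

namespace Prog

/-- Replace a cell of a real array by its maximum with `e`. -/
def updMax (A : Fin 24) (i : NExp 24) (e : RExp 24) : Stmt 24 :=
  .ite (rlt (.get A i) e) (.rput A i e) .skip

theorem updMax_wp {m : Machine} {s : Store 24} {A : Fin 24} {i : NExp 24} {e : RExp 24} {c : ℕ}
    {x : ℝ} {Q : Store 24 → Prop} (hi : ∀ R : ℕ → Prop, R c → i.wp m s R)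
    (he : ∀ R : ℝ → Prop, R x → e.wp m s R) (hc : c < m.size)
    (hQ : ∀ s', Frame [] [] [] [A] s s' →
      (∀ l, s'.rarr A l = if l = c then max (s.rarr A l) x else s.rarr A l) → Q s') :
    (updMax A i e).wp m Q s := by
  refine he _ (hi _ ⟨hc, fun h => ?_, fun h => hi _ ⟨hc, he _ ?_⟩⟩)
  · refine hQ _ (Frame.refl _) fun l => ?_
    split_ifs with h1
    · rw [h1, max_eq_left h]
    · rfl
  · refine hQ _ ((Frame.refl _).putR (by simp)) fun l => ?_
    rw [Store.putR_rarr, if_pos rfl]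
    split_ifs with h1
    · rw [h1, max_eq_right h.le]
    · rfl

/-- The first cluster consists of the end `a` of the longest path. -/
def clusterInit : Stmt 24 :=
  -- The constant is `21 = 7 * 3`: the additive error is seven cluster widths, and the longest path
  -- is at most three times the optimum.
  .rset 1 (.get 2 (.reg 12)) ;; .rset 2 (.div (.mul (.reg 0) (.reg 1)) (.const 21)) ;;
    .nput 5 (.reg 2) (.const 0) ;; .nput 6 (.const 0) (.reg 2) ;;
    .rput 4 (.const 0) (.const 0) ;; .rput 5 (.const 0) (.const 0) ;;
    .rput 6 (.const 0) (.const 0) ;; .nset 9 (.const 1) ;; .nset 3 (.sub (.reg 0) (.const 1))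

/-- Put the vertex in register `6` into the cluster of its parent. -/
def oldCluster : Stmt 24 :=
  .nput 5 (.reg 6) (.reg 10) ;; updMax 5 (.reg 10) (.get 2 (.reg 6)) ;;
    updMax 6 (.reg 10) (.sub (.get 3 (.reg 6)) (.reg 1))

/-- Make the vertex in register `6` the centre of a new cluster. -/
def newCluster : Stmt 24 :=
  .nput 5 (.reg 6) (.reg 9) ;; .nput 6 (.reg 9) (.reg 6) ;; .rput 4 (.reg 9) (.reg 9) ;;
    .rput 5 (.reg 9) (.get 2 (.reg 6)) ;; .rput 6 (.reg 9) (.sub (.get 3 (.reg 6)) (.reg 1)) ;;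
    incr 9

/-- Put the next vertex into a cluster. -/
def clusterBody : Stmt 24 :=
  .nset 3 (.sub (.reg 3) (.const 1)) ;; .nset 6 (.get 4 (.reg 3)) ;; fetch ;;
    .nset 10 (.get 5 (.reg 8)) ;;
    .rset 9 (.div (.sub (.add (.get 2 (.reg 6)) (.reg 1)) (.get 3 (.reg 6))) (.const 2)) ;;
    .ite (.rle (.reg 9) (.add (.get 4 (.reg 10)) (.reg 2))) oldCluster newCluster

/-- Compute the maxima over the initial segments. -/
def prefixMax : Stmt 24 :=
  .nset 3 (.const 1) ;; .loop (lt (.reg 3) (.reg 9))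
    (updMax 5 (.reg 3) (.get 5 (.sub (.reg 3) (.const 1))) ;; incr 3)

/-- Compute the maxima over the final segments. -/
def suffixMax : Stmt 24 :=
  .nset 3 (.sub (.reg 9) (.const 1)) ;; .loop (lt (.const 0) (.reg 3))
    (.nset 3 (.sub (.reg 3) (.const 1)) ;; updMax 6 (.reg 3) (.get 6 (.add (.reg 3) (.const 1))))

/-- Compute the clusters and their maxima. -/
def cluster : Stmt 24 :=
  (clusterInit ;; .loop (lt (.const 0) (.reg 3)) clusterBody) ;; prefixMax ;; suffixMax

section

open Doap

variable {n : ℕ} {I : Doap n} {L : EdgeList I.tree} {W : ℕ} {s₀ : Store 24}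

/-- The registers and arrays that are changed by `cluster`. -/
abbrev ClusterFrame (s s' : Store 24) : Prop :=
  Frame [3, 6, 7, 8, 9, 10] [1, 2, 9] [5, 6] [4, 5, 6] s s'

/-- The distances from the ends of a longest path are available. -/
structure HasEnds (I : Doap n) (a b : Fin n) (η : ℝ) (s : Store 24) : Prop where
  left : ∀ v : Fin n, s.rarr 2 v = I.dist a v
  right : ∀ v : Fin n, s.rarr 3 v = I.dist b v
  diam : s.rreg 1 = I.dist a b
  width : s.rreg 2 = η

theorem HasEnds.frame {a b : Fin n} {η : ℝ} {s s' : Store 24} {N R A B : List (Fin 24)}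
    (h : HasEnds I a b η s) (hF : Frame N R A B s s')
    (h1 : 1 ∉ R := by decide) (h2 : 2 ∉ R := by decide) (h3 : 2 ∉ B := by decide)
    (h4 : 3 ∉ B := by decide) : HasEnds I a b η s' := by
  refine ⟨?_, ?_, (hF.rreg 1 h1).trans h.diam, (hF.rreg 2 h2).trans h.width⟩
  · rw [hF.rarr 2 h3]; exact h.left
  · rw [hF.rarr 3 h4]; exact h.right

/-- The clusters of the vertices in `S`, and their maxima, are stored. -/
structure Clustered (I : Doap n) (a b : Fin n) (η : ℝ) (S : Fin n → Prop) (s : Store 24) :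
    Prop where
  clusters : I.Clusters a b η S (fun v => s.narr 5 v) (s.nreg 9) (s.narr 6) (s.rarr 4)
  left : Maxima S (fun v => s.narr 5 v) (s.nreg 9) (I.dist a) (s.rarr 5)
  right : Maxima S (fun v => s.narr 5 v) (s.nreg 9) (fun v => I.dist b v - I.dist a b) (s.rarr 6)

theorem clusterBody_wp (hW : 2 * n + 2 ≤ W) (hM : I.MetricTree) {a b : Fin n} {η : ℝ} (hη : 0 < η)
    {par : Fin n → Fin n} {rank : Fin n → ℕ} {s : Store 24} (hL : I.Loaded L s)
    (hO : Ordered L a par rank s) (hD : HasEnds I a b η s) {S S' : Fin n → Prop} {x : Fin n}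
    (hx : x ≠ a) (h3 : s.nreg 3 = rank x + 1) (hSr : ∀ v, S v ↔ rank x < rank v)
    (hS : ∀ v, S' v ↔ v = x ∨ S v) (hC : Clustered I a b η S s) :
    clusterBody.wp (I.machine W) (fun s' =>
      Frame [3, 6, 7, 8, 9, 10] [9] [5, 6] [4, 5, 6] s s' ∧ s'.nreg 3 = rank x ∧
        Clustered I a b η S' s') s := by
  have hrx := hO.rank_lt x hx
  have hSx : ¬ S x := fun h1 => by simpa using (hSr x).1 h1
  have hSp := (hSr (par x)).2 (hO.elim.lt_par x hx)
  have hcM := hC.clusters.lt _ hSp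
  have hMn := hC.clusters.lt_card hSx
  simp only [clusterBody, Stmt.wp, NExp.wp, h3, Doap.machine_word, Doap.machine_size,
    Store.setN_nreg, Store.setN_narr, if_true, Nat.add_sub_cancel, hO.ord x hx]
  refine ⟨by omega, by omega, by omega, ?_⟩
  have hFr : Frame [3, 6] [] [] [] s ((s.setN 3 (rank x)).setN 6 x) :=
    ((Frame.refl s).setN (by decide)).setN (by decide)
  refine fetch_wp hW (hL.frame hFr) (hO.frame hFr) hx (by simp) fun k _ => ?_
  have hpar := (par x).2
  set c := s.narr 5 (par x) with hc
  simp only [NExp.wp, RExp.wp, Store.setN_nreg, Store.setN_rarr, Store.setN_narr,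
    Store.setN_rreg, Fin.reduceEq, if_true,
    if_false, Doap.machine_size, x.2, hpar, true_and, hD.left, hD.right, hD.diam, ← hc]
  set s1 := (((((s.setN 3 (rank x)).setN 6 x).setN 7 k).setN 8 (par x)).setN 10 c).setR 9
    ((I.dist a x + I.dist a b - I.dist b x) / ((2 : ℚ) : ℝ)) with hs1
  have hF1 : Frame [3, 6, 7, 8, 9, 10] [9] [5, 6] [4, 5, 6] s s1 :=
    (((((Frame.refl s).setN (by decide)).setN (by decide)).setN (by decide)).setN
      (by decide)).setN (by decide) |>.setR (by decide)
  have hpos : s1.rreg 9 = I.pos a b x := by simp [s1, pos]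
  have h16 : s1.nreg 6 = x := by simp [s1]
  have h13 : s1.nreg 3 = rank x := by simp [s1]
  have h19 : s1.nreg 9 = s.nreg 9 := by simp [s1]
  have h110 : s1.nreg 10 = c := by simp [s1]
  have h12 : s1.rreg 2 = η := by simp [s1, hD.width]
  have h11 : s1.rreg 1 = I.dist a b := by simp [s1, hD.diam]
  have hn1 : s1.narr = s.narr := rfl
  have hr1 : s1.rarr = s.rarr := rfl
  have hcn : c < n := by omega
  clear_value s1
  simp only [BExp.wp, RExp.wp, NExp.wp, hpos, h110, h12, Doap.machine_size, hcn, true_and]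
  constructor
  · intro hle
    simp only [oldCluster, Stmt.wp, NExp.wp, h16, h110, Doap.machine_size, x.2, true_and]
    refine updMax_wp (c := c) (x := I.dist a x) (fun R hR => by simpa [NExp.wp, h110] using hR)
      (fun R hR => by simpa [RExp.wp, NExp.wp, h16, hr1, hD.left] using hR) hcn
      fun s2 hF2 hP => ?_
    refine updMax_wp (c := c) (x := I.dist b x - I.dist a b)
      (fun R hR => by simpa [NExp.wp, h110, hF2.nreg] using hR)
      (fun R hR => by simpa [RExp.wp, NExp.wp, h16, hr1, hD.right, hF2.nreg, hF2.rreg,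
        hF2.rarr, h11] using hR) hcn fun s3 hF3 hQ => ?_
    have hF23 : Frame [3, 6, 7, 8, 9, 10] [9] [5, 6] [4, 5, 6] s s3 :=
      ((hF1.putN (by decide)).trans hF2).trans hF3
    have hcl : ∀ v : Fin n, s3.narr 5 v = if v = x then c else s.narr 5 v := fun v => by
      rw [hF3.narr 5 (by decide), hF2.narr 5 (by decide)]
      simp [hn1, Fin.val_inj]
    have hM3 : s3.nreg 9 = s.nreg 9 := by
      rw [hF3.nreg 9 (by decide), hF2.nreg 9 (by decide)]
      simpa using h19
    have hrep : s3.narr 6 = s.narr 6 := by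
      rw [hF3.narr 6 (by decide), hF2.narr 6 (by decide)]
      ext l; simp [hn1]
    have hy : s3.rarr 4 = s.rarr 4 := by
      rw [hF3.rarr 4 (by decide), hF2.rarr 4 (by decide)]
      simp [hr1]
    refine ⟨hF23, ?_, ⟨?_, ?_, ?_⟩⟩
    · rw [hF3.nreg 3 (by decide), hF2.nreg 3 (by decide)]
      simpa using h13
    · rw [hM3, hrep, hy]
      refine hC.clusters.insert hM hO.elim hx hSr hS hcl ?_
      rwa [hr1] at hle
    · rw [hM3]
      refine hC.left.insert hSx hS (c := c) hcl fun l => ?_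
      rw [hF3.rarr 5 (by decide), hP]
      simp [hr1]
    · rw [hM3]
      refine hC.right.insert hSx hS (c := c) hcl fun l => ?_
      rw [hQ, hF2.rarr 6 (by decide)]
      simp [hr1]
  · intro hlt
    simp only [newCluster, incr, Stmt.wp, NExp.wp, RExp.wp, h16, h19, h11, hr1, hD.left, hD.right,
      hpos, Doap.machine_size, Doap.machine_word, x.2, hMn, true_and, Store.putN_nreg,
      Store.putN_rarr, Store.putR_rarr, Store.putR_nreg, Store.putN_rreg, Store.putR_rreg,
      Fin.reduceEq, if_false]
    refine ⟨by omega, by omega,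
      (((((hF1.putN (by decide)).putN (by decide)).putR (by decide)).putR (by decide)).putR
        (by decide)).setN (by decide), by simpa using h13, ⟨?_, ?_, ?_⟩⟩
    · simp only [Store.setN_nreg, if_true]
      refine hC.clusters.new hM hO.elim hη hx hSr hS (fun v => ?_) (fun l => ?_) (fun l => ?_) ?_
      · simp [hn1, Fin.val_inj]
      · simp [hn1]
      · simp [hr1]
      · rwa [hr1] at hlt
    · simp only [Store.setN_nreg, if_true]
      refine hC.left.new hSx hC.clusters.lt hS (fun v => ?_) (fun l => ?_)
      · simp [hn1, Fin.val_inj]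
      · simp [hr1]
    · simp only [Store.setN_nreg, if_true]
      refine hC.right.new hSx hC.clusters.lt hS (fun v => ?_) (fun l => ?_)
      · simp [hn1, Fin.val_inj]
      · simp [hr1]

theorem clusterLoop_spec (h2n : 2 ≤ n) (hW : 2 * n + 2 ≤ W) (hM : I.MetricTree) {a b : Fin n}
    (hab : a ≠ b) (hL : I.Loaded L s₀) {par : Fin n → Fin n} {rank : Fin n → ℕ}
    (hO : Ordered L a par rank s₀) (h2 : s₀.nreg 2 = a) (h12 : s₀.nreg 12 = b)
    (hda : ∀ v : Fin n, s₀.rarr 2 v = I.dist a v) (hdb : ∀ v : Fin n, s₀.rarr 3 v = I.dist b v)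
    {ε η : ℝ} (hε : 0 < ε) (hs : s₀.rreg 0 = ε) (hη : η = ε * I.dist a b / 21) :
    Tri (I.machine W) (clusterInit ;; .loop (lt (.const 0) (.reg 3)) clusterBody) s₀
      (100 + (n + 1) * 100) fun s => ClusterFrame s₀ s ∧ HasEnds I a b η s ∧
        Clustered I a b η (fun _ => True) s := by
  have hE := hO.elim
  have hη0 : 0 < η := by rw [hη]; have := hM.dist_pos a b hab; positivity
  refine Tri.mono (T := clusterInit.flatCost + (n + 1) * 100) ?_
    (by have : clusterInit.flatCost ≤ 100 := by decide
        omega) fun _ h => h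
  refine Tri.wp_seq (T := (n + 1) * 100) ?_
  simp only [clusterInit, Stmt.wp, NExp.wp, RExp.wp, h12, hda, h2, hs, hL.n_eq, a.2, b.2, true_and,
    Doap.machine_size, Doap.machine_word, Store.setR_rreg, Store.setR_nreg, Store.putN_nreg,
    Store.putR_nreg, Store.setN_nreg, Fin.reduceEq, if_true, if_false, Nat.zero_le]
  refine ⟨by omega, by omega, by omega, by omega, by omega, by omega, by omega, ?_⟩
  refine Tri.loop_wp n 100 (by decide)
    (fun i s => ClusterFrame s₀ s ∧ HasEnds I a b η s ∧ s.nreg 3 = n - 1 - i ∧ i ≤ n - 1 ∧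
      Clustered I a b η (fun v => n - 1 - i ≤ rank v) s) ?_ _ ?_
  · rintro i s ⟨hF, hD, hi, hin, hC⟩
    simp only [lt, BExp.wp, NExp.wp, hi, Doap.machine_word, Nat.zero_le, true_and]
    refine ⟨fun h => ⟨hF, hD, ?_⟩, fun h => ⟨by omega, ?_⟩⟩
    · have h0 : (fun v => n - 1 - i ≤ rank v) = fun _ => True := by
        funext v; simp only [eq_iff_iff, iff_true]; omega
      rwa [h0] at hC
    · obtain ⟨x, hx, hrx⟩ := hO.exists_rank (n - 1 - (i + 1)) (by omega)
      refine (Tri.of_wp _ (clusterBody_wp (S' := fun v => n - 1 - (i + 1) ≤ rank v) hW hM hη0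
        (hL.frame hF) (hO.frame hF) hD hx (by omega) (fun v => by omega) (fun v => ?_) hC)).mono
        le_rfl fun s' ⟨hF', h3, hC'⟩ => ?_
      · rw [← hrx]
        constructor
        · intro h1
          rcases h1.eq_or_lt with h2 | h2
          · exact .inl (hE.inj h2).symm
          · exact .inr (by omega)
        · rintro (rfl | h1)
          · exact le_rfl
          · omega
      · exact ⟨hF.trans hF', hD.frame hF', by omega, by omega, hC'⟩
  · have hrank : ∀ v, n - 1 - 0 ≤ rank v ↔ v = a := fun v => by
      constructor
      · intro h1
        by_contra h3
        have := hO.rank_lt v h3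
        omega
      · rintro rfl
        rw [hO.rank_root]
        omega
    have hpos : I.pos a b a = 0 := by
      simp only [pos, hM.dist_self, hM.dist_comm b a]; ring
    have hheight : I.height a b a = 0 := by
      simp only [height, hM.dist_self, hM.dist_comm b a]; ring
    refine ⟨((((((((((Frame.refl _).setR (by decide)).setR (by decide)).putN (by decide)).putN
      (by decide)).putR (by decide)).putR (by decide)).putR (by decide)).setN (by decide)).setN
      (by decide)), ⟨by simpa using hda, by simpa using hdb, by simp, by simp [hη]⟩, by simp,
      by omega, ⟨⟨?_, ?_, ?_, ?_, ?_, ?_, ?_⟩, ⟨?_, ?_⟩, ⟨?_, ?_⟩⟩⟩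
    all_goals simp only [hrank, forall_eq, Store.setN_nreg, Store.setN_narr, Store.setN_rarr,
      Store.putR_rarr, Store.putR_narr, Store.putN_narr, Store.putN_rarr, Fin.reduceEq, if_true,
      if_false, hpos]
    · omega
    · omega
    · simp
    · simp [hη0.le]
    · intro l hl
      obtain rfl : l = 0 := by omega
      exact ⟨a, rfl, by simp, by simp [hpos], hheight, by simp⟩
    · intro l hl; omega
    · simp
    · simp [hM.dist_self]
    · intro l hl
      obtain rfl : l = 0 := by omega
      exact ⟨a, rfl, by simp, by simp [hM.dist_self]⟩
    · simp [hM.dist_comm b a]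
    · intro l hl
      obtain rfl : l = 0 := by omega
      exact ⟨a, rfl, by simp, by simp [hM.dist_comm b a]⟩

theorem prefixMax_spec (h2n : 2 ≤ n) (hW : 2 * n + 2 ≤ W) {cl : Fin n → ℕ} {M : ℕ} (hMn : M ≤ n)
    (hM0 : 0 < M) (h9 : s₀.nreg 9 = M) {f : Fin n → ℝ}
    (hP : Maxima (fun _ => True) cl M f (s₀.rarr 5)) :
    Tri (I.machine W) prefixMax s₀ (2 + (n + 1) * 100) fun s =>
      Frame [3] [] [] [5] s₀ s ∧ ∀ l < M, (∀ v, cl v ≤ l → f v ≤ s.rarr 5 l) ∧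
        ∃ v, cl v ≤ l ∧ s.rarr 5 l = f v := by
  refine Tri.wp_seq (T := (n + 1) * 100) ?_
  simp only [Stmt.wp, NExp.wp, Doap.machine_word]
  refine ⟨by omega, ?_⟩
  refine Tri.loop_wp n 100 (by decide) (fun i s => Frame [3] [] [] [5] s₀ s ∧ s.nreg 3 = i + 1 ∧
    i + 1 ≤ M ∧ (∀ l ≤ i, (∀ v, cl v ≤ l → f v ≤ s.rarr 5 l) ∧ ∃ v, cl v ≤ l ∧ s.rarr 5 l = f v) ∧
    ∀ l, i < l → s.rarr 5 l = s₀.rarr 5 l) ?_ _ ?_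
  · rintro i s ⟨hF, hi, hiM, hl, hr⟩
    simp only [lt, BExp.wp, NExp.wp, hi, hF.nreg 9 (by decide), h9]
    refine ⟨fun h => ⟨hF, fun l hlM => hl l (by omega)⟩, fun h => ⟨by omega, Tri.of_wp _ ?_⟩⟩
    simp only [Stmt.wp]
    refine updMax_wp (c := i + 1) (x := s.rarr 5 i) (fun R hR => by simpa [NExp.wp, hi] using hR)
      (fun R hR => ?_) (by simpa using by omega) fun s' hF' hP' => ?_
    · simp only [RExp.wp, NExp.wp, hi, Doap.machine_word, Doap.machine_size, Nat.add_sub_cancel]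
      exact ⟨by omega, by omega, by omega, hR⟩
    · simp only [incr, Stmt.wp, NExp.wp, hF'.nreg 3 (by decide), hi, Doap.machine_word]
      refine ⟨by omega, by omega, (hF.trans hF').setN (by decide), by simp, by omega,
        fun l hli => ?_, fun l hli => ?_⟩
      · simp only [Store.setN_rarr, hP']
        rcases Nat.le_succ_iff.1 hli with h1 | rfl
        · rw [if_neg (by omega)]; exact hl l h1
        · rw [if_pos rfl, hr (i + 1) (by omega)]
          obtain ⟨w, -, hw, hw'⟩ := hP.eq (i + 1) h
          obtain ⟨hi1, u, hu, hu'⟩ := hl i le_rfl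
          refine ⟨fun v hv => ?_, ?_⟩
          · rcases Nat.le_succ_iff.1 hv with h1 | h1
            · exact (hi1 v h1).trans (le_max_right _ _)
            · have := hP.le v trivial
              rw [h1] at this
              exact this.trans (le_max_left _ _)
          · rcases le_total (s₀.rarr 5 (i + 1)) (s.rarr 5 i) with h1 | h1
            · exact ⟨u, by omega, by rw [max_eq_right h1, hu']⟩
            · exact ⟨w, by omega, by rw [max_eq_left h1, hw']⟩
      · simp only [Store.setN_rarr, hP']
        rw [if_neg (by omega)]
        exact hr l (by omega)
  · refine ⟨(Frame.refl _).setN (by decide), by simp, by omega, fun l hl => ?_, fun l hl => by simp⟩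
    obtain rfl : l = 0 := by omega
    obtain ⟨w, -, hw, hw'⟩ := hP.eq 0 hM0
    refine ⟨fun v hv => ?_, w, hw.le, hw'⟩
    have := hP.le v trivial
    rwa [show cl v = 0 by omega] at this

theorem suffixMax_spec (h2n : 2 ≤ n) (hW : 2 * n + 2 ≤ W) {cl : Fin n → ℕ} {M : ℕ} (hMn : M ≤ n)
    (hM0 : 0 < M) (hcl : ∀ v, cl v < M) (h9 : s₀.nreg 9 = M) {f : Fin n → ℝ}
    (hP : Maxima (fun _ => True) cl M f (s₀.rarr 6)) :
    Tri (I.machine W) suffixMax s₀ (4 + (n + 1) * 100) fun s =>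
      Frame [3] [] [] [6] s₀ s ∧ ∀ l < M, (∀ v, l ≤ cl v → f v ≤ s.rarr 6 l) ∧
        ∃ v, l ≤ cl v ∧ s.rarr 6 l = f v := by
  refine Tri.wp_seq (T := (n + 1) * 100) ?_
  simp only [Stmt.wp, NExp.wp, Doap.machine_word, h9]
  refine ⟨by omega, by omega, ?_⟩
  refine Tri.loop_wp n 100 (by decide) (fun i s => Frame [3] [] [] [6] s₀ s ∧
    s.nreg 3 = M - 1 - i ∧ i + 1 ≤ M ∧
    (∀ l, M - 1 - i ≤ l → l < M → (∀ v, l ≤ cl v → f v ≤ s.rarr 6 l) ∧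
      ∃ v, l ≤ cl v ∧ s.rarr 6 l = f v) ∧
    ∀ l, l < M - 1 - i → s.rarr 6 l = s₀.rarr 6 l) ?_ _ ?_
  · rintro i s ⟨hF, hi, hiM, hl, hr⟩
    simp only [lt, BExp.wp, NExp.wp, hi, Doap.machine_word, Nat.zero_le, true_and]
    refine ⟨fun h => ⟨hF, fun l hlM => hl l (by omega) hlM⟩, fun h => ⟨by omega, Tri.of_wp _ ?_⟩⟩
    obtain ⟨j, hj⟩ : ∃ j, M - 1 - i = j + 1 := ⟨M - 1 - i - 1, by omega⟩
    have hj' : M - 1 - (i + 1) = j := by omega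
    rw [hj] at hl hr
    simp only [Stmt.wp, NExp.wp, hi, hj, Doap.machine_word, Nat.add_sub_cancel]
    refine ⟨by omega, by omega, ?_⟩
    refine updMax_wp (c := j) (x := s.rarr 6 (j + 1)) (fun R hR => by simpa [NExp.wp] using hR)
      (fun R hR => ?_) (by simpa using by omega) fun s' hF' hP' => ?_
    · simp only [RExp.wp, NExp.wp, Doap.machine_word, Doap.machine_size, Store.setN_nreg, if_true]
      exact ⟨by omega, by omega, by omega, hR⟩
    · rw [hj']
      refine ⟨(hF.setN (by decide)).trans hF', by rw [hF'.nreg 3 (by decide)]; simp, by omega,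
        fun l hjl hlM => ?_, fun l hlj => ?_⟩
      · rw [hP']
        simp only [Store.setN_rarr]
        rcases Nat.lt_or_ge j l with h1 | h1
        · rw [if_neg (by omega)]; exact hl l h1 hlM
        · obtain rfl : l = j := by omega
          rw [if_pos rfl, hr l (by omega)]
          obtain ⟨w, -, hw, hw'⟩ := hP.eq l hlM
          obtain ⟨hi1, u, hu, hu'⟩ := hl (l + 1) le_rfl (by omega)
          refine ⟨fun v hv => ?_, ?_⟩
          · rcases Nat.eq_or_lt_of_le hv with h1 | h1
            · have := hP.le v trivial
              rw [← h1] at this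
              exact this.trans (le_max_left _ _)
            · exact (hi1 v h1).trans (le_max_right _ _)
          · rcases le_total (s₀.rarr 6 l) (s.rarr 6 (l + 1)) with h1 | h1
            · exact ⟨u, by omega, by rw [max_eq_right h1, hu']⟩
            · exact ⟨w, by omega, by rw [max_eq_left h1, hw']⟩
      · rw [hP', if_neg (by omega)]
        exact hr l (by omega)
  · refine ⟨(Frame.refl _).setN (by decide), by simp, by omega, fun l hl hlM => ?_,
      fun l hl => by simp⟩
    obtain rfl : l = M - 1 := by omega
    obtain ⟨w, -, hw, hw'⟩ := hP.eq (M - 1) hlM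
    refine ⟨fun v hv => ?_, w, hw.ge, by simpa using hw'⟩
    have := hP.le v trivial
    rwa [show cl v = M - 1 by have := hcl v; omega] at this

theorem cluster_spec (h2n : 2 ≤ n) (hW : 2 * n + 2 ≤ W) (hM : I.MetricTree) {a b : Fin n}
    (hab : a ≠ b) (hL : I.Loaded L s₀) {par : Fin n → Fin n} {rank : Fin n → ℕ}
    (hO : Ordered L a par rank s₀) (h2 : s₀.nreg 2 = a) (h12 : s₀.nreg 12 = b)
    (hda : ∀ v : Fin n, s₀.rarr 2 v = I.dist a v) (hdb : ∀ v : Fin n, s₀.rarr 3 v = I.dist b v)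
    {ε η : ℝ} (hε : 0 < ε) (hs : s₀.rreg 0 = ε) (hη : η = ε * I.dist a b / 21) :
    Tri (I.machine W) cluster s₀ (300 * n + 500) fun s => ClusterFrame s₀ s ∧
      s.rreg 1 = I.dist a b ∧ s.rreg 2 = η ∧
      ∃ cl, I.Summary a b η cl (s.nreg 9) (s.narr 6) (s.rarr 4) (s.rarr 5) (s.rarr 6) := by
  refine Tri.mono (T := (100 + (n + 1) * 100) + ((2 + (n + 1) * 100) + (4 + (n + 1) * 100))) ?_
    (by omega) fun _ h => h
  refine (clusterLoop_spec h2n hW hM hab hL hO h2 h12 hda hdb hε hs hη).seq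
    fun s1 ⟨hF1, hD, hC⟩ => ?_
  have hMn := hC.clusters.le_card
  have hM0 := hC.clusters.pos
  have hlt : ∀ v : Fin n, s1.narr 5 v < s1.nreg 9 := fun v => hC.clusters.lt v trivial
  refine (prefixMax_spec h2n hW hMn hM0 rfl hC.left).seq fun s2 ⟨hF2, hP⟩ => ?_
  have hr := hC.right
  rw [← hF2.rarr 6 (by decide)] at hr
  refine (suffixMax_spec h2n hW hMn hM0 hlt (hF2.nreg 9 (by decide)) hr).mono le_rfl
    fun s3 ⟨hF3, hQ⟩ => ?_
  refine ⟨(hF1.trans hF2).trans hF3, ?_, ?_, fun v => s1.narr 5 v, ⟨?_, fun l hl => ?_, fun l hl => ?_,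
    fun l hl => ?_, fun l hl => ?_⟩⟩
  · rw [hF3.rreg 1 (by decide), hF2.rreg 1 (by decide), hD.diam]
  · rw [hF3.rreg 2 (by decide), hF2.rreg 2 (by decide), hD.width]
  · have hC1 := hC.clusters
    rw [← hF2.nreg 9 (by decide), ← hF2.narr 6 (by decide), ← hF2.rarr 4 (by decide),
      ← hF3.nreg 9 (by decide), ← hF3.narr 6 (by decide), ← hF3.rarr 4 (by decide)] at hC1
    exact hC1
  all_goals rw [hF3.nreg 9 (by decide), hF2.nreg 9 (by decide)] at hl
  · rw [hF3.rarr 5 (by decide)]; exact (hP l hl).1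
  · rw [hF3.rarr 5 (by decide)]; exact (hP l hl).2
  · exact (hQ l hl).1
  · exact (hQ l hl).2

end

end Prog

/-! ### The decision problem -/

namespace Doap

variable {n : ℕ} {I : Doap n} {a b : Fin n} {η : ℝ} {cl : Fin n → ℕ} {M : ℕ} {rep : ℕ → ℕ}
  {y P Q : ℕ → ℝ}

/-- The maxima of the contributions of those pairs of vertices whose distance exceeds `Δ`. -/
structure Bounds (D : ℝ) (M : ℕ) (P Q : ℕ → ℝ) (Δ x₁ x₂ x₃ : ℝ) : Prop where
  left_le : ∀ l < M, Δ < P l → Q l ≤ x₁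
  -- The defaults `-D`, `0` and `-D` are the contributions of the pair `a`, `b`, which is itself a
  -- far pair whenever `Δ < D`.
  left_eq : x₁ = -D ∨ ∃ l < M, Δ < P l ∧ x₁ = Q l
  right_le : ∀ l < M, Δ < Q l + D → P l ≤ x₂
  right_eq : x₂ = 0 ∨ ∃ l < M, Δ < Q l + D ∧ x₂ = P l
  cycle_le : ∀ l < M, ∀ k < M, Δ < Q k + P l → P k + Q l ≤ x₃
  cycle_eq : x₃ = -D ∨ ∃ l < M, ∃ k < M, Δ < Q k + P l ∧ x₃ = P k + Q l

/-- The conditions on a shortcut of weight `c` between the positions `x` and `z`, in terms of the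
maxima. -/
structure Fits (D Δ x₁ x₂ x₃ c x z : ℝ) : Prop where
  ends : c + x - z + D ≤ Δ
  left : c + x + z + x₁ ≤ Δ
  right : c + D - x - z + x₂ ≤ Δ
  cycle : c + z - x + x₃ ≤ Δ

namespace Summary

variable (hS : I.Summary a b η cl M rep y P Q) {Δ x₁ x₂ x₃ : ℝ}
  (hB : Bounds (I.dist a b) M P Q Δ x₁ x₂ x₃)
include hS

theorem left_mono {l l' : ℕ} (h : l ≤ l') (hl : l' < M) : P l ≤ P l' := by
  obtain ⟨v, h1, h2⟩ := hS.left_eq l (by omega)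
  rw [h2]
  exact hS.left_le l' hl v (by omega)

theorem right_anti {l l' : ℕ} (h : l ≤ l') (hl : l' < M) : Q l' ≤ Q l := by
  obtain ⟨v, h1, h2⟩ := hS.right_eq l' hl
  rw [h2]
  exact hS.right_le l (by omega) v (by omega)

/-- Both maxima of a cluster are attained, up to the width of a cluster, by a single vertex. -/
theorem exists_vertex (hη : 0 < η) {l : ℕ} (hl : l < M) :
    ∃ v, P l - η ≤ I.dist a v ∧ Q l - η ≤ I.dist b v - I.dist a b := by
  obtain ⟨v, hv, h1⟩ := hS.left_eq l hl
  obtain ⟨w, hw, h2⟩ := hS.right_eq l hl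
  -- The maximizer `v` comes from an initial segment of the clusters and `w` from a final one, so
  -- `v` lies at most one cluster width beyond `w`. Whichever of the two is higher serves both
  -- maxima up to `η`.
  have hvw : I.pos a b v ≤ I.pos a b w + η := by
    have h3 := hS.clusters.pos_le v trivial
    have h4 := hS.clusters.le_pos w trivial
    rcases (hv.trans hw).lt_or_eq with h5 | h5
    · linarith [hS.clusters.strictMono hη h5 (hS.clusters.lt w trivial)]
    · rw [h5] at h3; linarith
  have hpv := MetricTree.pos_add_height (I := I) a b v
  have hpw := MetricTree.pos_add_height (I := I) a b w
  have hqv := MetricTree.height_sub_pos (I := I) a b v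
  have hqw := MetricTree.height_sub_pos (I := I) a b w
  rcases le_total (I.height a b v) (I.height a b w) with h3 | h3
  · exact ⟨w, by linarith, by linarith⟩
  · exact ⟨v, by linarith, by linarith⟩

include hB

/-- Nothing is lost in this direction: the maxima dominate the contribution of every far pair, and
centres lie on the path. -/
theorem good_of_fits {i j : Fin n} {l l' : ℕ} (hi : I.pos a b i = y l) (hj : I.pos a b j = y l')
    (hf : Fits (I.dist a b) Δ x₁ x₂ x₃ (I.c i j) (y l) (y l')) :
    I.Good a b Δ (I.pos a b i) (I.pos a b j) (I.c i j) := by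
  rw [hi, hj]
  have hlt := fun z => hS.clusters.lt z trivial
  have hp := fun z => hS.left_le (cl z) (hlt z) z le_rfl
  have hq := fun z => hS.right_le (cl z) (hlt z) z le_rfl
  refine ⟨hf.ends, fun z hz => ?_, fun z hz => ?_, fun z w hzw => ?_⟩
  · linarith [hB.left_le (cl z) (hlt z) (hz.trans_le (hp z)), hq z, hf.left]
  · linarith [hB.right_le (cl z) (hlt z) (by linarith [hq z]), hp z, hf.right]
  · linarith [hB.cycle_le (cl w) (hlt w) (cl z) (hlt z) (by linarith [hp w, hq z]), hp z, hq w,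
      hf.cycle]

/-- Moving `u` and `v` to their centres costs at most `2 * η` in the weight and `2 * η` in the
positions. Replacing the maxima by single vertices costs at most another `2 * η`. -/
theorem fits_of_good (hM : I.MetricTree) (hη : 0 < η) {Δ' : ℝ} {u v : Fin n}
    (hg : I.Good a b Δ' (I.pos a b u) (I.pos a b v)
      (I.c u v + I.height a b u + I.height a b v)) (hΔ : Δ' + 6 * η ≤ Δ) (hlt : Δ < I.dist a b)
    {i j : Fin n} (hi : I.pos a b i = y (cl u)) (hi0 : I.height a b i = 0)
    (hj : I.pos a b j = y (cl v)) (hj0 : I.height a b j = 0) :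
    Fits (I.dist a b) Δ x₁ x₂ x₃ (I.c i j) (y (cl u)) (y (cl v)) := by
  have hu1 := hS.clusters.le_pos u trivial
  have hu2 := hS.clusters.pos_le u trivial
  have hv1 := hS.clusters.le_pos v trivial
  have hv2 := hS.clusters.pos_le v trivial
  have hc : I.c i j ≤ I.c u v + I.height a b u + I.height a b v + 2 * η := by
    have h1 := hM.c_triangle i u j
    have h2 := hM.c_triangle u v j
    have h3 := (hM.c_le i u).trans (hM.dist_le_height a b i u)
    have h4 := (hM.c_le v j).trans (hM.dist_le_height a b v j)
    rw [hi, hi0, abs_of_nonpos (by linarith)] at h3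
    rw [hj, hj0, abs_of_nonneg (by linarith)] at h4
    linarith
  have h1 : -Δ' + (I.c u v + I.height a b u + I.height a b v) + I.pos a b u + I.pos a b v + x₁ ≤
      η := by
    -- A default value is covered by the condition for the pair `a`, `b`, which is far because of
    -- `hlt`.
    rcases hB.left_eq with h1 | ⟨l, hl, h2, h3⟩
    · have := hg.left b (by linarith)
      rw [hM.dist_self] at this
      linarith
    · obtain ⟨z, hz1, hz2⟩ := hS.exists_vertex hη hl
      have := hg.left z (by linarith)
      linarith
  have h2 : -Δ' + (I.c u v + I.height a b u + I.height a b v) + I.dist a b - I.pos a b u -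
      I.pos a b v + x₂ ≤ η := by
    rcases hB.right_eq with h1 | ⟨l, hl, h2, h3⟩
    · have := hg.right a (by linarith [hM.dist_comm a b])
      rw [hM.dist_self] at this
      linarith
    · obtain ⟨z, hz1, hz2⟩ := hS.exists_vertex hη hl
      have := hg.right z (by linarith)
      linarith
  have h3 : -Δ' + (I.c u v + I.height a b u + I.height a b v) + I.pos a b v - I.pos a b u + x₃ ≤
      2 * η := by
    rcases hB.cycle_eq with h1 | ⟨l, hl, k, hk, h2, h3⟩
    · have := hg.cycle a b (by linarith [hM.dist_comm a b])
      rw [hM.dist_self, hM.dist_self] at this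
      linarith
    · obtain ⟨z, hz1, hz2⟩ := hS.exists_vertex hη hk
      obtain ⟨w, hw1, hw2⟩ := hS.exists_vertex hη hl
      have := hg.cycle z w (by linarith)
      linarith
  have h4 := hg.ends
  exact ⟨by linarith, by linarith, by linarith, by linarith⟩

end Summary

end Doap

/-! ### The program: the three maxima for a given diameter -/

namespace Prog

/-- If the test holds, replace a real register by its maximum with `e`. -/
def maxIf (t : BExp 24) (x : Fin 24) (e : RExp 24) : Stmt 24 :=
  .ite (.and t (rlt (.reg x) e)) (.rset x e) .skip

theorem maxIf_wp {m : Machine} {s : Store 24} {t : BExp 24} {x : Fin 24} {e : RExp 24} {v : ℝ}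
    {p : Prop} [Decidable p] {Q : Store 24 → Prop}
    (ht : ∀ Qt Qf : Prop, (p → Qt) → (¬ p → Qf) → t.wp m s Qt Qf)
    (he : p → ∀ R : ℝ → Prop, R v → e.wp m s R)
    (hQ : Q (s.setR x (if p then max (s.rreg x) v else s.rreg x))) :
    (maxIf t x e).wp m Q s := by
  have hskip : s.setR x (s.rreg x) = s := by simp [Store.setR]
  refine ht _ _ (fun hp => he hp _ ⟨fun h => ?_, fun h => he hp _ ?_⟩) fun hp => ?_
  · rw [if_pos hp, max_eq_left h, hskip] at hQ
    exact hQ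
  · rwa [if_pos hp, max_eq_right (le_of_lt h)] at hQ
  · rw [if_neg hp, hskip] at hQ
    exact hQ

/-- Increase a register as long as it is less than register `9` and the test holds. -/
def advance (x : Fin 24) (t : BExp 24) : Stmt 24 := .loop (.and (lt (.reg x) (.reg 9)) t) (incr x)

/-- The pointer stops at the first number at which the test fails, or at `M`. The cost is charged to
the advance `q - p`, ready for `Tri.loop_amortized`. -/
theorem advance_spec {m : Machine} {s : Store 24} {x : Fin 24} {t : BExp 24} {M p c : ℕ}
    {T : ℕ → Prop} (hx : x ≠ 9) (hM : s.nreg 9 = M) (hp : s.nreg x = p) (hpM : p ≤ M)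
    (hW : M + 1 ≤ m.word) (hc : 12 + t.cost ≤ c)
    (ht : ∀ q < M, ∀ Qt Qf : Prop, (T q → Qt) → (¬ T q → Qf) → t.wp m (s.setN x q) Qt Qf) :
    ∃ q, p ≤ q ∧ q ≤ M ∧ (∀ r, p ≤ r → r < q → T r) ∧ (q < M → ¬ T q) ∧
      Tri m (advance x t) s (c + (q - p) * c) fun s' => s' = s.setN x q := by
  classical
  have hex : ∃ d, p + d = M ∨ ¬ T (p + d) := ⟨M - p, .inl (by omega)⟩
  have hfind := Nat.find_spec hex
  have hmin : ∀ d < Nat.find hex, p + d ≠ M ∧ T (p + d) := fun d hd => by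
    have := Nat.find_min hex hd
    push Not at this
    exact this
  set d := Nat.find hex with hd
  have hdM : p + d ≤ M := by
    by_contra! h
    exact (hmin (M - p) (by omega)).1 (by omega)
  refine ⟨p + d, by omega, hdM, fun r h1 h2 => ?_, fun h => ?_, ?_⟩
  · have := (hmin (r - p) (by omega)).2
    rwa [show p + (r - p) = r by omega] at this
  · rcases hfind with h1 | h1
    · omega
    · exact h1
  · refine (Tri.loop_wp d c (by simp [incr, lt, Stmt.flatCost, NExp.cost, BExp.cost]; omega)
      (fun i s' => s' = s.setN x (p + i) ∧ i ≤ d) ?_ s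
      ⟨by rw [add_zero, ← hp, Store.setN_self], by omega⟩).mono
      (by rw [show p + d - p = d by omega, add_mul, one_mul, add_comm]) fun _ h => h
    rintro i s' ⟨rfl, hi⟩
    simp only [lt, BExp.wp, NExp.wp, Store.setN_nreg, if_true, if_neg hx.symm, hM]
    refine ⟨fun h => ?_, fun h => ht _ h _ _ (fun h1 => ?_) fun h1 => ?_⟩
    · rw [show p + d = p + i by omega]
    · have hid : i < d := by
        by_contra! h2
        obtain rfl : i = d := by omega
        rcases hfind with h3 | h3
        · omega
        · exact h3 h1
      refine ⟨hid, Tri.of_wp _ ?_⟩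
      simp only [incr, Stmt.wp, NExp.wp, Store.setN_nreg, if_true]
      exact ⟨by omega, by omega, by rw [Store.setN_setN, add_assoc], hid⟩
    · have hid : i = d := by
        by_contra h2
        exact h1 (hmin i (by omega)).2
      rw [hid]

/-- The contributions of the pairs with cluster `l` in register `3`. -/
def boundsBody : Stmt 24 :=
  advance 14 (rlt (.reg 5) (.add (.get 6 (.reg 14)) (.get 5 (.reg 3)))) ;;
    maxIf (rlt (.reg 5) (.get 5 (.reg 3))) 6 (.get 6 (.reg 3)) ;;
    maxIf (rlt (.reg 5) (.add (.get 6 (.reg 3)) (.reg 1))) 7 (.get 5 (.reg 3)) ;;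
    maxIf (lt (.const 0) (.reg 14)) 8 (.add (.get 5 (.sub (.reg 14) (.const 1))) (.get 6 (.reg 3))) ;;
    incr 3

/-- Compute the maxima of the contributions of the pairs whose distance exceeds register `5`. -/
def bounds : Stmt 24 :=
  (.rset 6 (.sub (.const 0) (.reg 1)) ;; .rset 7 (.const 0) ;; .rset 8 (.sub (.const 0) (.reg 1)) ;;
    .nset 14 (.const 0) ;; .nset 3 (.const 0)) ;; .loop (lt (.reg 3) (.reg 9)) boundsBody

section

open Doap

variable {n : ℕ} {I : Doap n} {W : ℕ} {s₀ : Store 24}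

/-- The maxima for the clusters below `i`. -/
structure BoundsBelow (D : ℝ) (M : ℕ) (P Q : ℕ → ℝ) (Δ : ℝ) (i : ℕ) (x₁ x₂ x₃ : ℝ) : Prop where
  left_le : ∀ l < i, Δ < P l → Q l ≤ x₁
  left_eq : x₁ = -D ∨ ∃ l < M, Δ < P l ∧ x₁ = Q l
  right_le : ∀ l < i, Δ < Q l + D → P l ≤ x₂
  right_eq : x₂ = 0 ∨ ∃ l < M, Δ < Q l + D ∧ x₂ = P l
  cycle_le : ∀ l < i, ∀ k < M, Δ < Q k + P l → P k + Q l ≤ x₃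
  cycle_eq : x₃ = -D ∨ ∃ l < M, ∃ k < M, Δ < Q k + P l ∧ x₃ = P k + Q l

theorem BoundsBelow.succ {D : ℝ} {M : ℕ} {P Q : ℕ → ℝ} {Δ x₁ x₂ x₃ x₁' x₂' x₃' : ℝ} {i q : ℕ}
    (h : BoundsBelow D M P Q Δ i x₁ x₂ x₃) (hi : i < M)
    (hP : ∀ l l', l ≤ l' → l' < M → P l ≤ P l') (hqM : q ≤ M)
    (hq : ∀ k < M, Δ < Q k + P i ↔ k < q)
    (h₁ : x₁' = if Δ < P i then max x₁ (Q i) else x₁)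
    (h₂ : x₂' = if Δ < Q i + D then max x₂ (P i) else x₂)
    (h₃ : x₃' = if 0 < q then max x₃ (P (q - 1) + Q i) else x₃) :
    BoundsBelow D M P Q Δ (i + 1) x₁' x₂' x₃' := by
  have hlt : ∀ l, l < i + 1 → l < i ∨ l = i := fun l hl => Nat.lt_succ_iff_lt_or_eq.1 hl
  have hle₁ : x₁ ≤ x₁' := by rw [h₁]; split_ifs <;> simp
  have hle₂ : x₂ ≤ x₂' := by rw [h₂]; split_ifs <;> simp
  have hle₃ : x₃ ≤ x₃' := by rw [h₃]; split_ifs <;> simp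
  refine ⟨fun l hl hΔ => ?_, ?_, fun l hl hΔ => ?_, ?_, fun l hl k hk hΔ => ?_, ?_⟩
  · rcases hlt l hl with h4 | rfl
    · exact (h.left_le l h4 hΔ).trans hle₁
    · rw [h₁, if_pos hΔ]; exact le_max_right _ _
  · rw [h₁]
    split_ifs with h4
    · rcases le_total x₁ (Q i) with h5 | h5
      · rw [max_eq_right h5]; exact .inr ⟨i, hi, h4, rfl⟩
      · rw [max_eq_left h5]; exact h.left_eq
    · exact h.left_eq
  · rcases hlt l hl with h4 | rfl
    · exact (h.right_le l h4 hΔ).trans hle₂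
    · rw [h₂, if_pos hΔ]; exact le_max_right _ _
  · rw [h₂]
    split_ifs with h4
    · rcases le_total x₂ (P i) with h5 | h5
      · rw [max_eq_right h5]; exact .inr ⟨i, hi, h4, rfl⟩
      · rw [max_eq_left h5]; exact h.right_eq
    · exact h.right_eq
  · rcases hlt l hl with h4 | rfl
    · exact (h.cycle_le l h4 k hk hΔ).trans hle₃
    -- The partners of cluster `l` are the numbers below `q`. As `P` is monotone, `q - 1` is the
    -- best of them.
    · have hkq := (hq k hk).1 hΔ
      rw [h₃, if_pos (by omega)]
      refine le_max_of_le_right ?_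
      linarith [hP k (q - 1) (by omega) (by omega)]
  · rw [h₃]
    split_ifs with h4
    · rcases le_total x₃ (P (q - 1) + Q i) with h5 | h5
      · rw [max_eq_right h5]
        exact .inr ⟨i, hi, q - 1, by omega, (hq _ (by omega)).2 (by omega), rfl⟩
      · rw [max_eq_left h5]; exact h.cycle_eq
    · exact h.cycle_eq

/-- Since `Q` decreases, the `k` with `Δ < Q k + P i` form an initial segment; since `P` increases,
this segment grows with `i`. One pointer that never moves back delimits it for all `i`. -/
theorem bounds_spec (hW : n + 2 ≤ W) {D Δ : ℝ} {M : ℕ} {P Q : ℕ → ℝ} (hMn : M ≤ n)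
    (h9 : s₀.nreg 9 = M) (h1 : s₀.rreg 1 = D) (h5 : s₀.rreg 5 = Δ) (hP : s₀.rarr 5 = P)
    (hQ : s₀.rarr 6 = Q) (hPm : ∀ l l', l ≤ l' → l' < M → P l ≤ P l')
    (hQm : ∀ l l', l ≤ l' → l' < M → Q l' ≤ Q l) :
    Tri (I.machine W) bounds s₀ (500 * M + 500) fun s =>
      Frame [3, 14] [6, 7, 8] [] [] s₀ s ∧
        Bounds D M P Q Δ (s.rreg 6) (s.rreg 7) (s.rreg 8) := by
  refine Tri.mono (T := 50 + ((M + 1) * (200 + 1 + 4) + M * 50)) ?_ (by omega) fun _ h => h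
  refine (Tri.wp_seq (T := (M + 1) * (200 + 1 + 4) + M * 50) ?_).mono ?_ fun _ h => h
  · simp only [Stmt.wp, NExp.wp, RExp.wp, Doap.machine_word, Nat.zero_le, true_and, h1,
      Store.setR_rreg, Fin.reduceEq, if_false]
    refine Tri.loop_amortized M 200 50 M (fun i φ s => Frame [3, 14] [6, 7, 8] [] [] s₀ s ∧
      s.nreg 3 = i ∧ i ≤ M ∧ s.nreg 14 = φ ∧ φ ≤ M ∧
      (∀ k < φ, ∀ l, i ≤ l → l < M → Δ < Q k + P l) ∧
      BoundsBelow D M P Q Δ i (s.rreg 6) (s.rreg 7) (s.rreg 8)) ?_ _ ?_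
    · rintro i φ s ⟨hF, h3, hiM, h14, hφ, hk, hB⟩
      have h9' : s.nreg 9 = M := (hF.nreg 9 (by decide)).trans h9
      have hP' : s.rarr 5 = P := (hF.rarr 5 (by decide)).trans hP
      have hQ' : s.rarr 6 = Q := (hF.rarr 6 (by decide)).trans hQ
      have h5' : s.rreg 5 = Δ := (hF.rreg 5 (by decide)).trans h5
      have h1' : s.rreg 1 = D := (hF.rreg 1 (by decide)).trans h1
      simp only [lt, BExp.wp, NExp.wp, h3, h9']
      refine ⟨fun h => ⟨hF, ?_⟩, fun h => ⟨h, ?_⟩⟩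
      · obtain rfl : i = M := by omega
        exact ⟨hB.left_le, hB.left_eq, hB.right_le, hB.right_eq, hB.cycle_le, hB.cycle_eq⟩
      · obtain ⟨q, hq1, hq2, hq3, hq4, hq5⟩ := advance_spec (m := I.machine W) (s := s) (x := 14)
          (t := rlt (.reg 5) (.add (.get 6 (.reg 14)) (.get 5 (.reg 3)))) (c := 50)
          (T := fun k => Δ < Q k + P i) (by decide) h9' h14 hφ
          (by simp only [Doap.machine_word]; omega) (by decide) fun q hqM Qt Qf ht hf => by
            simp only [rlt, BExp.wp, RExp.wp, NExp.wp, Store.setN_nreg, Fin.reduceEq, if_true,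
              if_false, h3, Store.setN_rarr, Store.setN_rreg, hP', hQ', h5', Doap.machine_size]
            exact ⟨by omega, by omega, fun h => hf (not_lt.2 h), ht⟩
        refine ⟨q, hq1, hq2, ?_⟩
        refine (hq5.seq (T' := 150) fun s' hs' => ?_).mono (by omega) fun _ h => h
        subst hs'
        refine Tri.mono (Tri.of_wp _ (Q := fun s' =>
          Frame [3, 14] [6, 7, 8] [] [] s₀ s' ∧ s'.nreg 3 = i + 1 ∧ s'.nreg 14 = q ∧
          s'.rreg 6 = (if Δ < P i then max (s.rreg 6) (Q i) else s.rreg 6) ∧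
          s'.rreg 7 = (if Δ < Q i + D then max (s.rreg 7) (P i) else s.rreg 7) ∧
          s'.rreg 8 = (if 0 < q then max (s.rreg 8) (P (q - 1) + Q i) else s.rreg 8)) ?_)
          (by decide) fun s' hs' => ?_
        · have hin : i < n := by omega
          refine maxIf_wp (p := Δ < P i) (v := Q i) (fun Qt Qf h1 h2 => ?_) (fun _ R hR => ?_) ?_
          · simp only [rlt, BExp.wp, RExp.wp, NExp.wp, Store.setN_nreg, Fin.reduceEq, if_false, h3,
              Store.setN_rarr, Store.setN_rreg, hP', h5', Doap.machine_size]
            exact ⟨hin, fun h => h2 (not_lt.2 h), h1⟩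
          · simp only [RExp.wp, NExp.wp, Store.setN_nreg, Fin.reduceEq, if_false, h3,
              Store.setN_rarr, hQ', Doap.machine_size]
            exact ⟨hin, hR⟩
          refine maxIf_wp (p := Δ < Q i + D) (v := P i) (fun Qt Qf h1 h2 => ?_) (fun _ R hR => ?_) ?_
          · simp only [rlt, BExp.wp, RExp.wp, NExp.wp, Store.setN_nreg, Fin.reduceEq, if_false, h3,
              Store.setN_rarr, Store.setN_rreg, Store.setR_nreg, Store.setR_rreg, Store.setR_rarr,
              hQ', h5', h1', Doap.machine_size]
            exact ⟨hin, fun h => h2 (not_lt.2 h), h1⟩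
          · simp only [RExp.wp, NExp.wp, Store.setN_nreg, Fin.reduceEq, if_false, h3,
              Store.setN_rarr, Store.setR_nreg, Store.setR_rarr, hP', Doap.machine_size]
            exact ⟨hin, hR⟩
          refine maxIf_wp (p := 0 < q) (v := P (q - 1) + Q i) (fun Qt Qf h1 h2 => ?_)
            (fun _ R hR => ?_) ?_
          · simp only [lt, BExp.wp, NExp.wp, Store.setN_nreg, Store.setR_nreg, if_true,
              Doap.machine_word]
            exact ⟨by omega, fun h => h2 (not_lt.2 h), h1⟩
          · simp only [RExp.wp, NExp.wp, Store.setN_nreg, Fin.reduceEq, if_true, if_false, h3,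
              Store.setN_rarr, Store.setR_nreg, Store.setR_rarr, hP', hQ', Doap.machine_size,
              Doap.machine_word]
            exact ⟨by omega, by omega, by omega, hin, hR⟩
          simp only [incr, Stmt.wp, NExp.wp, Store.setN_nreg, Store.setR_nreg, Fin.reduceEq,
            if_false, h3, Doap.machine_word]
          refine ⟨by omega, by omega, ((((hF.setN (by decide)).setR (by decide)).setR
            (by decide)).setR (by decide)).setN (by decide), by simp, by simp, by simp, by simp,
            by simp⟩
        · obtain ⟨hF', h3', h14', h6, h7, h8⟩ := hs'
          have hqall : ∀ k < M, Δ < Q k + P i ↔ k < q := fun k hkM => by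
            constructor
            · intro h2
              by_contra! h4
              exact hq4 (by omega) (by linarith [hQm q k h4 hkM])
            · intro h2
              rcases Nat.lt_or_ge k φ with h4 | h4
              · exact hk k h4 i le_rfl h
              · exact hq3 k h4 h2
          refine ⟨hF', h3', h, h14', hq2, fun k hkq l hil hlM => ?_,
            hB.succ h hPm hq2 hqall h6 h7 h8⟩
          linarith [(hqall k (by omega)).2 hkq, hPm i l (by omega) hlM]
    · refine ⟨(((((Frame.refl _).setR (by decide)).setR (by decide)).setR (by decide)).setN
        (by decide)).setN (by decide), by simp, by omega, by simp, by omega, by simp, ?_⟩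
      exact ⟨by simp, by simp, by simp, by simp, by simp, by simp⟩
  · have : Stmt.flatCost (k := 24) (.rset 6 (.sub (.const 0) (.reg 1)) ;; .rset 7 (.const 0) ;;
      .rset 8 (.sub (.const 0) (.reg 1)) ;; .nset 14 (.const 0) ;; .nset 3 (.const 0)) ≤ 50 := by
      decide
    omega

end

end Prog

/-! ### The search for a shortcut between two centres -/

/-- A family of predicates on the numbers below `M` that hold on initial segments of growing
length. -/
def Staircase (M : ℕ) (F : ℕ → ℕ → Prop) : Prop :=
  ∀ i i' k k', i ≤ i' → i' < M → k' ≤ k → k < M → F i k → F i' k'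

namespace Prog

/-- The predicates `F i`, `F (i + 1)`, … hold below `p`. -/
def HoldsBelow (M : ℕ) (F : ℕ → ℕ → Prop) (i p : ℕ) : Prop :=
  p ≤ M ∧ ∀ k < p, ∀ i', i ≤ i' → i' < M → F i' k

/-- The pointer may resume where it stopped for the previous `i`: what lies below it still satisfies
the test. Where it stops next is the exact border for the present `i`. -/
theorem advance_staircase {m : Machine} {s : Store 24} {x : Fin 24} {t : BExp 24} {M i p c : ℕ}
    {F : ℕ → ℕ → Prop} (hF : Staircase M F) (hi : i < M) (hx : x ≠ 9) (hM : s.nreg 9 = M)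
    (hp : s.nreg x = p) (hW : M + 1 ≤ m.word) (hc : 12 + t.cost ≤ c) (hB : HoldsBelow M F i p)
    (ht : ∀ q < M, ∀ Qt Qf : Prop, (F i q → Qt) → (¬ F i q → Qf) → t.wp m (s.setN x q) Qt Qf) :
    ∃ q, p ≤ q ∧ (∀ k < M, F i k ↔ k < q) ∧ HoldsBelow M F (i + 1) q ∧
      Tri m (advance x t) s (c + (q - p) * c) fun s' => s' = s.setN x q := by
  obtain ⟨q, h1, h2, h3, h4, h5⟩ := advance_spec hx hM hp hB.1 hW hc ht
  have hq : ∀ k < M, F i k ↔ k < q := fun k hk => by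
    refine ⟨fun h => ?_, fun h => ?_⟩
    · by_contra! h6
      exact h4 (by omega) (hF i i k q le_rfl hi h6 hk h)
    · rcases Nat.lt_or_ge k p with h6 | h6
      · exact hB.2 k h6 i le_rfl hi
      · exact h3 k h6 h
  exact ⟨q, h1, hq, ⟨h2, fun k hk i' hi' hi'M =>
    hF i i' k k (by omega) hi'M le_rfl (by omega) ((hq k (by omega)).2 hk)⟩, h5⟩

/-- The test `c + σ x + τ z + e ≤ Δ`, where `c` is the weight of the shortcut between the centres
of the clusters with the numbers in register `3` and `j`, and `x` and `z` are their positions. -/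
def side (σ τ : ℚ) (e : RExp 24) (j : NExp 24) : BExp 24 :=
  .rle (.add (.add (.add (.query (.get 6 (.reg 3)) (.get 6 j)) (.mul (.const σ) (.get 4 (.reg 3))))
    (.mul (.const τ) (.get 4 j))) e) (.reg 5)

/-- The last number below register `9`, minus the register `x`. -/
def mirror (x : Fin 24) : NExp 24 := .sub (.sub (.reg 9) (.const 1)) (.reg x)

/-- The search for the partners of the cluster with the number in register `3`. -/
def searchBody : Stmt 24 :=
  advance 15 (.not (side 1 (-1) (.reg 1) (.reg 15))) ;;
    advance 16 (.not (side 1 1 (.reg 6) (mirror 16))) ;;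
    advance 17 (side (-1) (-1) (.add (.reg 1) (.reg 7)) (mirror 17)) ;;
    advance 18 (side (-1) 1 (.reg 8) (.reg 18)) ;;
    .nset 10 (.sub (.reg 9) (.reg 17)) ;;
    .ite (lt (.reg 10) (.reg 15)) (.nset 10 (.reg 15)) .skip ;;
    .ite (.and (lt (.reg 10) (.reg 18)) (lt (.add (.reg 10) (.reg 16)) (.reg 9)))
      (.nset 19 (.const 1) ;; .nset 20 (.get 6 (.reg 3)) ;; .nset 21 (.get 6 (.reg 10))) .skip ;;
    incr 3

/-- Search for two centres that satisfy the conditions. -/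
def search : Stmt 24 :=
  (.nset 15 (.const 0) ;; .nset 16 (.const 0) ;; .nset 17 (.const 0) ;; .nset 18 (.const 0) ;;
    .nset 19 (.const 0) ;; .nset 3 (.const 0)) ;; .loop (lt (.reg 3) (.reg 9)) searchBody

section

open Doap

variable {n : ℕ} {I : Doap n} {W : ℕ} {s₀ : Store 24}

/-- The store contains the data for the search. -/
structure Searchable (I : Doap n) (M : ℕ) (r : ℕ → Fin n) (y : ℕ → ℝ) (D Δ x₁ x₂ x₃ : ℝ)
    (s : Store 24) : Prop where
  le : M ≤ n
  count : s.nreg 9 = M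
  center : ∀ l < M, s.narr 6 l = r l
  position : s.rarr 4 = y
  diam : s.rreg 1 = D
  goal : s.rreg 5 = Δ
  left : s.rreg 6 = x₁
  right : s.rreg 7 = x₂
  cycle : s.rreg 8 = x₃

variable {M : ℕ} {r : ℕ → Fin n} {y : ℕ → ℝ} {D Δ x₁ x₂ x₃ : ℝ}

theorem Searchable.frame {s s' : Store 24} (h : Searchable I M r y D Δ x₁ x₂ x₃ s)
    {N R A B : List (Fin 24)} (hF : Frame N R A B s s') (hN : 9 ∉ N := by decide)
    (hR : ∀ x ∈ [1, 5, 6, 7, 8], x ∉ R := by decide) (hA : 6 ∉ A := by decide)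
    (hB : 4 ∉ B := by decide) : Searchable I M r y D Δ x₁ x₂ x₃ s' :=
  ⟨h.le, (hF.nreg 9 hN).trans h.count, fun l hl => by rw [hF.narr 6 hA, h.center l hl],
    (hF.rarr 4 hB).trans h.position, (hF.rreg 1 (hR 1 (by simp))).trans h.diam,
    (hF.rreg 5 (hR 5 (by simp))).trans h.goal, (hF.rreg 6 (hR 6 (by simp))).trans h.left,
    (hF.rreg 7 (hR 7 (by simp))).trans h.right, (hF.rreg 8 (hR 8 (by simp))).trans h.cycle⟩

/-- The condition that is tested by `side`. -/
def Side (I : Doap n) (r : ℕ → Fin n) (y : ℕ → ℝ) (Δ : ℝ) (σ τ : ℚ) (k : ℝ) (i j : ℕ) : Prop :=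
  I.c (r i) (r j) + σ * y i + τ * y j + k ≤ Δ

theorem side_wp {s : Store 24} (h : Searchable I M r y D Δ x₁ x₂ x₃ s) {i j : ℕ} (hi : i < M)
    (hj : j < M) (h3 : s.nreg 3 = i) {e : RExp 24} {k : ℝ} {jx : NExp 24} {σ τ : ℚ}
    (hjx : ∀ R : ℕ → Prop, R j → jx.wp (I.machine W) s R)
    (he : ∀ R : ℝ → Prop, R k → e.wp (I.machine W) s R) {Qt Qf : Prop}
    (ht : Side I r y Δ σ τ k i j → Qt) (hf : ¬ Side I r y Δ σ τ k i j → Qf) :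
    (side σ τ e jx).wp (I.machine W) s Qt Qf := by
  have hMn := h.le
  simp only [side, BExp.wp, RExp.wp, NExp.wp, h3, Doap.machine_size, Doap.machine_n,
    Doap.machine_oracle, h.position, h.goal]
  have hi' : s.narr 6 i < n := (h.center i hi).trans_lt (r i).2
  have hj' : s.narr 6 j < n := (h.center j hj).trans_lt (r j).2
  have hc : I.c ⟨s.narr 6 i, hi'⟩ ⟨s.narr 6 j, hj'⟩ = I.c (r i) (r j) :=
    congrArg₂ I.c (Fin.ext (h.center i hi)) (Fin.ext (h.center j hj))
  refine ⟨by omega, hjx _ ⟨by omega, ⟨hi', hj'⟩, by omega, hjx _ ⟨by omega, he _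
    ⟨fun h' => ht ?_, fun h' => hf ?_⟩⟩⟩⟩
  · rw [Side, ← hc]; exact h'
  · rw [Side, ← hc]; exact not_le.2 h'

/-- By `hc` the weight changes no faster than the positions, so each of the four conditions has the
direction of monotonicity of its position terms. For each `i` the admissible partners form an
interval, delimited by four pointers with at most `4 * M` advances altogether. -/
theorem search_spec (hW : 2 * n + 2 ≤ W) (h : Searchable I M r y D Δ x₁ x₂ x₃ s₀)
    (hc : ∀ i j k, i ≤ j → j < M → k < M →
      |I.c (r i) (r k) - I.c (r j) (r k)| ≤ y j - y i ∧
      |I.c (r k) (r i) - I.c (r k) (r j)| ≤ y j - y i) :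
    Tri (I.machine W) search s₀ (1000 * M + 1000) fun s =>
      Frame [3, 10, 15, 16, 17, 18, 19, 20, 21] [] [] [] s₀ s ∧
      ((s.nreg 19 = 1 ∧ ∃ i < M, ∃ j < M, Fits D Δ x₁ x₂ x₃ (I.c (r i) (r j)) (y i) (y j) ∧
        s.nreg 20 = r i ∧ s.nreg 21 = r j) ∨
      (s.nreg 19 = 0 ∧ ∀ i < M, ∀ j < M,
        ¬ Fits D Δ x₁ x₂ x₃ (I.c (r i) (r j)) (y i) (y j))) := by
  have hlip : ∀ i i' j j', i ≤ i' → i' < M → j ≤ j' → j' < M →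
      |I.c (r i) (r j) - I.c (r i') (r j')| ≤ (y i' - y i) + (y j' - y j) ∧
      |I.c (r i) (r j') - I.c (r i') (r j)| ≤ (y i' - y i) + (y j' - y j) := by
    intro i i' j j' h1 h2 h3 h4
    have a1 := (hc i i' j h1 h2 (by omega)).1
    have a2 := (hc j j' i' h3 h4 h2).2
    have a3 := (hc i i' j' h1 h2 h4).1
    simp only [abs_le] at *
    exact ⟨⟨by linarith, by linarith⟩, by linarith, by linarith⟩
  have hA : Staircase M fun i k => ¬ Side I r y Δ 1 (-1) D i k := by
    intro i i' k k' h1 h2 h3 h4 h5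
    have := abs_le.1 (hlip i i' k' k h1 h2 h3 h4).2
    simp only [Side, Rat.cast_one, Rat.cast_neg] at *
    linarith
  have hD : Staircase M fun i k => Side I r y Δ (-1) 1 x₃ i k := by
    intro i i' k k' h1 h2 h3 h4 h5
    have := abs_le.1 (hlip i i' k' k h1 h2 h3 h4).2
    simp only [Side, Rat.cast_one, Rat.cast_neg] at *
    linarith
  -- Here the border moves down as `i` grows; counting `j` from the top as `M - 1 - k` turns it into
  -- an advancing pointer.
  have hB : Staircase M fun i k => ¬ Side I r y Δ 1 1 x₁ i (M - 1 - k) := by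
    intro i i' k k' h1 h2 h3 h4 h5
    have := abs_le.1 (hlip i i' (M - 1 - k) (M - 1 - k') h1 h2 (by omega) (by omega)).1
    simp only [Side, Rat.cast_one] at *
    linarith
  have hC : Staircase M fun i k => Side I r y Δ (-1) (-1) (D + x₂) i (M - 1 - k) := by
    intro i i' k k' h1 h2 h3 h4 h5
    have := abs_le.1 (hlip i i' (M - 1 - k) (M - 1 - k') h1 h2 (by omega) (by omega)).1
    simp only [Side, Rat.cast_one, Rat.cast_neg] at *
    linarith
  have hMn := h.le
  refine Tri.mono (T := 12 + ((M + 1) * (480 + 1 + 4) + 4 * M * 100)) ?_ (by omega) fun _ h => h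
  refine Tri.wp_seq (T := (M + 1) * (480 + 1 + 4) + 4 * M * 100) ?_
  simp only [Stmt.wp, NExp.wp, Doap.machine_word, Nat.zero_le, true_and]
  refine Tri.loop_amortized M 480 100 (4 * M) (fun i φ s =>
    Frame [3, 10, 15, 16, 17, 18, 19, 20, 21] [] [] [] s₀ s ∧ s.nreg 3 = i ∧ i ≤ M ∧
    s.nreg 15 + s.nreg 16 + s.nreg 17 + s.nreg 18 = φ ∧
    HoldsBelow M (fun i k => ¬ Side I r y Δ 1 (-1) D i k) i (s.nreg 15) ∧
    HoldsBelow M (fun i k => ¬ Side I r y Δ 1 1 x₁ i (M - 1 - k)) i (s.nreg 16) ∧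
    HoldsBelow M (fun i k => Side I r y Δ (-1) (-1) (D + x₂) i (M - 1 - k)) i (s.nreg 17) ∧
    HoldsBelow M (fun i k => Side I r y Δ (-1) 1 x₃ i k) i (s.nreg 18) ∧
    ((s.nreg 19 = 1 ∧ ∃ i < M, ∃ j < M, Fits D Δ x₁ x₂ x₃ (I.c (r i) (r j)) (y i) (y j) ∧
        s.nreg 20 = r i ∧ s.nreg 21 = r j) ∨
      (s.nreg 19 = 0 ∧ ∀ i' < i, ∀ j < M,
        ¬ Fits D Δ x₁ x₂ x₃ (I.c (r i') (r j)) (y i') (y j)))) ?_ _ ?_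
  · rintro i φ s ⟨hF, h3, hiM, hφ, bA, bB, bC, bD, hres⟩
    have hS := h.frame hF
    simp only [lt, BExp.wp, NExp.wp, h3, hS.count]
    refine ⟨fun hiM' => ?_, fun hiM => ⟨hiM, ?_⟩⟩
    · obtain rfl : i = M := by omega
      exact ⟨hF, hres⟩
    have hmir : ∀ {s : Store 24} {x : Fin 24} {q : ℕ}, s.nreg 9 = M → s.nreg x = q →
        ∀ R : ℕ → Prop, R (M - 1 - q) → (mirror x).wp (I.machine W) s R := by
      intro s x q h1 h2 R hR
      simp only [mirror, NExp.wp, h1, h2, Doap.machine_word]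
      exact ⟨by omega, by omega, by omega, hR⟩
    obtain ⟨qA, hqA, eA, bA', tA⟩ := advance_staircase (m := I.machine W) (s := s) (x := 15)
      (t := .not (side 1 (-1) (.reg 1) (.reg 15))) (c := 100) hA hiM (by decide) hS.count rfl
      (by simp only [Doap.machine_word]; omega) (by decide) bA fun q hq Qt Qf ht hf =>
        side_wp (hS.frame ((Frame.refl _).setN (N := [15]) (R := []) (A := []) (B := [])
          (by decide))) hiM hq (by simpa using h3)
          (fun R hR => by simpa [NExp.wp] using hR)
          (fun R hR => by simpa [RExp.wp, hS.diam] using hR) (fun h => hf (not_not.2 h)) ht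
    set s1 := s.setN 15 qA with hs1
    have hF1 : Frame [15, 16, 17, 18] [] [] [] s s1 := (Frame.refl _).setN (by decide)
    have hS1 := hS.frame hF1
    obtain ⟨qB, hqB, eB, bB', tB⟩ := advance_staircase (m := I.machine W) (s := s1) (x := 16)
      (t := .not (side 1 1 (.reg 6) (mirror 16))) (c := 100) (p := s.nreg 16) hB hiM (by decide)
      hS1.count (by simp [s1])
      (by simp only [Doap.machine_word]; omega) (by decide) bB fun q hq Qt Qf ht hf =>
        have hS' := hS1.frame ((Frame.refl _).setN (N := [16]) (R := []) (A := []) (B := [])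
          (v := q) (by decide))
        side_wp hS' hiM (j := M - 1 - q) (by omega) (by simpa [s1] using h3)
          (hmir hS'.count (by simp)) (k := x₁)
          (fun R hR => by simpa [RExp.wp, hS1.left] using hR) (fun h => hf (not_not.2 h)) ht
    set s2 := s1.setN 16 qB with hs2
    have hF2 : Frame [15, 16, 17, 18] [] [] [] s s2 := hF1.setN (by decide)
    have hS2 := hS.frame hF2
    obtain ⟨qC, hqC, eC, bC', tC⟩ := advance_staircase (m := I.machine W) (s := s2) (x := 17)
      (t := side (-1) (-1) (.add (.reg 1) (.reg 7)) (mirror 17)) (c := 100) (p := s.nreg 17) hC hiM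
      (by decide) hS2.count (by simp [s1, s2])
      (by simp only [Doap.machine_word]; omega) (by decide) bC fun q hq Qt Qf ht hf =>
        have hS' := hS2.frame ((Frame.refl _).setN (N := [17]) (R := []) (A := []) (B := [])
          (v := q) (by decide))
        side_wp hS' hiM (j := M - 1 - q) (by omega) (by simpa [s1, s2] using h3)
          (hmir hS'.count (by simp)) (k := D + x₂)
          (fun R hR => by simpa [RExp.wp, hS2.diam, hS2.right] using hR) ht hf
    set s3 := s2.setN 17 qC with hs3
    have hF3 : Frame [15, 16, 17, 18] [] [] [] s s3 := hF2.setN (by decide)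
    have hS3 := hS.frame hF3
    obtain ⟨qD, hqD, eD, bD', tD⟩ := advance_staircase (m := I.machine W) (s := s3) (x := 18)
      (t := side (-1) 1 (.reg 8) (.reg 18)) (c := 100) (p := s.nreg 18) hD hiM
      (by decide) hS3.count (by simp [s1, s2, s3])
      (by simp only [Doap.machine_word]; omega) (by decide) bD fun q hq Qt Qf ht hf =>
        side_wp (hS3.frame ((Frame.refl _).setN (N := [18]) (R := []) (A := []) (B := [])
          (by decide))) hiM hq (by simpa [s1, s2, s3] using h3)
          (fun R hR => by simpa [NExp.wp] using hR)
          (fun R hR => by simpa [RExp.wp, hS3.cycle] using hR) ht hf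
    set s4 := s3.setN 18 qD with hs4
    have hF4 : Frame [15, 16, 17, 18] [] [] [] s s4 := hF3.setN (by decide)
    have hS4 := hS.frame hF4
    -- Two conditions bound the partner from below and two from above.
    have hiff : ∀ j < M, Fits D Δ x₁ x₂ x₃ (I.c (r i) (r j)) (y i) (y j) ↔
        qA ≤ j ∧ j + qB < M ∧ M ≤ j + qC ∧ j < qD := by
      intro j hj
      have e1 := eA j hj
      have e2 := eB (M - 1 - j) (by omega)
      have e3 := eC (M - 1 - j) (by omega)
      have e4 := eD j hj
      rw [show M - 1 - (M - 1 - j) = j by omega] at e2 e3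
      rw [not_iff_comm, not_lt] at e1 e2
      rw [show qA ≤ j ↔ Side I r y Δ 1 (-1) D i j from e1,
        show j + qB < M ↔ Side I r y Δ 1 1 x₁ i j by rw [← e2]; omega,
        show M ≤ j + qC ↔ Side I r y Δ (-1) (-1) (D + x₂) i j by rw [e3]; omega, ← e4]
      simp only [Side, Rat.cast_one, Rat.cast_neg]
      constructor
      · rintro ⟨a1, a2, a3, a4⟩
        exact ⟨by linarith, by linarith, by linarith, by linarith⟩
      · rintro ⟨a1, a2, a3, a4⟩
        exact ⟨by linarith, by linarith, by linarith, by linarith⟩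
    have l1 := bA'.1
    have l2 := bB'.1
    have l3 := bC'.1
    have l4 := bD'.1
    refine ⟨qA + qB + qC + qD, by omega, by omega, ?_⟩
    refine Tri.mono (T := (100 + (qA - s.nreg 15) * 100) + ((100 + (qB - s.nreg 16) * 100) +
      ((100 + (qC - s.nreg 17) * 100) + ((100 + (qD - s.nreg 18) * 100) + 80)))) ?_ (by omega)
      fun _ h => h
    refine tA.seq ?_
    rintro _ rfl
    refine tB.seq ?_
    rintro _ rfl
    refine tC.seq ?_
    rintro _ rfl
    refine tD.seq ?_
    rintro _ rfl
    have g9 := hS4.count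
    have g3 : s4.nreg 3 = i := (hF4.nreg 3 (by decide)).trans h3
    have g15 : s4.nreg 15 = qA := by simp [s4, s3, s2, s1]
    have g16 : s4.nreg 16 = qB := by simp [s4, s3, s2]
    have g17 : s4.nreg 17 = qC := by simp [s4, s3]
    have g18 : s4.nreg 18 = qD := by simp [s4]
    have g19 : s4.nreg 19 = s.nreg 19 := hF4.nreg 19 (by decide)
    have g20 : s4.nreg 20 = s.nreg 20 := hF4.nreg 20 (by decide)
    have g21 : s4.nreg 21 = s.nreg 21 := hF4.nreg 21 (by decide)
    have hF5 : Frame [3, 10, 15, 16, 17, 18, 19, 20, 21] [] [] [] s₀ s4 := hF.trans hF4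
    -- The smallest number that meets both lower bounds; if it violates an upper bound, so do all
    -- others.
    obtain ⟨j, hj⟩ : ∃ j, j = max qA (M - qC) := ⟨_, rfl⟩
    have hfits : ∀ j' < M, Fits D Δ x₁ x₂ x₃ (I.c (r i) (r j')) (y i) (y j') →
        j < qD ∧ j + qB < M := fun j' hj' hf => by
      have := (hiff j' hj').1 hf
      omega
    refine Tri.mono (T := 4 + (20 + 56)) ?_ (by omega) fun _ h => h
    refine Tri.seq (R := fun s5 => s5 = s4.setN 10 (M - qC)) ((Tri.of_wp _ ?_).mono (by decide)
      fun _ h => h) fun s5 hs5 => ?_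
    · simp only [Stmt.wp, NExp.wp, g9, g17, Doap.machine_word]
      exact ⟨by omega, trivial⟩
    refine Tri.seq (R := fun s6 => Frame [10] [] [] [] s4 s6 ∧ s6.nreg 10 = j)
      ((Tri.of_wp _ ?_).mono (by decide) fun _ h => h) fun s6 ⟨hF6, h10⟩ => ?_
    · subst hs5
      simp only [Stmt.wp, lt, BExp.wp, NExp.wp, Store.setN_nreg, Fin.reduceEq, if_true, if_false,
        g15]
      exact ⟨fun h => ⟨(Frame.refl _).setN (by decide), by omega⟩,
        fun h => ⟨((Frame.refl _).setN (by decide)).setN (by decide), by omega⟩⟩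
    refine (Tri.of_wp _ ?_).mono (by decide) fun _ h => h
    have hS6 := hS4.frame hF6
    have hF7 := hF5.trans hF6
    have k9 := hS6.count
    have k3 := (hF6.nreg 3 (by decide)).trans g3
    have k15 := (hF6.nreg 15 (by decide)).trans g15
    have k16 := (hF6.nreg 16 (by decide)).trans g16
    have k17 := (hF6.nreg 17 (by decide)).trans g17
    have k18 := (hF6.nreg 18 (by decide)).trans g18
    have k19 := (hF6.nreg 19 (by decide)).trans g19
    have k20 := (hF6.nreg 20 (by decide)).trans g20
    have k21 := (hF6.nreg 21 (by decide)).trans g21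
    have hci := hS6.center i hiM
    have hnot : ¬ (j < qD ∧ j + qB < M) → (incr 3).wp (I.machine W) (fun s' =>
        Frame [3, 10, 15, 16, 17, 18, 19, 20, 21] [] [] [] s₀ s' ∧ s'.nreg 3 = i + 1 ∧ i + 1 ≤ M ∧
        s'.nreg 15 + s'.nreg 16 + s'.nreg 17 + s'.nreg 18 = qA + qB + qC + qD ∧
        HoldsBelow M (fun i k => ¬ Side I r y Δ 1 (-1) D i k) (i + 1) (s'.nreg 15) ∧
        HoldsBelow M (fun i k => ¬ Side I r y Δ 1 1 x₁ i (M - 1 - k)) (i + 1) (s'.nreg 16) ∧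
        HoldsBelow M (fun i k => Side I r y Δ (-1) (-1) (D + x₂) i (M - 1 - k)) (i + 1)
          (s'.nreg 17) ∧
        HoldsBelow M (fun i k => Side I r y Δ (-1) 1 x₃ i k) (i + 1) (s'.nreg 18) ∧
        ((s'.nreg 19 = 1 ∧ ∃ i < M, ∃ j < M, Fits D Δ x₁ x₂ x₃ (I.c (r i) (r j)) (y i) (y j) ∧
            s'.nreg 20 = r i ∧ s'.nreg 21 = r j) ∨
          (s'.nreg 19 = 0 ∧ ∀ i' < i + 1, ∀ j < M,
            ¬ Fits D Δ x₁ x₂ x₃ (I.c (r i') (r j)) (y i') (y j)))) s6 := fun hno => by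
      simp only [incr, Stmt.wp, NExp.wp, k3, Doap.machine_word]
      refine ⟨by omega, by omega, hF7.setN (by decide), by simp, hiM, ?_⟩
      simp only [Store.setN_nreg, Fin.reduceEq, if_false, k15, k16, k17, k18, k19, k20, k21]
      refine ⟨trivial, bA', bB', bC', bD', hres.imp id fun ⟨h0, hno'⟩ => ⟨h0, fun i' hi' j' hj' hf => ?_⟩⟩
      rcases Nat.lt_succ_iff_lt_or_eq.1 hi' with h1 | rfl
      · exact hno' i' h1 j' hj' hf
      · exact hno (hfits j' hj' hf)
    simp only [Stmt.wp, lt, BExp.wp, NExp.wp, h10, k18, k16, k9, Doap.machine_word]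
    refine ⟨fun h1 => hnot (by omega), fun h1 => ⟨?_, fun h2 => hnot (by omega), fun h2 => ?_⟩⟩
    · omega
    have hcj := hS6.center j (by omega)
    simp only [incr, Stmt.wp, NExp.wp, Store.setN_nreg, Store.setN_narr, Fin.reduceEq, if_false,
      k3, h10, hci, hcj, Doap.machine_word, Doap.machine_size]
    refine ⟨by omega, by omega, by omega, by omega, by omega, (((hF7.setN (by decide)).setN
      (by decide)).setN (by decide)).setN (by decide), by simp, hiM, ?_⟩
    simp only [if_true, k15, k16, k17, k18]
    exact ⟨trivial, bA', bB', bC', bD', .inl ⟨trivial, i, hiM, j, by omega,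
      (hiff j (by omega)).2 (by omega), rfl, rfl⟩⟩
  · refine ⟨((((((Frame.refl _).setN (by decide)).setN (by decide)).setN (by decide)).setN
      (by decide)).setN (by decide)).setN (by decide), by simp, by omega, by simp, ?_⟩
    simp [HoldsBelow]

end

end Prog

/-! ### Binary search for the optimal diameter -/

namespace Doap

variable {n : ℕ} {I : Doap n} {a b : Fin n} {η : ℝ} {cl : Fin n → ℕ} {M : ℕ} {rep : ℕ → ℕ}
  {y P Q : ℕ → ℝ}

theorem Clusters.mono (h : I.Clusters a b η (fun _ => True) cl M rep y) (hη : 0 < η) {i j : ℕ}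
    (hij : i ≤ j) (hj : j < M) : y i ≤ y j := by
  rcases hij.eq_or_lt with rfl | hlt
  · exact le_rfl
  · linarith [h.strictMono hη hlt hj]

/-- Vertices of the path are at most the difference of their positions apart in the tree, hence in
`c`; the rest is the triangle inequality of the metric. -/
theorem MetricTree.abs_c_sub_le (h : I.MetricTree) {u v : Fin n} (hu : I.height a b u = 0)
    (hv : I.height a b v = 0) (huv : I.pos a b u ≤ I.pos a b v) (w : Fin n) :
    |I.c u w - I.c v w| ≤ I.pos a b v - I.pos a b u ∧
      |I.c w u - I.c w v| ≤ I.pos a b v - I.pos a b u := by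
  have h1 := (h.c_le u v).trans (h.dist_le_height a b u v)
  rw [hu, hv, abs_of_nonpos (by linarith)] at h1
  have h2 := h.c_triangle u v w
  have h3 := h.c_triangle v u w
  have h4 := h.c_comm u v
  have h5 := h.c_comm u w
  have h6 := h.c_comm v w
  constructor <;> rw [abs_le] <;> constructor <;> linarith

end Doap

namespace Prog

/-- Decide whether the middle of the interval is feasible, and halve the interval. -/
def optimizeBody : Stmt 24 :=
  .rset 5 (.div (.add (.reg 3) (.reg 4)) (.const 2)) ;; bounds ;; search ;;
    .ite (.nle (.const 1) (.reg 19))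
      (.rset 4 (.reg 5) ;; .nset 22 (.reg 20) ;; .nset 23 (.reg 21)) (.rset 3 (.reg 5))

/-- Find a good shortcut by binary search. -/
def optimize : Stmt 24 :=
  (.rset 3 (.const 0) ;; .rset 4 (.reg 1) ;; .nset 22 (.reg 2) ;; .nset 23 (.reg 12)) ;;
    .loop (rlt (.reg 2) (.sub (.reg 4) (.reg 3))) optimizeBody ;;
    .nset 0 (.reg 22) ;; .nset 1 (.reg 23)

section

open Doap

variable {n : ℕ} {I : Doap n} {W : ℕ} {s₀ : Store 24} {a b : Fin n} {η : ℝ}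

/-- The interval `[lo, hi]`, and the shortcut from `u` to `v`, in the course of the binary search. -/
structure Bracket (I : Doap n) (a b : Fin n) (η lo hi : ℝ) (u v : Fin n) : Prop where
  le : hi ≤ I.dist a b
  ne : u ≠ v
  diam : ∀ e f, I.diamWith u v ≤ max hi (I.diamWith e f)
  lt : ∀ e f, I.diamWith e f < I.dist a b → lo < I.diamWith e f + 6 * η

/-- Six widths come from the gap between `lo` and the optimum, the seventh from the length of the
interval. A shortcut that does not improve on the tree is beaten because `hi` is at most `I.dist a
b`. -/
theorem Bracket.diamWith_le {lo hi : ℝ} {u v : Fin n} (h : Bracket I a b η lo hi u v)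
    (hη : 0 < η) (hlh : hi - lo ≤ η) (e f : Fin n) :
    I.diamWith u v ≤ I.diamWith e f + 7 * η := by
  rcases le_max_iff.1 (h.diam e f) with h1 | h1
  · rcases lt_or_ge (I.diamWith e f) (I.dist a b) with h2 | h2
    · linarith [h.lt e f h2]
    · linarith [h.le]
  · linarith

/-- The registers that are changed by `optimizeBody`. -/
abbrev OptFrame (s s' : Store 24) : Prop :=
  Frame [3, 10, 14, 15, 16, 17, 18, 19, 20, 21, 22, 23] [3, 4, 5, 6, 7, 8] [] [] s s'

theorem optimizeBody_spec (hW : 2 * n + 2 ≤ W) (hM : I.MetricTree) (he : I.Ends a b) (hη : 0 < η)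
    {cl : Fin n → ℕ}
    (hS : I.Summary a b η cl (s₀.nreg 9) (s₀.narr 6) (s₀.rarr 4) (s₀.rarr 5) (s₀.rarr 6))
    (h1 : s₀.rreg 1 = I.dist a b) {u v : Fin n} (h22 : s₀.nreg 22 = u) (h23 : s₀.nreg 23 = v)
    (hlt : s₀.rreg 3 < s₀.rreg 4) (hB : Bracket I a b η (s₀.rreg 3) (s₀.rreg 4) u v) :
    Tri (I.machine W) optimizeBody s₀ (1500 * s₀.nreg 9 + 1520) fun s => OptFrame s₀ s ∧
      s.rreg 4 - s.rreg 3 = (s₀.rreg 4 - s₀.rreg 3) / 2 ∧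
      ∃ u v : Fin n, s.nreg 22 = u ∧ s.nreg 23 = v ∧
        Bracket I a b η (s.rreg 3) (s.rreg 4) u v := by
  have hMn := hS.clusters.le_card
  have hcen := fun l (hl : l < s₀.nreg 9) => hS.clusters.center l hl
  have : Nonempty (Fin n) := ⟨a⟩
  choose! r _ hr1 hr2 hr3 hr4 using hcen
  generalize hMe : s₀.nreg 9 = M at *
  generalize hPe : s₀.rarr 5 = P at *
  generalize hQe : s₀.rarr 6 = Q at *
  generalize hye : s₀.rarr 4 = y at *
  obtain ⟨mid, hmid⟩ : ∃ mid, mid = (s₀.rreg 3 + s₀.rreg 4) / 2 := ⟨_, rfl⟩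
  have hmidD : mid < I.dist a b := by linarith [hB.le]
  refine Tri.mono (T := 6 + ((500 * M + 500) + ((1000 * M + 1000) + 13))) ?_ (by omega)
    fun _ h => h
  refine Tri.seq (R := fun s1 => s1 = s₀.setR 5 mid) ((Tri.of_wp _ ?_).mono (by decide)
    fun _ h => h) fun s1 hs1 => ?_
  · simp only [Stmt.wp, RExp.wp]
    rw [hmid]
    norm_num
  have hF1 : OptFrame s₀ s1 := by
    rw [hs1]
    exact (Frame.refl _).setR (by decide)
  have k5 : s1.rreg 5 = mid := by simp [hs1]
  have k3 : s1.rreg 3 = s₀.rreg 3 := by simp [hs1]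
  have k4 : s1.rreg 4 = s₀.rreg 4 := by simp [hs1]
  have k22 : s1.nreg 22 = u := by simpa [hs1] using h22
  have k23 : s1.nreg 23 = v := by simpa [hs1] using h23
  refine (bounds_spec (by omega) hMn ((hF1.nreg 9 (by decide)).trans hMe)
    ((hF1.rreg 1 (by decide)).trans h1) k5 ((hF1.rarr 5 (by decide)).trans hPe)
    ((hF1.rarr 6 (by decide)).trans hQe) (fun _ _ => hS.left_mono)
    fun _ _ => hS.right_anti).seq fun s2 ⟨hF2, hbd⟩ => ?_
  have hF02 : OptFrame s₀ s2 := hF1.trans hF2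
  have hsr : Searchable I M r y (I.dist a b) mid (s2.rreg 6) (s2.rreg 7) (s2.rreg 8) s2 :=
    ⟨hMn, (hF02.nreg 9 (by decide)).trans hMe,
      fun l hl => by rw [hF02.narr 6 (by decide), hr1 l hl], (hF02.rarr 4 (by decide)).trans hye,
      (hF02.rreg 1 (by decide)).trans h1, (hF2.rreg 5 (by decide)).trans k5, rfl, rfl, rfl⟩
  refine (search_spec hW hsr fun i j k hij hj hk => ?_).seq
    fun s3 ⟨hF3, hres⟩ => (Tri.of_wp _ ?_).mono (by decide) fun _ h => h
  · have := hM.abs_c_sub_le (hr3 i (by omega)) (hr3 j hj)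
      (by rw [hr2 i (by omega), hr2 j hj]; exact hS.clusters.mono hη hij hj) (r k)
    rwa [hr2 i (by omega), hr2 j hj] at this
  have hF03 : OptFrame s₀ s3 := hF02.trans hF3
  have l3 : s3.rreg 3 = s₀.rreg 3 := by
    rw [hF3.rreg 3 (by decide), hF2.rreg 3 (by decide), k3]
  have l4 : s3.rreg 4 = s₀.rreg 4 := by
    rw [hF3.rreg 4 (by decide), hF2.rreg 4 (by decide), k4]
  have l5 : s3.rreg 5 = mid := by
    rw [hF3.rreg 5 (by decide), hF2.rreg 5 (by decide), k5]
  have l22 : s3.nreg 22 = u := by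
    rw [hF3.nreg 22 (by decide), hF2.nreg 22 (by decide), k22]
  have l23 : s3.nreg 23 = v := by
    rw [hF3.nreg 23 (by decide), hF2.nreg 23 (by decide), k23]
  simp only [Stmt.wp, BExp.wp, RExp.wp, NExp.wp, Doap.machine_word, Store.setR_nreg,
    Store.setN_nreg, Fin.reduceEq, if_false, l5]
  refine ⟨by omega, fun h => ?_, fun h => ?_⟩
  · rcases hres with ⟨-, i, hi, j, hj, hf, e20, e21⟩ | ⟨h0, -⟩
    swap
    · omega
    refine ⟨((hF03.setR (by decide)).setN (by decide)).setN (by decide), ?_, r i, r j, ?_, ?_,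
      hmidD.le, ?_, ?_, ?_⟩
    · simp [l3, hmid]
      ring
    · simpa using e20
    · simpa using e21
    -- For equal centres the condition `ends` would give `I.dist a b ≤ mid`, because weights are
    -- nonnegative.
    · intro hij
      have h2 := hf.ends
      have h3 := I.c_nonneg (r i) (r j)
      have h4 := hr2 i hi
      rw [hij, hr2 j hj] at h4
      linarith
    · intro e f
      simpa using hM.diamWith_le_max he (hr3 i hi) (hr3 j hj)
        (hS.good_of_fits hbd (hr2 i hi) (hr2 j hj) hf) e f
    · intro e f hef
      simpa [l3] using hB.lt e f hef
  · rcases hres with ⟨h0, -⟩ | ⟨-, hno⟩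
    · omega
    refine ⟨hF03.setR (by decide), ?_, u, v, ?_, ?_, ?_, hB.ne, ?_, ?_⟩
    · simp [l4, hmid]
      ring
    · simpa using l22
    · simpa using l23
    · simpa [l4] using hB.le
    · simpa [l4] using hB.diam
    · intro e f hef
      simp only [Store.setR_rreg, if_true]
      -- If some shortcut had a diameter of at most `mid - 6 * η`, the centres of the clusters of
      -- its ends would have passed the test.
      by_contra! hcon
      obtain ⟨e', f', hg⟩ := hM.exists_good he hef
      have he' := hS.clusters.lt e' trivial
      have hf' := hS.clusters.lt f' trivial
      exact hno _ he' _ hf' (hS.fits_of_good hbd hM hη hg hcon hmidD (hr2 _ he') (hr3 _ he')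
        (hr2 _ hf') (hr3 _ hf'))

theorem optimize_spec (hW : 2 * n + 2 ≤ W) (hM : I.MetricTree) (hab : a ≠ b) (he : I.Ends a b)
    (hη : 0 < η) {cl : Fin n → ℕ}
    (hS : I.Summary a b η cl (s₀.nreg 9) (s₀.narr 6) (s₀.rarr 4) (s₀.rarr 5) (s₀.rarr 6))
    (h1 : s₀.rreg 1 = I.dist a b) (h2r : s₀.rreg 2 = η) (h2 : s₀.nreg 2 = a) (h12 : s₀.nreg 12 = b)
    {N : ℕ} (hN : I.dist a b ≤ η * 2 ^ N) :
    Tri (I.machine W) optimize s₀ ((N + 1) * (1500 * s₀.nreg 9 + 1530) + 20) fun s =>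
      ∃ u v : Fin n, s.nreg 0 = u ∧ s.nreg 1 = v ∧ u ≠ v ∧
        ∀ e f, I.diamWith u v ≤ I.diamWith e f + 7 * η := by
  have hD := hM.dist_pos a b hab
  refine Tri.mono (T := 8 + ((N + 1) * (1500 * s₀.nreg 9 + 1530) + 4)) ?_ (by omega) fun _ h => h
  refine Tri.wp_seq ?_
  simp only [Stmt.wp, RExp.wp, NExp.wp, Store.setR_rreg, Store.setR_nreg, Store.setN_nreg,
    Fin.reduceEq, if_false, h1, h2, h12]
  refine Tri.seq (R := fun s => ∃ u v : Fin n, s.nreg 22 = u ∧ s.nreg 23 = v ∧ u ≠ v ∧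
    ∀ e f, I.diamWith u v ≤ I.diamWith e f + 7 * η)
    (Tri.loop_le N (1500 * s₀.nreg 9 + 1520) _ (by simp [rlt, BExp.cost, RExp.cost])
    (fun i s => OptFrame s₀ s ∧ s.rreg 4 - s.rreg 3 = I.dist a b / 2 ^ i ∧
      ∃ u v : Fin n, s.nreg 22 = u ∧ s.nreg 23 = v ∧
        Bracket I a b η (s.rreg 3) (s.rreg 4) u v) ?_ _ ?_) ?_
  · rintro i s ⟨hF, hi, u, v, h22, h23, hB⟩
    simp only [rlt, BExp.wp, RExp.wp, hF.rreg 2 (by decide), h2r, hi]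
    refine ⟨fun h => ⟨u, v, h22, h23, hB.ne, hB.diamWith_le hη (hi.trans_le h)⟩, fun h => ⟨?_, ?_⟩⟩
    -- After `N` halvings the interval is no longer than `η`, so the loop has stopped by then.
    · by_contra! hNi
      rw [lt_div_iff₀ (by positivity)] at h
      have : (2 : ℝ) ^ N ≤ 2 ^ i := pow_le_pow_right₀ (by norm_num) hNi
      nlinarith
    · have hS' := hS
      rw [← hF.nreg 9 (by decide), ← hF.narr 6 (by decide), ← hF.rarr 4 (by decide),
        ← hF.rarr 5 (by decide), ← hF.rarr 6 (by decide)] at hS'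
      refine (optimizeBody_spec hW hM he hη hS' ((hF.rreg 1 (by decide)).trans h1) h22 h23
        (by linarith [div_pos hD (pow_pos (two_pos (α := ℝ)) i)]) hB).mono
        (by rw [hF.nreg 9 (by decide)]) fun s' ⟨hF', hi', hB'⟩ => ⟨hF.trans hF', ?_, hB'⟩
      rw [hi', hi, pow_succ]
      field_simp
  · refine ⟨((((Frame.refl _).setR (by decide)).setR (by decide)).setN (by decide)).setN
      (by decide), by simp, a, b, by simp, by simp, ?_⟩
    refine ⟨by simp, hab, fun e f => le_max_of_le_left ?_, fun e f _ => ?_⟩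
    · simpa using hM.diamWith_le_dist he a b
    -- The lower end `0` is valid since every diameter is at least a third of the positive length
    -- `I.dist a b`.
    · have := hM.dist_le_three_mul e f a b
      simp only [Store.setN_rreg, Store.setR_rreg, Fin.reduceEq, if_false, if_true, Rat.cast_zero]
      linarith
  · rintro s ⟨u, v, h22, h23, huv, hd⟩
    refine Tri.of_wp _ ?_
    simp only [Stmt.wp, NExp.wp, Store.setN_nreg, Fin.reduceEq, if_false, if_true, h22, h23]
    exact ⟨u, v, rfl, rfl, huv, hd⟩

end

end Prog

/-! ### The running time -/

namespace Doap

/-- With `x = 1 / ε`, `K` bounds the number of clusters and `N` the number of rounds of the binary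
search. -/
theorem exists_rounds {x : ℝ} (hx : 0 < x) {n : ℕ} (hn : 2 ≤ n) : ∃ K N : ℕ, 21 * x + 1 ≤ K ∧
    21 * x ≤ 2 ^ N ∧ (2000 * n + 2018 + (300 * n + 500 + ((N + 1) * (1500 * K + 1530) + 20)) : ℝ) ≤
      500000 * (n + x * Real.log x) := by
  have hn' : (2 : ℝ) ≤ n := by exact_mod_cast hn
  rcases le_or_gt x 2 with hx2 | hx2
  -- For `x ≤ 2` constants do: `43 = 21 * 2 + 1` and `2 ^ 6 ≥ 42`. Here `x * Real.log x` may be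
  -- negative, but it is at least `x - 1 > -1`, which `n ≥ 2` absorbs.
  · refine ⟨43, 6, by norm_num; linarith, by norm_num; linarith, ?_⟩
    have h1 := Real.one_sub_inv_le_log_of_pos hx
    have h2 : x - 1 ≤ x * Real.log x := by
      have := mul_le_mul_of_nonneg_left h1 hx.le
      rwa [mul_sub, mul_one, mul_inv_cancel₀ hx.ne'] at this
    norm_num
    linarith
  · have hlog2 := Real.log_two_gt_d9
    have hlogx : Real.log 2 ≤ Real.log x := Real.log_le_log (by norm_num) hx2.le
    have hceil := Nat.ceil_lt_add_one (show 0 ≤ 21 * x by positivity)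
    have hceil' := Nat.le_ceil (21 * x)
    set m := ⌈21 * x⌉₊ with hm
    have hm1 : 1 < m := by
      have : (1 : ℝ) < m := by linarith
      exact_mod_cast this
    have hNm : (m : ℝ) ≤ 2 ^ Nat.clog 2 m := by exact_mod_cast Nat.le_pow_clog one_lt_two m
    have hmN : (2 : ℝ) ^ (Nat.clog 2 m - 1) < m := by
      exact_mod_cast Nat.pow_pred_clog_lt_self one_lt_two hm1
    have hN0 : 0 < Nat.clog 2 m := Nat.clog_pos one_lt_two hm1
    set N := Nat.clog 2 m with hN
    refine ⟨m + 1, N, by push_cast; linarith, hceil'.trans hNm, ?_⟩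
    have h1 : ((N : ℝ) - 1) * Real.log 2 ≤ 5 * Real.log 2 + Real.log x := by
      -- `2 ^ (N - 1) < m < 21 * x + 1 ≤ 32 * x`, the last step because `x > 2`.
      have h2 : (2 : ℝ) ^ (N - 1) ≤ 2 ^ 5 * x := by norm_num; linarith
      have h3 := Real.log_le_log (by positivity) h2
      rw [Real.log_mul (by positivity) (by positivity), Real.log_pow, Real.log_pow,
        Nat.cast_sub hN0] at h3
      push_cast at h3
      exact h3
    -- The additive constants are absorbed because `Real.log x ≥ Real.log 2`.
    have h2 : (N : ℝ) + 1 ≤ 12 * Real.log x := by nlinarith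
    have h3 : (1500 * ((m + 1 : ℕ) : ℝ) + 1530) ≤ 34000 * x := by push_cast; linarith
    have h4 : ((N : ℝ) + 1) * (1500 * ((m + 1 : ℕ) : ℝ) + 1530) ≤ 12 * Real.log x * (34000 * x) :=
      mul_le_mul h2 h3 (by positivity) (by linarith)
    have h5 : 0 ≤ x * Real.log x := by
      have : 0 ≤ Real.log x := by linarith
      positivity
    nlinarith

theorem loaded_input {n : ℕ} (I : Doap n) (L : EdgeList I.tree) (ε : ℝ) :
    I.Loaded L (I.input L ε 22) := by
  constructor <;> intros <;> simp [Doap.input]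

end Doap

/-! ### The complete program -/

namespace Prog

section

open Doap

variable {n : ℕ} {I : Doap n} {L : EdgeList I.tree} {W : ℕ} {s₀ : Store 24}

/-- The program. -/
def main : Stmt 24 := ends ;; cluster ;; optimize

theorem main_spec (h2n : 2 ≤ n) (hW : n * n + 2 * n + 2 ≤ W) (hI : I.EmbeddedInMetric)
    (hL : I.Loaded L s₀) {ε : ℝ} (hε : 0 < ε) (hs : s₀.rreg 0 = ε) {K N : ℕ}
    (hK : 21 * (1 / ε) + 1 ≤ K) (hN : 21 * (1 / ε) ≤ 2 ^ N) :
    Tri (I.machine W) main s₀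
      (2000 * n + 2018 + (300 * n + 500 + ((N + 1) * (1500 * K + 1530) + 20))) fun s =>
        ∃ u v : Fin n, s.nreg 0 = u ∧ s.nreg 1 = v ∧ I.IsApproxSolution ε u v := by
  have hW' : 2 * n + 2 ≤ W := by have := Nat.zero_le (n * n); omega
  refine (ends_spec h2n hW hI hL).seq fun s1 ⟨hF1, hM, a, b, hab, he, h2, h12, ⟨par, rank, hO⟩,
    hda, hdb⟩ => ?_
  have hD := hM.dist_pos a b hab
  obtain ⟨η, hη⟩ : ∃ η, η = ε * I.dist a b / 21 := ⟨_, rfl⟩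
  have hη0 : 0 < η := by rw [hη]; positivity
  have hDη : I.dist a b = 21 * (1 / ε) * η := by rw [hη]; field_simp
  refine (cluster_spec h2n hW' hM hab (hL.frame hF1) hO h2 h12 hda hdb hε
    ((hF1.rreg 0 (by decide)).trans hs) hη).seq fun s2 ⟨hF2, hr1, hr2, cl, hS⟩ => ?_
  have hMK : s2.nreg 9 ≤ K := by
    have h3 := hS.clusters.mul_le hM he
    rw [hDη] at h3
    have h4 := le_of_mul_le_mul_right h3 hη0
    have : (s2.nreg 9 : ℝ) ≤ K := by linarith
    exact_mod_cast this
  refine (optimize_spec hW' hM hab he hη0 hS hr1 hr2 ((hF2.nreg 2 (by decide)).trans h2)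
    ((hF2.nreg 12 (by decide)).trans h12) (N := N) ?_).mono ?_ ?_
  · rw [hDη, mul_comm]
    exact mul_le_mul_of_nonneg_left hN hη0.le
  · gcongr
  · rintro s ⟨u, v, h0, h1, huv, hd⟩
    refine ⟨u, v, h0, h1, huv, fun e f => (hd e f).trans ?_⟩
    -- The additive error `7 * η = ε * I.dist a b / 3` is at most `ε` times the diameter for the
    -- shortcut `e`, `f`.
    have h3 := mul_le_mul_of_nonneg_left (hM.dist_le_three_mul e f a b) hε.le
    linarith

end

end Prog

/-- One fixed program, with constants independent of the input, computes `(1 + ε)`-approximate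
solutions in time `O(n + (1/ε) log (1/ε))` and space `O(n + 1/ε)`, with integers of
`O(log (n + 1/ε))` bits; the solution is left in the integer registers `0` and `1`. -/
theorem mainTheorem4 :
    ∃ (k : ℕ) (P : Stmt (k + 2)) (C : ℕ),
      ∀ (n : ℕ), 2 ≤ n → ∀ (I : Doap n), I.EmbeddedInMetric →
      ∀ (L : EdgeList I.tree) (ε : ℝ), 0 < ε →
      ∃ (size word t : ℕ) (s' : Store (k + 2)) (u v : Fin n),
        Exec ⟨n, I.c, size, word⟩ P (I.input L ε k) t s' ∧
        s'.nreg 0 = (u : ℕ) ∧ s'.nreg 1 = (v : ℕ) ∧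
        I.IsApproxSolution ε u v ∧
        (t : ℝ) ≤ C * (n + 1 / ε * Real.log (1 / ε)) ∧
        ((Machine.cells ⟨n, I.c, size, word⟩ (k + 2) : ℕ) : ℝ) ≤ C * (n + 1 / ε) ∧
        (word : ℝ) ≤ (n + 1 / ε + 1) ^ C := by
  refine ⟨22, Prog.main, 500000, fun n hn I hI L ε hε => ?_⟩
  obtain ⟨K, N, hK, hN, hT⟩ := Doap.exists_rounds (one_div_pos.2 hε) hn
  obtain ⟨t, s', hE, ht, u, v, hu, hv, hA⟩ := Prog.main_spec hn le_rfl hI (I.loaded_input L ε) hε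
    (by simp [Doap.input]) hK hN
  have hx : 0 < 1 / ε := one_div_pos.2 hε
  have hn' : (2 : ℝ) ≤ n := by exact_mod_cast hn
  -- Arrays of `n` cells suffice even for the clusters, as their centres are distinct vertices. The
  -- word size is dictated by the sums of edge numbers.
  refine ⟨n, n * n + 2 * n + 2, t, s', u, v, hE, hu, hv, hA, ?_, ?_, ?_⟩
  · refine le_trans (Nat.cast_le.2 ht) (le_trans (le_of_eq ?_) hT)
    push_cast
    ring
  · simp only [Machine.cells]
    push_cast
    linarith
  · have h1 : (1 : ℝ) ≤ n + 1 / ε + 1 := by linarith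
    -- A cube already dominates the quadratic word size; the exponent is large only because one
    -- constant serves all three bounds.
    refine le_trans ?_ (pow_le_pow_right₀ h1 (show 3 ≤ 500000 by norm_num))
    have h2 : (n + 1 : ℝ) ^ 3 ≤ (n + 1 / ε + 1) ^ 3 := by gcongr; linarith
    refine le_trans ?_ h2
    push_cast
    nlinarith
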